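/- Let $G$ be a Lie group (real, finite-dimensional, Hausdorff; possibly non-compact, not necessarily second countable) and $F=\mathbb R$ or $\mathbb C$. **The classifying space.** Let $F^{(\infty)}=\varinjlim F^k$. For a finite set $S$, let $\mathcal C(S)$ be the topological category whose objects are the families $(A_s,V_s)_{s\in S}$, where the $A_s$ are pairwise disjoint finite subsets of $\mathbb N$ and $V_s$ is a $\#A_s$-dimensional linear subspace of $(F^{(\infty)})^{A_s}$, and whose morphisms from $(A_s,V_s)_{s}$ to $(B_s,W_s)_{s}$ are the families of linear isomorphisms $V_s\to W_s$, $s\in S$; the space of morphisms is topologized as the quotient of the space of pairs of (families of) frames. If $\gamma$ maps each $s\in S$ to a subset $\gamma(s)$ of a finite set $T$, with $\gamma(s)\cap\gamma(s')=\emptyset$ for $s\ne s'$, direct sums over the sets $\gamma(s)$ define a functor $\mathcal C(T)\to\mathcal C(S)$. Let $\mathcal EG$ be the topological category with space of objects $G$ and exactly one morphism between any two objects (space of morphisms $G\times G$). Let $\underline{\mathrm{vec}}(S)=|\mathrm{Func}(\mathcal EG,\mathcal C(S))|$ be the (thin) geometric realization of the nerve, formed in k-spaces, of the category of continuous functors $\mathcal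 EG\to\mathcal C(S)$ and continuous natural transformations; right multiplication on $\mathcal EG$ makes it a left $G$-space. Let $B$ be the thick geometric realization (identifications along injective maps only) of the simplicial $G$-space $[n]\mapsto\underline{\mathrm{vec}}(\{1,\dots,n\})$, where a non-decreasing map $\delta:[n]\to[m]$ acts through $\gamma(k)=\{j:\delta(k-1)<j\le\delta(k)\}$. It is pointed by the point $\underline{\mathrm{vec}}(\emptyset)$. Set $KF_G^{[\infty]}:=\Omega B$, with the k-space topology and the induced $G$-action. **The functors.** A $G$-CW-pair $(X,A)$ consists of a $G$-CW-complex $X$ (cells $(G/H)\times D^n$ with $H$ a closed subgroup of $G$) and a $G$-subspace $A$ such that $A$ is a $G$-CW-complex and $(X,A)$ is a relative $G$-CW-complex. For $n\ge 0$ let $$KF_G^{-n}(X,A):=\bigl[\Sigma^n(X/A),KF_G^{[\infty]}\bigr]_G^{\bullet}$$ be the set of pointed $G$-homotopy classes of pointed $G$-maps, where $X/\emptyset$ is $X$ with a disjoint base point added, and let $KF_G^{-n}(X):=KF_G^{-n}(X,\emptyset)$. A map of pairs $f:(X,A)\to(Y,B)$ (a continuous $G$-map $X\to Y$ with $f(A)\subset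 B$) induces $f^*:KF_G^{-n}(Y,B)\to KF_G^{-n}(X,A)$. **Proposition.** Pointwise concatenation of loops makes every $KF_G^{-n}(X,A)$ an abelian group, and $KF_G^{*}(-)$ is a good equivariant cohomology theory in negative degrees on the category of $G$-CW-pairs, that is: 1. (Functoriality) For every $n\ge 0$, $KF_G^{-n}$ is a contravariant functor from $G$-CW-pairs and maps of pairs to abelian groups. 2. (Homotopy invariance) If $f_0,f_1:(X,A)\to(Y,B)$ are $G$-homotopic through maps of pairs, then $f_0^*=f_1^*$. 3. (Excision) If $f:(X,A)\to(Y,B)$ is a map of $G$-CW-pairs that exhibits $Y$ as the push-out of $X$ and $B$ along $A$, then $f^*:KF_G^{-n}(Y,B)\to KF_G^{-n}(X,A)$ is an isomorphism for every $n\ge0$. 4. (Disjoint unions) If $(Y,B)$ is the disjoint union of a family of $G$-CW-pairs $(X_i,A_i)$, then the inclusions induce isomorphisms $KF_G^{-n}(Y,B)\cong\prod_i KF_G^{-n}(X_i,A_i)$ for every $n\ge 0$. 5. (Long exact sequences) There are homomorphisms $\delta:KF_G^{-n-1}(A)\to KF_G^{-n}(X,A)$, natural in the $G$-CW-pair $(X,A)$,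 such that the sequence $$\cdots\to KF_G^{-n-1}(X)\to KF_G^{-n-1}(A)\xrightarrow{\ \delta\ }KF_G^{-n}(X,A)\to KF_G^{-n}(X)\to KF_G^{-n}(A)\to\cdots\to KF_G^{0}(X,A)\to KF_G^{0}(X)\to KF_G^{0}(A)$$ is exact. -/

import Mathlib

open scoped unitInterval Manifold ContDiff

universe u v w

noncomputable section

namespace EquivKTheory

/-! ## The topological categories of labelled subspaces -/

section LabelledSubspaces

variable (F : Type w) [RCLike F]

/-- The inner product space `(F^(∞))^(∞)`: the coordinate `(a, j)` is the `j`-th coordinate of the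
component of label `a`. -/
abbrev Amb : Type w := (ℕ × ℕ) →₀ F

/-- For a finite set `A` of labels, the subspace `(F^(∞))^A` of `(F^(∞))^(∞)`. -/
abbrev labelled (A : Finset ℕ) : Submodule F (Amb F) :=
  Finsupp.supported F F {q : ℕ × ℕ | q.1 ∈ A}

/-- The direct limit topology of the finite dimensional subspaces of a vector space, i.e. the
finest topology for which all the linear maps from the spaces `F^k` are continuous. -/
@[reducible] def limitTopology (V : Type w) [AddCommGroup V] [Module F V] : TopologicalSpace V :=
  ⨆ k : ℕ, ⨆ L : (Fin k → F) →ₗ[F] V,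
    TopologicalSpace.coinduced (fun x => L x) inferInstance

variable {F}

/-- The elements of the set `Γ(S)`: families of pairwise disjoint finite subsets of `ℕ`. -/
def IsLabelling {S : Type} (f : S → Finset ℕ) : Prop :=
  Pairwise fun s t => Disjoint (f s) (f t)

/-- The set of all the labels used by `f`. -/
abbrev Labels {S : Type} (f : S → Finset ℕ) : Type := {i : ℕ // ∃ s, i ∈ f s}

/-- The label `i ∈ f s`. -/
abbrev lab {S : Type} (f : S → Finset ℕ) (s : S) (i : f s) : Labels f := ⟨i.1, s, i.2⟩

/-- `p = (b, c)` is a family, indexed by `s ∈ S`, of pairs consisting of a basis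
`(b_i)_{i ∈ f s}` of a `#(f s)`-dimensional subspace of `(F^(∞))^(f s)` and of a basis
`(c_i)_{i ∈ f s}` of a `#(g s)`-dimensional subspace of `(F^(∞))^(g s)`, both subspaces
having the same dimension. -/
structure IsFramePair {S : Type} (f g : S → Finset ℕ)
    (p : (Labels f → Amb F) × (Labels f → Amb F)) : Prop where
  card_eq : ∀ s, (f s).card = (g s).card
  mem_fst : ∀ s (i : f s), p.1 (lab f s i) ∈ labelled F (f s)
  mem_snd : ∀ s (i : f s), p.2 (lab f s i) ∈ labelled F (g s)
  indep_fst : ∀ s, LinearIndependent F fun i : f s => p.1 (lab f s i)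
  indep_snd : ∀ s, LinearIndependent F fun i : f s => p.2 (lab f s i)

/-- The space of pairs of (families of) frames, as a subspace of a vector space with the
direct limit topology. -/
def FramePair (F : Type w) [RCLike F] {S : Type} (f g : S → Finset ℕ) : Type w :=
  {p : (Labels f → Amb F) × (Labels f → Amb F) // IsFramePair f g p}

instance {S : Type} (f g : S → Finset ℕ) : TopologicalSpace (FramePair F f g) :=
  TopologicalSpace.induced Subtype.val (limitTopology F _)

/-- The graph of the linear isomorphism that maps the frame `(b_i)_{i ∈ f s}` to the frame
`(c_i)_{i ∈ f s}`. -/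
def frameGraph {S : Type} (f : S → Finset ℕ) (p : (Labels f → Amb F) × (Labels f → Amb F))
    (s : S) : Submodule F (Amb F × Amb F) :=
  Submodule.span F (Set.range fun i : f s => (p.1 (lab f s i), p.2 (lab f s i)))

variable (F) in
/-- The morphisms of the category `Fib^{F^(∞)}(S)-mod`. An object is a family
`(A_s, V_s)_{s ∈ S}`, where the `A_s` are pairwise disjoint finite subsets of `ℕ` and `V_s` is
a `#A_s`-dimensional subspace of `(F^(∞))^{A_s}`. A morphism from `(A_s, V_s)` to `(B_s, W_s)`
is a family of linear isomorphisms `V_s ≃ W_s`; it is encoded by the labels of its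
source and of its target and by the graphs of these isomorphisms (so that `V_s` and `W_s` are the
two projections of the `s`-th graph). -/
@[ext] structure Mor (S : Type) : Type w where
  dom : S → Finset ℕ
  cod : S → Finset ℕ
  graph : S → Submodule F (Amb F × Amb F)
  dom_label : IsLabelling dom
  cod_label : IsLabelling cod
  isIso : ∃ p, IsFramePair dom cod p ∧ ∀ s, graph s = frameGraph dom p s

/-- The morphism defined by a pair of (families of) frames. -/
def Mor.mk' {S : Type} {f g : S → Finset ℕ} (hf : IsLabelling f) (hg : IsLabelling g)
    (p : FramePair F f g) : Mor F S where
  dom := f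
  cod := g
  graph := frameGraph f p.1
  dom_label := hf
  cod_label := hg
  isIso := ⟨p.1, p.2, fun _ => rfl⟩

/-- The space of morphisms is the disjoint union, over all the labels, of the quotients of the
spaces of pairs of frames: two pairs of frames define the same morphism if and only if they are in
the same orbit under `∏ s, GL_{#(f s)}(F)`. (As products of quotient maps of k-spaces are quotient
maps, this is the fiber product over the space of pairs of objects, for `s ∈ S`, of the quotients of
the spaces of pairs of frames of the `s`-th bundle by `GL_n(F)`.) -/
instance {S : Type} : TopologicalSpace (Mor F S) :=
  ⨆ f : {f : S → Finset ℕ // IsLabelling f}, ⨆ g : {g : S → Finset ℕ // IsLabelling g},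
    TopologicalSpace.coinduced (fun p : FramePair F f.1 g.1 => Mor.mk' f.2 g.2 p) inferInstance

/-- `χ` is the composite of `φ` followed by `ψ` (which includes the fact that the target of `φ`
is the source of `ψ`). -/
structure IsComp {S : Type} (φ ψ χ : Mor F S) : Prop where
  cod_eq : φ.cod = ψ.dom
  range_eq : ∀ s, (φ.graph s).map (LinearMap.snd F (Amb F) (Amb F)) =
    (ψ.graph s).map (LinearMap.fst F (Amb F) (Amb F))
  dom_comp : χ.dom = φ.dom
  cod_comp : χ.cod = ψ.cod
  mem_graph : ∀ s x z, (x, z) ∈ χ.graph s ↔ ∃ y, (x, y) ∈ φ.graph s ∧ (y, z) ∈ ψ.graph s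

/-- `φ` is an identity morphism. -/
structure IsId {S : Type} (φ : Mor F S) : Prop where
  dom_eq : φ.dom = φ.cod
  eq_of_mem : ∀ s, ∀ p ∈ φ.graph s, p.1 = p.2

/-! ## Functoriality with respect to `Γ` -/

/-- Morphisms from `S` to `T` in the category `Γ`. -/
structure GammaHom (S T : Type) where
  toFun : S → Finset T
  disjoint : Pairwise fun s t => Disjoint (toFun s) (toFun t)

/-- The label of an orthogonal direct sum. -/
def pullLabel {S T : Type} (γ : GammaHom S T) (f : T → Finset ℕ) (s : S) : Finset ℕ :=
  (γ.toFun s).biUnion f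

lemma IsLabelling.pull {S T : Type} (γ : GammaHom S T) {f : T → Finset ℕ} (hf : IsLabelling f) :
    IsLabelling (pullLabel γ f) := by
  intro s s' hs
  simp only [pullLabel, Finset.disjoint_biUnion_left, Finset.disjoint_biUnion_right]
  intro t ht t' ht'
  apply hf
  rintro rfl
  exact (Finset.disjoint_left.1 (γ.disjoint hs) ht') ht

/-- The inclusion of sets of labels. -/
def labelIncl {S T : Type} (γ : GammaHom S T) (f : T → Finset ℕ) :
    Labels (pullLabel γ f) → Labels f := fun i =>
  ⟨i.1, by
    obtain ⟨s, hs⟩ := i.2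
    obtain ⟨t, -, ht⟩ := Finset.mem_biUnion.1 hs
    exact ⟨t, ht⟩⟩

/-- Restriction of a pair of families of frames. -/
def restrictFrame {S T : Type} (γ : GammaHom S T) (f : T → Finset ℕ) :
    ((Labels f → Amb F) × (Labels f → Amb F)) →ₗ[F]
      ((Labels (pullLabel γ f) → Amb F) × (Labels (pullLabel γ f) → Amb F)) :=
  LinearMap.prodMap (LinearMap.funLeft F (Amb F) (labelIncl γ f))
    (LinearMap.funLeft F (Amb F) (labelIncl γ f))

lemma indep_biUnion {T : Type} {f g : T → Finset ℕ} (hg : IsLabelling g)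
    (u : Finset T) (b : Labels f → Amb F)
    (hmem : ∀ t (i : f t), b (lab f t i) ∈ labelled F (g t))
    (hind : ∀ t, LinearIndependent F fun i : f t => b (lab f t i))
    (e : u.biUnion f → Labels f) (he : ∀ i, (e i).1 = i.1) :
    LinearIndependent F fun i : u.biUnion f => b (e i) := by
  classical
  have hz : ∀ t (i : f t) (q : ℕ × ℕ), q.1 ∉ g t → b (lab f t i) q = 0 := by
    intro t i q hq
    have := (Finsupp.mem_supported' F (b (lab f t i))).1 (hmem t i) q hq
    exact this
  rw [Fintype.linearIndependent_iff]
  intro a ha i₀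
  obtain ⟨t₀, ht₀, hi₀⟩ := Finset.mem_biUnion.1 i₀.2
  let j : f t₀ → u.biUnion f := fun i => ⟨i.1, Finset.mem_biUnion.2 ⟨t₀, ht₀, i.2⟩⟩
  have hej : ∀ i : f t₀, e (j i) = lab f t₀ i := fun i => Subtype.ext (he _)
  have hj : Function.Injective j := fun i i' h => Subtype.ext (congrArg (fun z => z.1) h)
  have key : ∑ i : f t₀, a (j i) • b (lab f t₀ i) = 0 := by
    ext q
    by_cases hq : q.1 ∈ g t₀
    · have h1 := DFunLike.congr_fun ha q
      rw [Finsupp.finsetSum_apply] at h1 ⊢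
      rw [← h1]
      have h2 : ∑ i : f t₀, (a (j i) • b (lab f t₀ i)) q =
          ∑ i ∈ Finset.univ.image j, (a i • b (e i)) q := by
        rw [Finset.sum_image (fun _ _ _ _ h => hj h)]
        exact Finset.sum_congr rfl fun i _ => by rw [hej]
      rw [h2]
      apply Finset.sum_subset (Finset.subset_univ _)
      intro i _ hi
      obtain ⟨t, ht, hit⟩ := Finset.mem_biUnion.1 i.2
      have hne : t ≠ t₀ := by
        rintro rfl
        exact hi (Finset.mem_image.2 ⟨⟨i.1, hit⟩, Finset.mem_univ _, Subtype.ext rfl⟩)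
      have hq' : q.1 ∉ g t := fun h => Finset.disjoint_left.1 (hg hne) h hq
      have : e i = lab f t ⟨i.1, hit⟩ := Subtype.ext (he _)
      rw [this, Finsupp.smul_apply, hz t _ q hq', smul_zero]
    · rw [Finsupp.finsetSum_apply]
      exact Finset.sum_eq_zero fun i _ => by
        rw [Finsupp.smul_apply, hz t₀ i q hq, smul_zero]
  exact Fintype.linearIndependent_iff.1 (hind t₀) (fun i => a (j i)) key ⟨i₀.1, hi₀⟩

lemma labelled_mono {A B : Finset ℕ} (h : A ⊆ B) : labelled F A ≤ labelled F B :=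
  Finsupp.supported_mono fun _ hq => h hq

lemma IsFramePair.pull {S T : Type} (γ : GammaHom S T) {f g : T → Finset ℕ}
    (hf : IsLabelling f) (hg : IsLabelling g)
    {p : (Labels f → Amb F) × (Labels f → Amb F)} (hp : IsFramePair f g p) :
    IsFramePair (pullLabel γ f) (pullLabel γ g) (restrictFrame γ f p) where
  card_eq s := by
    rw [pullLabel, pullLabel, Finset.card_biUnion fun t _ t' _ h => hf h,
      Finset.card_biUnion fun t _ t' _ h => hg h]
    exact Finset.sum_congr rfl fun t _ => hp.card_eq t
  mem_fst s i := by
    obtain ⟨t, ht, hi⟩ := Finset.mem_biUnion.1 i.2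
    exact labelled_mono (Finset.subset_biUnion_of_mem f ht) (hp.mem_fst t ⟨i.1, hi⟩)
  mem_snd s i := by
    obtain ⟨t, ht, hi⟩ := Finset.mem_biUnion.1 i.2
    exact labelled_mono (Finset.subset_biUnion_of_mem g ht) (hp.mem_snd t ⟨i.1, hi⟩)
  indep_fst s := indep_biUnion hf (γ.toFun s) p.1 hp.mem_fst hp.indep_fst
    (fun i => labelIncl γ f (lab (pullLabel γ f) s i)) fun _ => rfl
  indep_snd s := indep_biUnion hg (γ.toFun s) p.2 hp.mem_snd hp.indep_snd
    (fun i => labelIncl γ f (lab (pullLabel γ f) s i)) fun _ => rfl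

lemma iSup_frameGraph {S T : Type} (γ : GammaHom S T) (f : T → Finset ℕ)
    (p : (Labels f → Amb F) × (Labels f → Amb F)) (s : S) :
    ⨆ t ∈ γ.toFun s, frameGraph f p t =
      frameGraph (pullLabel γ f) (restrictFrame γ f p) s := by
  simp only [frameGraph]
  rw [← Submodule.span_iUnion₂]
  congr 1
  ext x
  simp only [Set.mem_iUnion, Set.mem_range]
  constructor
  · rintro ⟨t, ht, i, rfl⟩
    exact ⟨⟨i.1, Finset.mem_biUnion.2 ⟨t, ht, i.2⟩⟩, rfl⟩
  · rintro ⟨i, rfl⟩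
    obtain ⟨t, ht, hi⟩ := Finset.mem_biUnion.1 i.2
    exact ⟨t, ht, ⟨i.1, hi⟩, rfl⟩

/-- The functor `Fib^{F^(∞)}(T)-mod → Fib^{F^(∞)}(S)-mod` induced by a morphism `γ : S → T`
of `Γ`, which takes orthogonal direct sums: `(φ_t)_{t ∈ T} ↦ (⨁_{t ∈ γ(s)} φ_t)_{s ∈ S}`. -/
def Mor.pull {S T : Type} (γ : GammaHom S T) (φ : Mor F T) : Mor F S where
  dom := pullLabel γ φ.dom
  cod := pullLabel γ φ.cod
  graph s := ⨆ t ∈ γ.toFun s, φ.graph t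
  dom_label := φ.dom_label.pull γ
  cod_label := φ.cod_label.pull γ
  isIso := by
    obtain ⟨p, hp, h⟩ := φ.isIso
    refine ⟨restrictFrame γ φ.dom p, hp.pull γ φ.dom_label φ.cod_label, fun s => ?_⟩
    rw [← iSup_frameGraph]
    simp only [h]

lemma continuous_linearMap {V W : Type w} [AddCommGroup V] [Module F V] [AddCommGroup W]
    [Module F W] (L : V →ₗ[F] W) :
    @Continuous _ _ (limitTopology F V) (limitTopology F W) L := by
  refine continuous_iSup_dom.2 fun k => continuous_iSup_dom.2 fun M => ?_
  rw [continuous_coinduced_dom]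
  rw [continuous_iff_coinduced_le]
  exact le_iSup_of_le k (le_iSup_of_le (L.comp M) le_rfl)

lemma Mor.continuous_mk' {S : Type} {f g : S → Finset ℕ} (hf : IsLabelling f)
    (hg : IsLabelling g) : Continuous fun p : FramePair F f g => Mor.mk' hf hg p := by
  rw [continuous_iff_coinduced_le]
  exact le_iSup_of_le ⟨f, hf⟩ (le_iSup_of_le ⟨g, hg⟩ le_rfl)

lemma Mor.continuous_pull {S T : Type} (γ : GammaHom S T) :
    Continuous (Mor.pull (F := F) γ) := by
  refine continuous_iSup_dom.2 fun f => continuous_iSup_dom.2 fun g => ?_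
  rw [continuous_coinduced_dom]
  let R : FramePair F f.1 g.1 → FramePair F (pullLabel γ f.1) (pullLabel γ g.1) := fun p =>
    ⟨restrictFrame γ f.1 p.1, p.2.pull γ f.2 g.2⟩
  have h1 : Continuous R := by
    have h0 : @Continuous (FramePair F f.1 g.1) _ _ (limitTopology F _) fun p => p.1 :=
      continuous_induced_dom
    have h0' := @Continuous.comp _ _ _ _ (limitTopology F _)
      (limitTopology F _) _ _ (continuous_linearMap (restrictFrame γ f.1)) h0
    exact continuous_induced_rng.2 h0'
  have h2 := (Mor.continuous_mk' (F := F) (f.2.pull γ) (g.2.pull γ)).comp h1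
  convert h2 using 1
  funext p
  refine Mor.ext rfl rfl ?_
  funext s
  exact iSup_frameGraph γ f.1 p.1 s

/-- `Mor.pull` as a continuous map. -/
def Mor.pullC {S T : Type} (γ : GammaHom S T) : C(Mor F T, Mor F S) :=
  ⟨Mor.pull γ, Mor.continuous_pull γ⟩

lemma Mor.graph_le {S : Type} (φ : Mor F S) (s : S) :
    φ.graph s ≤ (labelled F (φ.dom s)).prod (labelled F (φ.cod s)) := by
  obtain ⟨p, hp, h⟩ := φ.isIso
  rw [h, frameGraph, Submodule.span_le]
  rintro _ ⟨i, rfl⟩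
  exact ⟨hp.mem_fst s i, hp.mem_snd s i⟩

lemma mem_graph_pull {S T : Type} (γ : GammaHom S T) (φ : Mor F T) (s : S)
    (z : Amb F × Amb F) : z ∈ (φ.pull γ).graph s ↔
      ∃ μ : T → Amb F × Amb F, (∀ t, μ t ∈ φ.graph t) ∧ ∑ t ∈ γ.toFun s, μ t = z := by
  refine (Submodule.mem_iSup_finset_iff_exists_sum (s := γ.toFun s) φ.graph z).trans ?_
  constructor
  · rintro ⟨μ, h⟩
    exact ⟨fun t => μ t, fun t => (μ t).2, h⟩
  · rintro ⟨μ, h, h'⟩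
    exact ⟨fun t => ⟨μ t, h t⟩, h'⟩

lemma eq_of_sum_eq {T : Type} {g : T → Finset ℕ} (hg : IsLabelling g) (u : Finset T)
    (x y : T → Amb F) (hx : ∀ t, x t ∈ labelled F (g t)) (hy : ∀ t, y t ∈ labelled F (g t))
    (h : ∑ t ∈ u, x t = ∑ t ∈ u, y t) : ∀ t ∈ u, x t = y t := by
  intro t ht
  ext q
  have hz : ∀ (x : T → Amb F), (∀ t, x t ∈ labelled F (g t)) → ∀ t', q.1 ∉ g t' →
      x t' q = 0 := fun x hx t' hq =>
    (Finsupp.mem_supported' F (x t')).1 (hx t') q hq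
  by_cases hq : q.1 ∈ g t
  · have h1 := DFunLike.congr_fun h q
    rw [Finsupp.finsetSum_apply, Finsupp.finsetSum_apply] at h1
    have hne : ∀ t', t' ≠ t → q.1 ∉ g t' := fun t' hne hq' =>
      Finset.disjoint_left.1 (hg hne) hq' hq
    rwa [Finset.sum_eq_single_of_mem t ht fun t' _ hne' => hz x hx t' (hne t' hne'),
      Finset.sum_eq_single_of_mem t ht fun t' _ hne' => hz y hy t' (hne t' hne')] at h1
  · rw [hz x hx t hq, hz y hy t hq]

lemma IsComp.pull {S T : Type} (γ : GammaHom S T) {φ ψ χ : Mor F T} (h : IsComp φ ψ χ) :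
    IsComp (φ.pull γ) (ψ.pull γ) (χ.pull γ) where
  cod_eq := congrArg (pullLabel γ) h.cod_eq
  range_eq s := by
    simp only [Mor.pull, Submodule.map_iSup, h.range_eq]
  dom_comp := congrArg (pullLabel γ) h.dom_comp
  cod_comp := congrArg (pullLabel γ) h.cod_comp
  mem_graph s x z := by
    simp only [mem_graph_pull]
    constructor
    · rintro ⟨μ, hμ, hsum⟩
      have := fun t => (h.mem_graph t (μ t).1 (μ t).2).1 (hμ t)
      choose y hy1 hy2 using this
      refine ⟨∑ t ∈ γ.toFun s, y t, ⟨fun t => ((μ t).1, y t), hy1, ?_⟩,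
        ⟨fun t => (y t, (μ t).2), hy2, ?_⟩⟩
      · rw [Prod.ext_iff, Prod.fst_sum, Prod.snd_sum] at *
        exact ⟨hsum.1, rfl⟩
      · rw [Prod.ext_iff, Prod.fst_sum, Prod.snd_sum] at *
        exact ⟨rfl, hsum.2⟩
    · rintro ⟨y, ⟨μ, hμ, h1⟩, ⟨ν, hν, h2⟩⟩
      rw [Prod.ext_iff, Prod.fst_sum, Prod.snd_sum] at h1 h2
      have hmid := eq_of_sum_eq φ.cod_label (γ.toFun s) (fun t => (μ t).2) (fun t => (ν t).1)
        (fun t => (φ.graph_le t (hμ t)).2)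
        (fun t => by
          rw [h.cod_eq]
          exact (ψ.graph_le t (hν t)).1) (h1.2.trans h2.1.symm)
      classical
      refine ⟨fun t => if t ∈ γ.toFun s then ((μ t).1, (ν t).2) else 0, fun t => ?_, ?_⟩
      · by_cases ht : t ∈ γ.toFun s
        · simp only [ht, if_true]
          refine (h.mem_graph t _ _).2 ⟨(μ t).2, hμ t, ?_⟩
          have : (μ t).2 = (ν t).1 := hmid t ht
          rw [this]
          exact hν t
        · simp only [ht, if_false]
          exact zero_mem _
      · rw [Finset.sum_congr rfl fun t ht => if_pos ht, Prod.ext_iff, Prod.fst_sum, Prod.snd_sum]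
        exact ⟨h1.1, h2.2⟩

lemma IsId.pull {S T : Type} (γ : GammaHom S T) {φ : Mor F T} (h : IsId φ) :
    IsId (φ.pull γ) where
  dom_eq := congrArg (pullLabel γ) h.dom_eq
  eq_of_mem s p hp := by
    have hle : (φ.pull γ).graph s ≤
        LinearMap.eqLocus (LinearMap.fst F (Amb F) (Amb F)) (LinearMap.snd F (Amb F) (Amb F)) :=
      iSup_le fun t => iSup_le fun _ q hq => h.eq_of_mem t q hq
    exact hle hp

instance : Unique (Mor F (Fin 0)) where
  default :=
    { dom := fun s => s.elim0
      cod := fun s => s.elim0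
      graph := fun s => s.elim0
      dom_label := fun s => s.elim0
      cod_label := fun s => s.elim0
      isIso := ⟨0, ⟨fun s => s.elim0, fun s => s.elim0, fun s => s.elim0, fun s => s.elim0,
        fun s => s.elim0⟩, fun s => s.elim0⟩ }
  uniq _ := Mor.ext (funext fun s => s.elim0) (funext fun s => s.elim0)
    (funext fun s => s.elim0)

end LabelledSubspaces

/-! ## The nerve of the category of functors from `𝓔G` -/

section Nerve

variable (F : Type w) [RCLike F] (G : Type u) [TopologicalSpace G]

/-- An `m`-simplex of the nerve of `Func(𝓔G, Fib^{F^(∞)}(S)-mod)`, where `𝓔G` is the category with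
space of objects `G` and exactly one morphism `(g, h)` from `g` to `h` for all `g` and `h`:
a functor from the ordered set `[m]` to the category of continuous functors from `𝓔G` to
`Fib^{F^(∞)}(S)-mod` and continuous natural transformations. The functor `fn i` is given by its
action on morphisms, and `nt (i, j)` is the natural transformation from `fn i` to `fn j`. -/
@[ext] structure FuncSimplex (m : ℕ) (S : Type) : Type (max u w) where
  fn : Fin (m + 1) → C(G × G, Mor F S)
  nt : {p : Fin (m + 1) × Fin (m + 1) // p.1 ≤ p.2} → C(G, Mor F S)
  fn_id : ∀ i g, IsId (fn i (g, g))
  fn_comp : ∀ i g h k, IsComp (fn i (g, h)) (fn i (h, k)) (fn i (g, k))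
  nt_natural : ∀ i j (hij : i ≤ j) g h, ∃ d : Mor F S,
    IsComp (fn i (g, h)) (nt ⟨(i, j), hij⟩ h) d ∧ IsComp (nt ⟨(i, j), hij⟩ g) (fn j (g, h)) d
  nt_id : ∀ i g, nt ⟨(i, i), le_rfl⟩ g = fn i (g, g)
  nt_comp : ∀ i j k (hij : i ≤ j) (hjk : j ≤ k) g,
    IsComp (nt ⟨(i, j), hij⟩ g) (nt ⟨(j, k), hjk⟩ g) (nt ⟨(i, k), hij.trans hjk⟩ g)

variable {F G}

/-- The topology of the spaces of maps (before passing to the associated k-space topology). -/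
@[reducible] def FuncSimplex.mapTopology (m : ℕ) (S : Type) : TopologicalSpace (FuncSimplex F G m S) :=
  TopologicalSpace.induced (fun x => (x.fn, x.nt)) inferInstance

/-- The nerve is formed in the category of k-spaces. -/
instance (m : ℕ) (S : Type) : TopologicalSpace (FuncSimplex F G m S) :=
  @TopologicalSpace.compactlyGenerated.{max u w} (FuncSimplex F G m S)
    (FuncSimplex.mapTopology m S)

/-- The simplicial structure of the nerve. -/
def FuncSimplex.reindex {n m : ℕ} {S : Type} (θ : Fin (n + 1) →o Fin (m + 1))
    (x : FuncSimplex F G m S) : FuncSimplex F G n S where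
  fn i := x.fn (θ i)
  nt p := x.nt ⟨(θ p.1.1, θ p.1.2), θ.monotone p.2⟩
  fn_id i := x.fn_id (θ i)
  fn_comp i := x.fn_comp (θ i)
  nt_natural i j hij := x.nt_natural (θ i) (θ j) (θ.monotone hij)
  nt_id i := x.nt_id (θ i)
  nt_comp i j k hij hjk := x.nt_comp (θ i) (θ j) (θ k) (θ.monotone hij) (θ.monotone hjk)

/-- The functoriality of the nerve with respect to `Γ`. -/
def FuncSimplex.pull {m : ℕ} {S T : Type} (γ : GammaHom S T) (x : FuncSimplex F G m T) :
    FuncSimplex F G m S where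
  fn i := (Mor.pullC γ).comp (x.fn i)
  nt p := (Mor.pullC γ).comp (x.nt p)
  fn_id i g := (x.fn_id i g).pull γ
  fn_comp i g h k := (x.fn_comp i g h k).pull γ
  nt_natural i j hij g h := by
    obtain ⟨d, h1, h2⟩ := x.nt_natural i j hij g h
    exact ⟨d.pull γ, h1.pull γ, h2.pull γ⟩
  nt_id i g := congrArg (Mor.pull γ) (x.nt_id i g)
  nt_comp i j k hij hjk g := (x.nt_comp i j k hij hjk g).pull γ

variable [Group G] [IsTopologicalGroup G]

/-- The action of `G` on the category of functors, induced by the right multiplication on `𝓔G`. -/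
instance (m : ℕ) (S : Type) : MulAction G (FuncSimplex F G m S) where
  smul a x :=
    { fn := fun i => (x.fn i).comp ⟨fun p : G × G => (p.1 * a, p.2 * a), by fun_prop⟩
      nt := fun p => (x.nt p).comp ⟨fun g : G => g * a, by fun_prop⟩
      fn_id := fun i g => x.fn_id i (g * a)
      fn_comp := fun i g h k => x.fn_comp i (g * a) (h * a) (k * a)
      nt_natural := fun i j hij g h => x.nt_natural i j hij (g * a) (h * a)
      nt_id := fun i g => x.nt_id i (g * a)
      nt_comp := fun i j k hij hjk g => x.nt_comp i j k hij hjk (g * a) }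
  one_smul x := by
    refine FuncSimplex.ext (funext fun i => ?_) (funext fun p => ?_)
    · ext1 q
      exact congrArg (x.fn i) (Prod.ext (mul_one _) (mul_one _))
    · ext1 g
      exact congrArg (x.nt p) (mul_one _)
  mul_smul a b x := by
    refine FuncSimplex.ext (funext fun i => ?_) (funext fun p => ?_)
    · ext1 q
      exact congrArg (x.fn i) (Prod.ext (mul_assoc _ _ _).symm (mul_assoc _ _ _).symm)
    · ext1 g
      exact congrArg (x.nt p) (mul_assoc _ _ _).symm

lemma FuncSimplex.smul_fn {m : ℕ} {S : Type} (a : G) (x : FuncSimplex F G m S) (i : Fin (m + 1)) :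
    (a • x).fn i = (x.fn i).comp ⟨fun p : G × G => (p.1 * a, p.2 * a), by fun_prop⟩ := rfl

lemma FuncSimplex.smul_nt {m : ℕ} {S : Type} (a : G) (x : FuncSimplex F G m S)
    (p : {p : Fin (m + 1) × Fin (m + 1) // p.1 ≤ p.2}) :
    (a • x).nt p = (x.nt p).comp ⟨fun g : G => g * a, by fun_prop⟩ := rfl

lemma FuncSimplex.smul_reindex {n m : ℕ} {S : Type} (θ : Fin (n + 1) →o Fin (m + 1)) (a : G)
    (x : FuncSimplex F G m S) : a • x.reindex θ = (a • x).reindex θ := rfl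

lemma FuncSimplex.smul_pull {m : ℕ} {S T : Type} (γ : GammaHom S T) (a : G)
    (x : FuncSimplex F G m T) : a • x.pull γ = (a • x).pull γ := rfl

lemma continuous_kSpace.{k, a, b} {X : Type a} {Y : Type b} (tX : TopologicalSpace X) (tY : TopologicalSpace Y)
    (f : X → Y) (hf : @Continuous _ _ tX tY f) :
    @Continuous _ _ (@TopologicalSpace.compactlyGenerated.{k} X tX)
      (@TopologicalSpace.compactlyGenerated.{k} Y tY) f := by
  let _ := tX
  refine @continuous_from_compactlyGenerated.{k} X Y tX
    (@TopologicalSpace.compactlyGenerated.{k} Y tY) f fun S g => ?_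
  have key : ∀ s : C(S, Y), @Continuous _ _ _
      (@TopologicalSpace.compactlyGenerated.{k} Y tY) s := by
    intro s
    let Φ : (Σ i : (S : CompHaus.{k}) × C(S, Y), i.fst) → Y := fun x => x.1.2 x.2
    have h1 : @Continuous _ _ inferInstance
        (@TopologicalSpace.compactlyGenerated.{k} Y tY) Φ := continuous_coinduced_rng
    have h2 : Continuous (fun x : S =>
        (⟨⟨S, s⟩, x⟩ : Σ i : (S : CompHaus.{k}) × C(S, Y), i.fst)) :=
      @continuous_sigmaMk _ (fun i : (S : CompHaus.{k}) × C(S, Y) => (i.fst : Type _))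
        _ ⟨S, s⟩
    have h3 := @Continuous.comp _ _ _ _ _
      (@TopologicalSpace.compactlyGenerated.{k} Y tY) _ _ h1 h2
    exact h3
  exact key ⟨f ∘ g, hf.comp g.continuous⟩

lemma FuncSimplex.continuous_smul {m : ℕ} {S : Type} (a : G) :
    Continuous fun x : FuncSimplex F G m S => a • x := by
  refine continuous_kSpace.{max u w} (FuncSimplex.mapTopology m S) (FuncSimplex.mapTopology m S) _ ?_
  refine continuous_induced_rng.2 ?_
  let _ := FuncSimplex.mapTopology (F := F) (G := G) m S
  have hc : Continuous fun x : FuncSimplex F G m S => (x.fn, x.nt) := continuous_induced_dom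
  refine Continuous.prodMk (continuous_pi fun i => ?_) (continuous_pi fun p => ?_)
  · exact (ContinuousMap.continuous_precomp _).comp ((continuous_apply i).comp hc.fst)
  · exact (ContinuousMap.continuous_precomp _).comp ((continuous_apply p).comp hc.snd)

end Nerve

/-! ## Geometric realizations and the classifying space -/

section Realization

/-- The identifications that define the geometric realization of a simplicial space `N`, restricted
to the maps `θ : [n] → [m]` that satisfy `P`. -/
inductive RealRel (N : ℕ → Type w)
    (str : ∀ {n m : ℕ}, (Fin (n + 1) →o Fin (m + 1)) → N m → N n)
    (P : ∀ {n m : ℕ}, (Fin (n + 1) →o Fin (m + 1)) → Prop) :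
    (Σ m, N m × stdSimplex ℝ (Fin (m + 1))) → (Σ m, N m × stdSimplex ℝ (Fin (m + 1))) → Prop
  | glue {n m : ℕ} (θ : Fin (n + 1) →o Fin (m + 1)) (hθ : P θ) (a : N m)
      (t : stdSimplex ℝ (Fin (n + 1))) :
      RealRel N str P ⟨n, str θ a, t⟩ ⟨m, a, stdSimplex.map θ t⟩

variable (F : Type w) [RCLike F] (G : Type u) [TopologicalSpace G]

/-- The (thin) geometric realization `|Func(𝓔G, Fib^{F^(∞)}(S)-mod)|`, i.e. the value at `S` of the
equivariant `Γ`-space. -/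
def Vec (S : Type) : Type (max u w) :=
  Quot (RealRel (fun m => FuncSimplex F G m S) (fun θ x => x.reindex θ) fun _ => True)

instance (S : Type) : TopologicalSpace (Vec F G S) :=
  inferInstanceAs (TopologicalSpace (Quot _))

variable {F G}

/-- The map `Vec F G T → Vec F G S` induced by a morphism `γ : S → T` of `Γ`. -/
def Vec.pull {S T : Type} (γ : GammaHom S T) : Vec F G T → Vec F G S :=
  Quot.map (fun x => ⟨x.1, x.2.1.pull γ, x.2.2⟩) (by
    rintro _ _ ⟨θ, -, a, t⟩
    exact RealRel.glue (N := fun m => FuncSimplex F G m S) θ trivial (a.pull γ) t)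

/-- The morphism `𝐧 → 𝐦` of `Γ` associated to a non-decreasing map `δ : [n] → [m]`:
it maps `k ∈ {1, …, n}` to `{j | δ (k - 1) < j ≤ δ k}`. Here the elements of `{1, …, n}` are
numbered from `0`. -/
def gammaOfOrderHom {n m : ℕ} (δ : Fin (n + 1) →o Fin (m + 1)) : GammaHom (Fin n) (Fin m) where
  toFun k := Finset.univ.filter fun j : Fin m =>
    (δ k.castSucc : ℕ) < (j : ℕ) + 1 ∧ (j : ℕ) + 1 ≤ (δ k.succ : ℕ)
  disjoint := by
    have key : ∀ k l : Fin n, k < l → ∀ j : ℕ, j + 1 ≤ (δ k.succ : ℕ) →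
        (δ l.castSucc : ℕ) < j + 1 → False := by
      intro k l hkl j h1 h2
      have h3 : δ k.succ ≤ δ l.castSucc := δ.monotone (by
        rw [Fin.le_def]
        simpa using hkl)
      have : (δ k.succ : ℕ) ≤ (δ l.castSucc : ℕ) := h3
      omega
    intro k l hkl
    rw [Finset.disjoint_left]
    intro j hj hj'
    simp only [Finset.mem_filter, Finset.mem_univ, true_and] at hj hj'
    rcases lt_or_gt_of_ne hkl with h | h
    · exact key k l h j hj.2 hj'.1
    · exact key l k h j hj'.2 hj.1

variable (F G) in
/-- The thick geometric realization `B` of the simplicial space underlying the `Γ`-space `Vec F G`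
(only the injective maps `[n] → [m]` are used in the identifications). -/
def BVec : Type (max u w) :=
  Quot (RealRel (fun m => Vec F G (Fin m)) (fun θ x => x.pull (gammaOfOrderHom θ))
    fun θ => Function.Injective θ)

instance : TopologicalSpace (BVec F G) := inferInstanceAs (TopologicalSpace (Quot _))

variable [Group G]

/-- The unique vertex of the nerve of `Func(𝓔G, Fib^{F^(∞)}(∅)-mod)`. -/
def FuncSimplex.base : FuncSimplex F G 0 (Fin 0) where
  fn _ := ContinuousMap.const _ default
  nt _ := ContinuousMap.const _ default
  fn_id _ _ := ⟨rfl, fun s => s.elim0⟩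
  fn_comp _ _ _ _ := ⟨rfl, fun s => s.elim0, rfl, rfl, fun s => s.elim0⟩
  nt_natural _ _ _ _ _ := ⟨default, ⟨rfl, fun s => s.elim0, rfl, rfl, fun s => s.elim0⟩,
    ⟨rfl, fun s => s.elim0, rfl, rfl, fun s => s.elim0⟩⟩
  nt_id _ _ := rfl
  nt_comp _ _ _ _ _ _ := ⟨rfl, fun s => s.elim0, rfl, rfl, fun s => s.elim0⟩

variable (F G) in
/-- The base point of `BVec F G`, given by the point `Vec F G 𝟎`. -/
def BVec.base : BVec F G :=
  Quot.mk _ ⟨0, Quot.mk _ ⟨0, FuncSimplex.base, stdSimplex.vertex 0⟩, stdSimplex.vertex 0⟩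

variable [IsTopologicalGroup G]

instance (S : Type) : MulAction G (Vec F G S) where
  smul a := Quot.map (fun x => ⟨x.1, a • x.2.1, x.2.2⟩) (by
    rintro _ _ ⟨θ, -, b, t⟩
    exact RealRel.glue (N := fun m => FuncSimplex F G m S) θ trivial (a • b) t)
  one_smul := by
    rintro ⟨m, x, t⟩
    change Quot.mk _ _ = _
    dsimp only
    rw [one_smul]
  mul_smul a b := by
    rintro ⟨m, x, t⟩
    change Quot.mk _ _ = Quot.mk _ _
    dsimp only
    rw [mul_smul]

lemma Vec.smul_pull {S T : Type} (γ : GammaHom S T) (a : G) (x : Vec F G T) :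
    a • x.pull γ = (a • x).pull γ := by
  obtain ⟨m, x, t⟩ := x
  rfl

lemma Vec.continuous_smul {S : Type} (a : G) : Continuous fun x : Vec F G S => a • x := by
  refine continuous_quot_lift _ ?_
  refine continuous_quot_mk.comp (continuous_sigma fun m => ?_)
  refine continuous_sigmaMk.comp ?_
  exact ((FuncSimplex.continuous_smul a).comp continuous_fst).prodMk continuous_snd

instance : MulAction G (BVec F G) where
  smul a := Quot.map (fun x => ⟨x.1, a • x.2.1, x.2.2⟩) (by
    rintro _ _ ⟨θ, hθ, b, t⟩
    dsimp only
    rw [Vec.smul_pull]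
    exact RealRel.glue (N := fun m => Vec F G (Fin m))
      (str := fun θ x => x.pull (gammaOfOrderHom θ)) θ hθ (a • b) t)
  one_smul := by
    rintro ⟨m, x, t⟩
    change Quot.mk _ _ = _
    dsimp only
    rw [one_smul]
  mul_smul a b := by
    rintro ⟨m, x, t⟩
    change Quot.mk _ _ = Quot.mk _ _
    dsimp only
    rw [mul_smul]

lemma BVec.continuous_smul (a : G) : Continuous fun x : BVec F G => a • x := by
  refine continuous_quot_lift _ ?_
  refine continuous_quot_mk.comp (continuous_sigma fun m => ?_)
  refine continuous_sigmaMk.comp ?_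
  exact ((Vec.continuous_smul a).comp continuous_fst).prodMk continuous_snd

lemma BVec.smul_base (a : G) : a • BVec.base F G = BVec.base F G := rfl

variable (F G) in
/-- The classifying space `KF_G^{[∞]} = Ω B vec_G^{F,∞}`. -/
structure KSpace : Type (max u w) where
  loop : Path (BVec.base F G) (BVec.base F G)

/-- The loop space, with the k-space topology associated to the compact-open topology. -/
instance : TopologicalSpace (KSpace F G) :=
  @TopologicalSpace.compactlyGenerated.{max u w} (KSpace F G)
    (TopologicalSpace.induced KSpace.loop inferInstance)

instance : MulAction G (KSpace F G) where
  smul a x := ⟨⟨⟨fun t => a • x.loop t, (BVec.continuous_smul a).comp x.loop.continuous⟩,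
    by
      change a • x.loop 0 = _
      rw [x.loop.source, BVec.smul_base], by
      change a • x.loop 1 = _
      rw [x.loop.target, BVec.smul_base]⟩⟩
  one_smul x := by
    refine congrArg KSpace.mk (Path.ext (funext fun t => ?_))
    exact one_smul G (x.loop t)
  mul_smul a b x := by
    refine congrArg KSpace.mk (Path.ext (funext fun t => ?_))
    exact mul_smul a b (x.loop t)

variable (F G) in
/-- The base point of the loop space. -/
def KSpace.base : KSpace F G := ⟨Path.refl _⟩

end Realization

/-! ## `G`-CW-pairs -/

section GCW

variable (G : Type u) [Group G] [TopologicalSpace G]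

/-- The closed unit disk `D^n`. -/
abbrev Disk (n : ℕ) : Type := Metric.closedBall (0 : EuclideanSpace ℝ (Fin n)) 1

/-- The structure of a relative `G`-CW-complex `(X, A)` on a `G`-space `X`, with
`sk 0 = X_{(-1)} = A` and `sk (n + 1) = X_{(n)}`: `X` is the direct limit of the `sk n`, and
`sk (n + 1)` is the push-out of `sk n` and of a family of `G`-cells `(G/H) × D^n` along their
boundaries `(G/H) × S^(n-1)`. -/
structure RelGCW {X : Type v} [TopologicalSpace X] [MulAction G X] (A : Set X) where
  sk : ℕ → Set X
  sk_zero : sk 0 = A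
  sk_mono : ∀ n, sk n ⊆ sk (n + 1)
  sk_smul : ∀ n (g : G), ∀ x ∈ sk n, g • x ∈ sk n
  iUnion_sk : ⋃ n, sk n = Set.univ
  isClosed_of_sk : ∀ C : Set X, (∀ n, IsClosed ((↑) ⁻¹' C : Set (sk n))) → IsClosed C
  cell : ℕ → Type v
  stab : ∀ n, cell n → Subgroup G
  isClosed_stab : ∀ n i, IsClosed (stab n i : Set G)
  char : ∀ n (i : cell n), C((G ⧸ stab n i) × Disk n, X)
  char_smul : ∀ n i (g : G) q x, char n i (g • q, x) = g • char n i (q, x)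
  char_sphere : ∀ n i q (x : Disk n), ‖x.1‖ = 1 → char n i (q, x) ∈ sk n
  char_injective : ∀ n i j q r (x y : Disk n), ‖x.1‖ < 1 → ‖y.1‖ < 1 →
    char n i (q, x) = char n j (r, y) →
    (⟨i, q, x⟩ : Σ i : cell n, (G ⧸ stab n i) × Disk n) = ⟨j, r, y⟩
  char_range : ∀ n, {z | ∃ i q, ∃ x : Disk n, ‖x.1‖ < 1 ∧ char n i (q, x) = z} =
    sk (n + 1) \ sk n
  isClosed_of_char : ∀ n (C : Set X), IsClosed ((↑) ⁻¹' C : Set (sk n)) →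
    (∀ i, IsClosed (char n i ⁻¹' C)) → IsClosed ((↑) ⁻¹' C : Set (sk (n + 1)))

/-- `(X, A)` is a relative `G`-CW-complex. -/
def IsRelGCW {X : Type v} [TopologicalSpace X] [MulAction G X] (A : Set X) : Prop :=
  Nonempty (RelGCW G A)

/-- `X` is a `G`-CW-complex. -/
def IsGCW (X : Type v) [TopologicalSpace X] [MulAction G X] : Prop :=
  IsRelGCW G (∅ : Set X)

/-- A `G`-CW-pair: `X` and `A` are `G`-CW-complexes and `(X, A)` is a relative
`G`-CW-complex. -/
structure GCWPair where
  X : Type v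
  [top : TopologicalSpace X]
  [act : MulAction G X]
  [cont : ContinuousSMul G X]
  A : SubMulAction G X
  isGCW : IsGCW G X
  isGCW_sub : IsGCW G A
  isRelGCW : IsRelGCW G (A : Set X)

attribute [instance] GCWPair.top GCWPair.act GCWPair.cont

variable {G}

lemma isGCW_of_isEmpty (X : Type v) [TopologicalSpace X] [MulAction G X] [IsEmpty X] :
    IsGCW G X :=
  ⟨{ sk := fun _ => ∅
     sk_zero := rfl
     sk_mono := fun _ => le_rfl
     sk_smul := fun _ _ x => isEmptyElim x
     iUnion_sk := Subsingleton.elim _ _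
     isClosed_of_sk := fun C _ => by
      rw [Subsingleton.elim C ∅]
      exact isClosed_empty
     cell := fun _ => PEmpty
     stab := fun _ i => i.elim
     isClosed_stab := fun _ i => i.elim
     char := fun _ i => i.elim
     char_smul := fun _ i => i.elim
     char_sphere := fun _ i => i.elim
     char_injective := fun _ i => i.elim
     char_range := fun _ => Subsingleton.elim _ _
     isClosed_of_char := fun _ C _ _ => by
      rw [Subsingleton.elim C ∅]
      exact isClosed_empty }⟩

instance (X : Type v) [MulAction G X] : IsEmpty (⊥ : SubMulAction G X) :=
  ⟨fun x => x.2⟩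

/-- The pair `(X, ∅)`. -/
def GCWPair.abs (P : GCWPair.{u, v} G) : GCWPair.{u, v} G where
  X := P.X
  A := ⊥
  isGCW := P.isGCW
  isGCW_sub := isGCW_of_isEmpty _
  isRelGCW := P.isGCW

/-- The pair `(A, ∅)`. -/
def GCWPair.sub (P : GCWPair.{u, v} G) : GCWPair.{u, v} G where
  X := P.A
  cont := ⟨(continuous_fst.smul (continuous_subtype_val.comp continuous_snd)).subtype_mk _⟩
  A := ⊥
  isGCW := P.isGCW_sub
  isGCW_sub := isGCW_of_isEmpty _
  isRelGCW := P.isGCW_sub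

/-- Maps of `G`-CW-pairs: the continuous `G`-maps from `X` to `Y` that map `A` into `B`. -/
structure PairMap (P Q : GCWPair.{u, v} G) where
  toFun : C(P.X, Q.X)
  map_smul : ∀ (g : G) x, toFun (g • x) = g • toFun x
  map_sub : ∀ x ∈ P.A, toFun x ∈ Q.A

/-- The identity map. -/
def PairMap.id (P : GCWPair.{u, v} G) : PairMap P P :=
  ⟨ContinuousMap.id _, fun _ _ => rfl, fun _ h => h⟩

/-- The composite `g ∘ f`. -/
def PairMap.comp {P Q R : GCWPair.{u, v} G} (g : PairMap Q R) (f : PairMap P Q) : PairMap P R :=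
  ⟨g.toFun.comp f.toFun, fun a x => (congrArg g.toFun (f.map_smul a x)).trans (g.map_smul a _),
    fun x hx => g.map_sub _ (f.map_sub x hx)⟩

/-- The restriction `(A, ∅) → (B, ∅)` of a map of pairs `(X, A) → (Y, B)`. -/
def PairMap.sub {P Q : GCWPair.{u, v} G} (f : PairMap P Q) : PairMap P.sub Q.sub where
  toFun := ⟨fun x : P.A => (⟨f.toFun x.1, f.map_sub x.1 x.2⟩ : Q.A),
    (f.toFun.continuous.comp continuous_subtype_val).subtype_mk _⟩
  map_smul g x := Subtype.ext (f.map_smul g x.1)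
  map_sub _ h := h.elim

/-- The inclusion `(A, ∅) → (X, ∅)`. -/
def GCWPair.incl (P : GCWPair.{u, v} G) : PairMap P.sub P.abs where
  toFun := ⟨fun x : P.A => (x : P.X), continuous_subtype_val⟩
  map_smul _ _ := rfl
  map_sub _ h := h.elim

/-- The map `(X, ∅) → (X, A)`. -/
def GCWPair.quot (P : GCWPair.{u, v} G) : PairMap P.abs P where
  toFun := ContinuousMap.id P.X
  map_smul _ _ := rfl
  map_sub _ h := h.elim

/-- Equivariant homotopy of maps of pairs. -/
def PairMap.Homotopic {P Q : GCWPair.{u, v} G} (f₀ f₁ : PairMap P Q) : Prop :=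
  ContinuousMap.HomotopicWith f₀.toFun f₁.toFun fun f =>
    (∀ (g : G) x, f (g • x) = g • f x) ∧ ∀ x ∈ P.A, f x ∈ Q.A

/-- The map of pairs `f : (X, A) → (Y, B)` exhibits `Y` as the push-out of `X` and `B` along
`A`. -/
structure PairMap.IsPushout {P Q : GCWPair.{u, v} G} (f : PairMap P Q) : Prop where
  bijOn : Set.BijOn f.toFun (P.A : Set P.X)ᶜ (Q.A : Set Q.X)ᶜ
  isClosed : ∀ C : Set Q.X, IsClosed ((↑) ⁻¹' C : Set Q.A) → IsClosed (f.toFun ⁻¹' C) → IsClosed C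

/-- The maps of pairs `f i : (X_i, A_i) → (Y, B)` exhibit `(Y, B)` as the disjoint union of the
pairs `(X_i, A_i)`. -/
structure IsDisjointUnion {ι : Type v} {P : ι → GCWPair.{u, v} G} {Q : GCWPair.{u, v} G}
    (f : ∀ i, PairMap (P i) Q) : Prop where
  isHomeomorph : IsHomeomorph fun x : Σ i, (P i).X => (f x.1).toFun x.2
  mem_iff : ∀ i x, (f i).toFun x ∈ Q.A ↔ x ∈ (P i).A

/-- Good equivariant cohomology theories in negative degrees, on the category of `G`-CW-pairs:
`h n` stands for the functor `h^{-n}`, and `res n f` for the homomorphism `f^*` that is induced by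
the map of pairs `f` in degree `-n`. -/
structure IsGoodCohomologyTheory (h : ℕ → GCWPair.{u, v} G → Type*)
    [∀ n P, AddCommGroup (h n P)]
    (res : ∀ (n : ℕ) {P Q : GCWPair.{u, v} G}, PairMap P Q → h n Q → h n P) : Prop where
  res_add : ∀ n {P Q : GCWPair.{u, v} G} (f : PairMap P Q) a b,
    res n f (a + b) = res n f a + res n f b
  res_id : ∀ n (P : GCWPair.{u, v} G) a, res n (PairMap.id P) a = a
  res_comp : ∀ n {P Q R : GCWPair.{u, v} G} (g : PairMap Q R) (f : PairMap P Q) a,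
    res n (g.comp f) a = res n f (res n g a)
  homotopy : ∀ n {P Q : GCWPair.{u, v} G} (f₀ f₁ : PairMap P Q), f₀.Homotopic f₁ →
    res n f₀ = res n f₁
  excision : ∀ n {P Q : GCWPair.{u, v} G} (f : PairMap P Q), f.IsPushout →
    Function.Bijective (res n f)
  disjoint_union : ∀ n {ι : Type v} {P : ι → GCWPair.{u, v} G} {Q : GCWPair.{u, v} G}
    (f : ∀ i, PairMap (P i) Q), IsDisjointUnion f →
    Function.Bijective fun (a : h n Q) i => res n (f i) a
  exact_seq : ∃ δ : ∀ (n : ℕ) (P : GCWPair.{u, v} G), h (n + 1) P.sub →+ h n P,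
    (∀ n {P Q : GCWPair.{u, v} G} (f : PairMap P Q) b,
      δ n P (res (n + 1) f.sub b) = res n f (δ n Q b)) ∧
    ∀ n P, Function.Exact (res n P.quot) (res n P.incl) ∧
      Function.Exact (res (n + 1) P.incl) (δ n P) ∧
      Function.Exact (δ n P) (res n P.quot)

end GCW

/-! ## Quotients, suspensions and the groups `KF_G^{-n}(X, A)` -/

section Quotients

variable {G : Type u} [Group G]

/-- The identification of all the points of `C` with an added point. -/
inductive CollapseRel {Z : Type v} (C : Set Z) : Z ⊕ Unit → Z ⊕ Unit → Prop
  | glue (z : Z) (hz : z ∈ C) : CollapseRel C (Sum.inl z) (Sum.inr ())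

/-- The pointed `G`-space `Z / C`, i.e. the push-out of `Z` and of a point along `C`
(if `C` is empty, a disjoint base point is added to `Z`). -/
def Collapse {Z : Type v} [MulAction G Z] (C : SubMulAction G Z) : Type v :=
  Quot (CollapseRel (C : Set Z))

namespace Collapse

variable {Z W : Type v} [MulAction G Z] [MulAction G W]
  (C : SubMulAction G Z) (D : SubMulAction G W)

instance [TopologicalSpace Z] : TopologicalSpace (Collapse C) := inferInstanceAs (TopologicalSpace (Quot _))

/-- The base point. -/
def base : Collapse C := Quot.mk _ (Sum.inr ())

variable {C D}

/-- The map between quotients that is induced by a map of pairs. -/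
def map (f : Z → W) (hf : ∀ z ∈ C, f z ∈ D) : Collapse C → Collapse D :=
  Quot.lift (Sum.elim (fun z => Quot.mk _ (Sum.inl (f z))) fun _ => base D) (by
    rintro _ _ ⟨z, hz⟩
    exact Quot.sound (CollapseRel.glue _ (hf z hz)))

lemma map_base (f : Z → W) (hf : ∀ z ∈ C, f z ∈ D) : map f hf (base C) = base D := rfl

lemma continuous_map [TopologicalSpace Z] [TopologicalSpace W]
    (f : Z → W) (hf : ∀ z ∈ C, f z ∈ D) (h : Continuous f) :
    Continuous (map f hf) :=
  continuous_quot_lift _ (Continuous.sumElim (continuous_quot_mk.comp (continuous_inl.comp h))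
    continuous_const)

instance : MulAction G (Collapse C) where
  smul a := map (fun z => a • z) fun _ hz => C.smul_mem a hz
  one_smul := by
    rintro ⟨z | _⟩
    · exact congrArg (fun z => Quot.mk _ (Sum.inl z)) (one_smul G z)
    · rfl
  mul_smul a b := by
    rintro ⟨z | _⟩
    · exact congrArg (fun z => Quot.mk _ (Sum.inl z)) (mul_smul a b z)
    · rfl

lemma smul_base (a : G) : a • base C = base C := rfl

lemma map_smul (f : Z → W) (hf : ∀ z ∈ C, f z ∈ D) (hs : ∀ (a : G) z, f (a • z) = a • f z)
    (a : G) (x : Collapse C) : map f hf (a • x) = a • map f hf x := by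
  obtain ⟨z | _⟩ := x
  · exact congrArg (fun z => Quot.mk _ (Sum.inl z)) (hs a z)
  · rfl

end Collapse

/-- The product of `Y` with the cube `[0,1]^n`, on which `G` acts trivially. -/
structure TimesCube (n : ℕ) (Y : Type v) where
  pt : Y
  time : Fin n → I

namespace TimesCube

variable {n : ℕ} {Y Y' : Type v}

instance [TopologicalSpace Y] : TopologicalSpace (TimesCube n Y) :=
  TopologicalSpace.induced (fun z => (z.pt, z.time)) inferInstance

instance [MulAction G Y] : MulAction G (TimesCube n Y) where
  smul a z := ⟨a • z.pt, z.time⟩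
  one_smul z := congrArg (fun y => TimesCube.mk y z.time) (one_smul G z.pt)
  mul_smul a b z := congrArg (fun y => TimesCube.mk y z.time) (mul_smul a b z.pt)

lemma smul_pt [MulAction G Y] (a : G) (z : TimesCube n Y) : (a • z).pt = a • z.pt := rfl

lemma smul_time [MulAction G Y] (a : G) (z : TimesCube n Y) : (a • z).time = z.time := rfl

lemma continuous_map [TopologicalSpace Y] [TopologicalSpace Y'] {f : Y → Y'} (hf : Continuous f) :
    Continuous fun z : TimesCube n Y => (⟨f z.pt, z.time⟩ : TimesCube n Y') := by
  have h : Continuous fun z : TimesCube n Y => (z.pt, z.time) := continuous_induced_dom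
  exact continuous_induced_rng.2 ((hf.comp h.fst).prodMk h.snd)

end TimesCube

variable [TopologicalSpace G]

/-- The pointed `G`-space `X / A`. -/
abbrev GCWPair.Quotient (P : GCWPair.{u, v} G) : Type v := Collapse P.A

/-- The subspace of `(X/A) × [0,1]^n` consisting of the points whose first component is the base
point or whose second component is in the boundary of the cube. -/
def GCWPair.suspSub (P : GCWPair.{u, v} G) (n : ℕ) : SubMulAction G (TimesCube n P.Quotient) where
  carrier := {z | z.pt = Collapse.base P.A ∨ ∃ k, z.time k = 0 ∨ z.time k = 1}
  smul_mem' a z hz := by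
    rcases hz with hz | hz
    · left
      rw [TimesCube.smul_pt, hz, Collapse.smul_base]
    · exact Or.inr hz

/-- The `n`-fold reduced suspension `Σ^n (X/A) = (X/A) ∧ ([0,1]^n/∂[0,1]^n)`. -/
abbrev GCWPair.Susp (P : GCWPair.{u, v} G) (n : ℕ) : Type v := Collapse (P.suspSub n)

/-- The base point of the suspension. -/
abbrev GCWPair.suspBase (P : GCWPair.{u, v} G) (n : ℕ) : P.Susp n := Collapse.base (P.suspSub n)

/-- The map `X/A → Y/B` that is induced by a map of pairs. -/
def PairMap.quotMap {P Q : GCWPair.{u, v} G} (f : PairMap P Q) : P.Quotient → Q.Quotient :=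
  Collapse.map f.toFun f.map_sub

lemma PairMap.suspMap_mem {P Q : GCWPair.{u, v} G} (f : PairMap P Q) (n : ℕ) :
    ∀ z ∈ P.suspSub n, (⟨f.quotMap z.pt, z.time⟩ : TimesCube n Q.Quotient) ∈ Q.suspSub n := by
  rintro z (hz | hz)
  · left
    change f.quotMap z.pt = _
    rw [hz]
    rfl
  · exact Or.inr hz

/-- The map `Σ^n (X/A) → Σ^n (Y/B)` that is induced by a map of pairs. -/
def PairMap.suspMap {P Q : GCWPair.{u, v} G} (f : PairMap P Q) (n : ℕ) :
    C(P.Susp n, Q.Susp n) :=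
  ⟨Collapse.map (fun z => ⟨f.quotMap z.pt, z.time⟩) (f.suspMap_mem n),
    Collapse.continuous_map _ _ (TimesCube.continuous_map
      (Collapse.continuous_map _ _ f.toFun.continuous))⟩

lemma PairMap.suspMap_smul {P Q : GCWPair.{u, v} G} (f : PairMap P Q) (n : ℕ) (a : G)
    (x : P.Susp n) : f.suspMap n (a • x) = a • f.suspMap n x := by
  refine Collapse.map_smul _ (f.suspMap_mem n) (fun a z => ?_) a x
  exact congrArg (fun y => TimesCube.mk y z.time)
    (Collapse.map_smul f.toFun f.map_sub f.map_smul a z.pt)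

variable [IsTopologicalGroup G] (F : Type w) [RCLike F]

/-- The pointed equivariant maps from `Σ^n (X/A)` to `KF_G^{[∞]}`. -/
def IsPointedGMap (P : GCWPair.{u, v} G) (n : ℕ) (f : C(P.Susp n, KSpace F G)) : Prop :=
  (∀ (a : G) x, f (a • x) = a • f x) ∧ f (P.suspBase n) = KSpace.base F G

/-- The pointed `G`-maps from `Σ^n (X/A)` to `KF_G^{[∞]}`, up to equivariant pointed homotopy. -/
instance mapSetoid (P : GCWPair.{u, v} G) (n : ℕ) : Setoid {f // IsPointedGMap F P n f} where
  r f g := ContinuousMap.HomotopicWith f.1 g.1 (IsPointedGMap F P n)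
  iseqv :=
    { refl := fun f => ContinuousMap.HomotopicWith.refl f.1 f.2
      symm := fun h => h.symm
      trans := fun h h' => h.trans h' }

/-- The set `KF_G^{-n}(X, A) = [Σ^n (X/A), KF_G^{[∞]}]_G^•`. -/
def KF (n : ℕ) (P : GCWPair.{u, v} G) : Type (max u v w) := Quotient (mapSetoid F P n)

variable {F}

/-- The class of a pointed `G`-map. -/
def KF.mk {n : ℕ} {P : GCWPair.{u, v} G} (f : {f // IsPointedGMap F P n f}) : KF F n P :=
  Quotient.mk _ f

lemma IsPointedGMap.comp {P Q : GCWPair.{u, v} G} (f : PairMap P Q) {n : ℕ}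
    {φ : C(Q.Susp n, KSpace F G)} (hφ : IsPointedGMap F Q n φ) :
    IsPointedGMap F P n (φ.comp (f.suspMap n)) := by
  refine ⟨fun a x => ?_, hφ.2⟩
  change φ (f.suspMap n (a • x)) = _
  rw [f.suspMap_smul, hφ.1]
  rfl

/-- The map `KF_G^{-n}(Y, B) → KF_G^{-n}(X, A)` that is induced by a map of pairs. -/
def KF.res (n : ℕ) {P Q : GCWPair.{u, v} G} (f : PairMap P Q) : KF F n Q → KF F n P :=
  Quotient.map (fun φ => ⟨φ.1.comp (f.suspMap n), φ.2.comp f⟩) (by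
    rintro φ ψ ⟨H⟩
    refine ⟨⟨⟨H.toContinuousMap.comp
      ((ContinuousMap.id I).prodMap (f.suspMap n)), fun x => ?_, fun x => ?_⟩, fun t => ?_⟩⟩
    · exact H.map_zero_left _
    · exact H.map_one_left _
    · exact (H.prop' t).comp f)

/-- `c` is the pointwise concatenation of `a` and `b`. -/
def IsConcat {n : ℕ} {P : GCWPair.{u, v} G} (a b c : {f // IsPointedGMap F P n f}) : Prop :=
  ∀ x, (c.1 x).loop = (a.1 x).loop.trans (b.1 x).loop

end Quotients

end EquivKTheory

end

/-!
The groups `KF_G^{-n}(X, A)` are analysed as homotopy groups of spaces of equivariant maps to the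
classifying space `BVec F G`, of which `KSpace F G` is the loop space. By adjunction
(`KF.equivRelClass`), `KF_G^{-n}(X, A)` is the set `RelClass` of homotopy classes of equivariant
maps `X × (I × [0,1]^n) → BVec F G` that are trivial on `A` and on the boundary of `I × [0,1]^n`.
This uses that `G`-CW-complexes are compactly generated (`IsGCW.uCompactlyGeneratedSpace`), because
the loop space carries the k-space topology. The cohomological statements then hold for every
target `W` that is an equivariant H-space on which `G` acts by continuous maps
(`isGoodCohomologyTheory_relClass`), and they are transported along the adjunction
(`IsGoodCohomologyTheory.of_equiv`).

Concatenation of loops makes `RelClass` a group. For `n = 0` there is only one loop coordinate, so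
that commutativity requires a second operation on `BVec F G`: it is the direct sum of vector
spaces, and the Eckmann-Hilton argument shows that the group is abelian. To form direct sums, the
labels of the first summand are moved to the even numbers and those of the second one to the odd
numbers (`Mor.sum`). This sum is natural on morphisms, hence it is defined levelwise on simplices,
and it passes to both geometric realizations, thin and thick, by the construction `Pairing.prod`:
two points of `Δ^m` and `Δ^k` are the images of one point of a nondegenerate simplex of the product
of the ordered sets `[m] × [k]` (`exists_coupling`), obtained from the monotone coupling of two
probability measures. Only injective maps may be used for identifications in the thick realization,
so that the simplex has to be nondegenerate. As a measure that is carried by a chain of `[m] × [k]`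
is determined by its marginals, the result does not depend on the choices (`Pairing.point_eq`).

Two points require care. The sum with the base point is not the identity but a change of labels,
which is deformed to the identity by means of a pairing with the simplicial interval
(`BVec.deform`). Moreover, the sum is jointly continuous on products formed in k-spaces only
(`KContinuous₂`), which suffices for the pointwise sum of maps defined on compactly generated
spaces. The structure that remains is recorded in the class `EquivariantHSpace`.

Homotopy invariance is composition of homotopies. Excision and the axiom for disjoint unions hold
because maps and homotopies glue uniquely along push-outs and disjoint unions
(`RelMap.exists_pullback_eq_of_isPushout`, `RelMap.exists_pullback_eq_of_isDisjointUnion`). The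
long exact sequence rests on the equivariant homotopy extension property of relative
`G`-CW-complexes (`IsRelGCW.exists_extension`), proved cell by cell with the retraction of `D^n × I` to
`(D^n × 0) ∪ (S^(n-1) × I)`. A map on `A` with one more cube coordinate is a homotopy on `A`
from the trivial map to itself; the end of an extension to `X`, which starts at the trivial map, is
its image under the connecting map (`RelMap.IsDelta`, `RelClass.delta`). That the connecting map is
well defined follows from its additivity and from `RelMap.IsDelta.homotopic_zero`.
-/

noncomputable section

namespace EquivKTheory

/-! ### Compactly generated spaces and jointly continuous operations -/

section CompactlyGenerated

universe a b c d t

/-- The continuity of a map of two variables on the product formed in k-spaces, tested on pairs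
of continuous maps defined on a locally compact Hausdorff space. -/
def KContinuous₂.{s, x, y, z} {X : Type x} {Y : Type y} {Z : Type z} [TopologicalSpace X]
    [TopologicalSpace Y] [TopologicalSpace Z] (f : X → Y → Z) : Prop :=
  ∀ (T : Type s) [TopologicalSpace T] [LocallyCompactSpace T] [T2Space T] (α : T → X) (β : T → Y),
    Continuous α → Continuous β → Continuous fun t => f (α t) (β t)

lemma locallyCompactSpace_of_compactSpace {X : Type a} [TopologicalSpace X] [CompactSpace X]
    [T2Space X] : LocallyCompactSpace X := by
  have : R1Space X := inferInstance
  have : WeaklyLocallyCompactSpace X := inferInstance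
  infer_instance

lemma uCompactlyGeneratedSpace_of_locallyCompactSpace {X : Type a} [TopologicalSpace X]
    [LocallyCompactSpace X] [T2Space X] : UCompactlyGeneratedSpace.{a} X := by
  have h : CompactlyGeneratedSpace X := inferInstance
  exact h

/-- A continuous map from a compactly generated space remains continuous if the topology of its
target is replaced by the k-space topology, whatever universes of test spaces are used for the two.
-/
lemma continuous_to_compactlyGenerated {T : Type a} [TopologicalSpace T]
    [UCompactlyGeneratedSpace.{b} T] {Y : Type d} [tY : TopologicalSpace Y] {f : T → Y}
    (hf : Continuous f) :
    @Continuous _ _ _ (TopologicalSpace.compactlyGenerated.{max b c} Y) f := by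
  refine @continuous_from_uCompactlyGeneratedSpace T Y _
    (TopologicalSpace.compactlyGenerated.{max b c} Y) _ f fun S g => ?_
  let S' : CompHaus.{max b c} := CompHaus.of (ULift.{c} S)
  let s : @ContinuousMap S' Y _ tY :=
    @ContinuousMap.mk _ _ _ tY (fun x : S' => f (g (ULift.down x)))
      (@Continuous.comp _ _ _ _ _ tY _ _ hf (g.continuous.comp continuous_uliftDown))
  let Φ : (Σ i : (S : CompHaus.{max b c}) × @ContinuousMap S Y _ tY, i.fst) → Y :=
    fun x => x.1.2 x.2
  have h1 : @Continuous _ _ inferInstance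
      (@TopologicalSpace.compactlyGenerated.{max b c} Y tY) Φ := continuous_coinduced_rng
  have h2 : Continuous (fun x : S' =>
      (⟨⟨S', s⟩, x⟩ : Σ i : (S : CompHaus.{max b c}) × @ContinuousMap S Y _ tY, i.fst)) :=
    @continuous_sigmaMk _
      (fun i : (S : CompHaus.{max b c}) × @ContinuousMap S Y _ tY => (i.fst : Type _)) _ ⟨S', s⟩
  have h3 := @Continuous.comp _ _ _ _ _
    (@TopologicalSpace.compactlyGenerated.{max b c} Y tY) _ _ h1 h2
  exact @Continuous.comp S S' Y _ _ (@TopologicalSpace.compactlyGenerated.{max b c} Y tY)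
    (fun x => ULift.up x) (fun x => f (g (ULift.down x))) h3 continuous_uliftUp

lemma continuous_compactlyGenerated_id {Y : Type d} [tY : TopologicalSpace Y] :
    @Continuous Y Y (TopologicalSpace.compactlyGenerated.{c} Y) tY id :=
  continuous_from_compactlyGenerated _ fun _ g => g.continuous

lemma uCompactlyGeneratedSpace_compactlyGenerated {Y : Type d} (tY : TopologicalSpace Y) :
    @UCompactlyGeneratedSpace.{c} Y (@TopologicalSpace.compactlyGenerated.{c} Y tY) := by
  let f : (Σ (i : (S : CompHaus.{c}) × C(S, Y)), i.fst) → Y := fun x => x.1.2 x.2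
  exact @uCompactlyGeneratedSpace_of_coinduced.{c} _ _ inferInstance
    (@TopologicalSpace.compactlyGenerated.{c} Y tY)
    inferInstance f continuous_coinduced_rng rfl

/-- The product of a compactly generated space with a locally compact space is compactly
generated: after currying, continuity on `X × L` becomes continuity of a map from `X`. -/
lemma uCompactlyGeneratedSpace_prod {X : Type a} {L : Type b} [TopologicalSpace X]
    [TopologicalSpace L] [UCompactlyGeneratedSpace.{c} X] [LocallyCompactSpace L] [T2Space L] :
    UCompactlyGeneratedSpace.{max b c} (X × L) := by
  refine uCompactlyGeneratedSpace_of_continuous_maps fun {Z} _ f hf => ?_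
  have h1 : ∀ (S : Type c) [TopologicalSpace S] [CompactSpace S] [T2Space S] (g : C(S, X)),
      Continuous fun p : S × L => f (g p.1, p.2) := by
    intro S _ _ _ g
    have : Continuous fun p : ULift.{b} S × ULift.{c} L => f (g p.1.down, p.2.down) := by
      have : LocallyCompactSpace (ULift.{b} S) := locallyCompactSpace_of_compactSpace
      have : LocallyCompactSpace (ULift.{c} L) :=
        Homeomorph.ulift.isClosedEmbedding.locallyCompactSpace
      have : UCompactlyGeneratedSpace.{max b c} (ULift.{b} S × ULift.{c} L) :=
        uCompactlyGeneratedSpace_of_locallyCompactSpace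
      refine continuous_from_uCompactlyGeneratedSpace.{max b c} _ fun K h => ?_
      exact hf K ⟨fun k => (g (h k).1.down, (h k).2.down), by
        have := h.continuous
        exact (g.continuous.comp (continuous_uliftDown.comp this.fst)).prodMk
          (continuous_uliftDown.comp this.snd)⟩
    exact this.comp ((continuous_uliftUp.comp continuous_fst).prodMk
      (continuous_uliftUp.comp continuous_snd))
  have h0 : ∀ x, Continuous fun l => f (x, l) := fun x =>
    (h1 PUnit ⟨fun _ => x, continuous_const⟩).comp
      (continuous_const.prodMk continuous_id : Continuous fun l : L => (PUnit.unit, l))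
  have h2 : Continuous fun x => (⟨fun l => f (x, l), h0 x⟩ : C(L, Z)) := by
    refine continuous_from_uCompactlyGeneratedSpace.{c} _ fun S g => ?_
    exact (ContinuousMap.curry ⟨_, h1 S g⟩).continuous
  exact ContinuousMap.continuous_uncurry_of_continuous ⟨_, h2⟩

/-- Joint continuity in k-spaces may be checked after pulling back along quotient maps. -/
lemma KContinuous₂.of_isQuotientMap {X₀ : Type*} {Y₀ : Type*} {X Y Z : Type*}
    [TopologicalSpace X₀] [TopologicalSpace Y₀] [TopologicalSpace X] [TopologicalSpace Y]
    [TopologicalSpace Z] [UCompactlyGeneratedSpace.{a} X₀] [UCompactlyGeneratedSpace.{b} Y₀]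
    {q : X₀ → X} {r : Y₀ → Y} (hq : Topology.IsQuotientMap q) (hr : Topology.IsQuotientMap r)
    {f : X → Y → Z} (h : KContinuous₂.{max a b} fun x y => f (q x) (r y)) :
    KContinuous₂.{t} f := by
  have h1 : ∀ (K : Type a) (L : Type b) [TopologicalSpace K] [CompactSpace K] [T2Space K]
      [TopologicalSpace L] [CompactSpace L] [T2Space L] (α : C(K, X₀)) (β : C(L, Y₀)),
      Continuous fun p : K × L => f (q (α p.1)) (r (β p.2)) := by
    intro K L _ _ _ _ _ _ α β
    have : LocallyCompactSpace (K × L) := locallyCompactSpace_of_compactSpace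
    exact h (K × L) _ _ (α.continuous.comp continuous_fst) (β.continuous.comp continuous_snd)
  -- The two quotient maps are treated one after the other: a map on a product with a locally compact
  -- space is curried, and then tested on compact Hausdorff spaces over the domain of the quotient map.
  have h2 : ∀ (L : Type b) [TopologicalSpace L] [CompactSpace L] [T2Space L] (β : C(L, Y₀)),
      Continuous fun p : X × L => f p.1 (r (β p.2)) := by
    intro L _ _ _ β
    have h0 : ∀ x, Continuous fun l => f x (r (β l)) := by
      intro x
      obtain ⟨x, rfl⟩ := hq.surjective x
      exact (h1 PUnit L ⟨fun _ => x, continuous_const⟩ β).comp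
        (continuous_const.prodMk continuous_id : Continuous fun l : L => (PUnit.unit, l))
    have : Continuous fun x => (⟨fun l => f x (r (β l)), h0 x⟩ : C(L, Z)) := by
      rw [hq.continuous_iff]
      refine continuous_from_uCompactlyGeneratedSpace.{a} _ fun K α => ?_
      exact (ContinuousMap.curry ⟨_, h1 K L α β⟩).continuous
    exact ContinuousMap.continuous_uncurry_of_continuous ⟨_, this⟩
  intro T _ _ _ α β hα hβ
  have h3 : ∀ y, Continuous fun s => f (α s) y := by
    intro y
    obtain ⟨y, rfl⟩ := hr.surjective y
    exact (h2 PUnit ⟨fun _ => y, continuous_const⟩).comp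
      (hα.prodMk continuous_const : Continuous fun s => (α s, PUnit.unit))
  have h4 : Continuous fun y => (⟨fun s => f (α s) y, h3 y⟩ : C(T, Z)) := by
    rw [hr.continuous_iff]
    refine continuous_from_uCompactlyGeneratedSpace.{b} _ fun L β => ?_
    have : Continuous fun p : L × T => f (α p.2) (r (β p.1)) :=
      (h2 L β).comp ((hα.comp continuous_snd).prodMk continuous_fst)
    exact (ContinuousMap.curry ⟨_, this⟩).continuous
  have h5 := ContinuousMap.continuous_uncurry_of_continuous ⟨_, h4⟩
  exact h5.comp (hβ.prodMk continuous_id)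

/-- A jointly continuous operation in k-spaces may be applied to continuous maps defined on any
compactly generated space. -/
lemma KContinuous₂.continuous_comp {X Y Z : Type*} {S : Type*} [TopologicalSpace X]
    [TopologicalSpace Y] [TopologicalSpace Z] [TopologicalSpace S]
    [UCompactlyGeneratedSpace.{a} S] {f : X → Y → Z} (h : KContinuous₂.{a} f) {α : S → X}
    {β : S → Y} (hα : Continuous α) (hβ : Continuous β) :
    Continuous fun s => f (α s) (β s) :=
  continuous_from_uCompactlyGeneratedSpace.{a} _ fun K g =>
    have : LocallyCompactSpace K := locallyCompactSpace_of_compactSpace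
    h K _ _ (hα.comp g.continuous) (hβ.comp g.continuous)

lemma uCompactlyGeneratedSpace_of_isQuotientMap {X Y : Type*} [TopologicalSpace X]
    [TopologicalSpace Y] [UCompactlyGeneratedSpace.{a} X] {q : X → Y}
    (hq : Topology.IsQuotientMap q) : UCompactlyGeneratedSpace.{a} Y :=
  uCompactlyGeneratedSpace_of_isOpen fun s hs => by
    rw [← hq.isOpen_preimage]
    exact UCompactlyGeneratedSpace.isOpen.{a} fun S f =>
      hs S ⟨_, hq.continuous.comp f.continuous⟩

lemma uCompactlyGeneratedSpace_of_isOpen_subtype {X : Type*} [TopologicalSpace X]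
    [UCompactlyGeneratedSpace.{a} X] {U : Set X} (hU : IsOpen U) :
    UCompactlyGeneratedSpace.{a} U := by
  refine uCompactlyGeneratedSpace_of_continuous_maps fun {Z} _ f hf => ?_
  rw [continuous_def]
  intro s hs
  refine (Topology.IsInducing.subtypeVal.isOpen_iff).2
    ⟨Subtype.val '' (f ⁻¹' s), ?_, Set.preimage_image_eq _ Subtype.val_injective⟩
  refine UCompactlyGeneratedSpace.isOpen.{a} fun S g => ?_
  have hV : IsOpen (g ⁻¹' U) := hU.preimage g.continuous
  have : LocallyCompactSpace S := locallyCompactSpace_of_compactSpace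
  have : LocallyCompactSpace (g ⁻¹' U) := hV.locallyCompactSpace
  have : UCompactlyGeneratedSpace.{a} (g ⁻¹' U) := uCompactlyGeneratedSpace_of_locallyCompactSpace
  have h1 : Continuous fun x : g ⁻¹' U => f ⟨g x.1, x.2⟩ := by
    refine continuous_from_uCompactlyGeneratedSpace.{a} _ fun K k => ?_
    exact hf K ⟨fun x => ⟨g (k x).1, (k x).2⟩, by fun_prop⟩
  have h2 := hV.isOpenMap_subtype_val _ (hs.preimage h1)
  convert h2 using 1
  ext x
  constructor
  · rintro ⟨y, hy, hxy⟩
    exact ⟨⟨x, by rw [Set.mem_preimage, ← hxy]; exact y.2⟩, by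
      have : (⟨g x, by rw [← hxy]; exact y.2⟩ : U) = y := Subtype.ext hxy.symm
      simpa [this] using hy, rfl⟩
  · rintro ⟨y, hy, rfl⟩
    exact ⟨_, hy, rfl⟩

end CompactlyGenerated

/-! ### Relabelling and juxtaposition of morphisms -/

section Relabel

variable {F : Type w} [RCLike F]

/-- The linear map of `(F^(∞))^(∞)` that is induced by a map of labels. -/
def relabelAmb (r : ℕ → ℕ) : Amb F →ₗ[F] Amb F := Finsupp.lmapDomain F F (Prod.map r id)

lemma relabelAmb_injective (ρ : ℕ ↪ ℕ) : Function.Injective (relabelAmb (F := F) ρ) :=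
  Finsupp.mapDomain_injective (ρ.injective.prodMap Function.injective_id)

lemma relabelAmb_id : relabelAmb (F := F) (Function.Embedding.refl ℕ) = LinearMap.id := by
  have : Prod.map (Function.Embedding.refl ℕ) (id : ℕ → ℕ) = id := by ext <;> rfl
  rw [relabelAmb, this]
  exact Finsupp.lmapDomain_id F F

lemma relabelAmb_mem (ρ : ℕ ↪ ℕ) {A : Finset ℕ} {x : Amb F} (hx : x ∈ labelled F A) :
    relabelAmb ρ x ∈ labelled F (A.map ρ) := by
  classical
  rw [labelled, Finsupp.mem_supported] at hx ⊢
  intro q hq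
  have hq' := Finsupp.mapDomain_support (f := Prod.map ρ id) (s := x) hq
  obtain ⟨p, hp, rfl⟩ := Finset.mem_image.1 hq'
  exact Finset.mem_map_of_mem ρ (hx hp)

lemma IsLabelling.map {S : Type} {f : S → Finset ℕ} (hf : IsLabelling f) (ρ : ℕ ↪ ℕ) :
    IsLabelling fun s => (f s).map ρ := fun _ _ h =>
  (Finset.disjoint_map ρ).2 (hf h)

lemma exists_labelBack {S : Type} {f : S → Finset ℕ} {ρ : ℕ ↪ ℕ}
    (i : Labels fun s => (f s).map ρ) : ∃ j : Labels f, ρ j.1 = i.1 := by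
  obtain ⟨s, hs⟩ := i.2
  obtain ⟨j, hj, h⟩ := Finset.mem_map.1 hs
  exact ⟨⟨j, s, hj⟩, h⟩

/-- The label of which `i` is the image. -/
def labelBack {S : Type} (f : S → Finset ℕ) (ρ : ℕ ↪ ℕ) (i : Labels fun s => (f s).map ρ) :
    Labels f := (exists_labelBack i).choose

lemma labelBack_eq {S : Type} {f : S → Finset ℕ} {ρ : ℕ ↪ ℕ} (i : Labels fun s => (f s).map ρ)
    (j : Labels f) (h : ρ j.1 = i.1) : labelBack f ρ i = j :=
  Subtype.ext (ρ.injective ((exists_labelBack i).choose_spec.trans h.symm))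

/-- The relabelling of a pair of families of frames. -/
def relabelFrame {S : Type} (ρ τ : ℕ ↪ ℕ) (f : S → Finset ℕ) :
    ((Labels f → Amb F) × (Labels f → Amb F)) →ₗ[F]
      ((Labels (fun s => (f s).map ρ) → Amb F) × (Labels (fun s => (f s).map ρ) → Amb F)) :=
  LinearMap.prodMap
    (((relabelAmb ρ).compLeft _).comp (LinearMap.funLeft F (Amb F) (labelBack f ρ)))
    (((relabelAmb τ).compLeft _).comp (LinearMap.funLeft F (Amb F) (labelBack f ρ)))

lemma relabelFrame_fst {S : Type} (ρ τ : ℕ ↪ ℕ) (f : S → Finset ℕ)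
    (p : (Labels f → Amb F) × (Labels f → Amb F)) (i) :
    (relabelFrame ρ τ f p).1 i = relabelAmb ρ (p.1 (labelBack f ρ i)) := rfl

lemma relabelFrame_snd {S : Type} (ρ τ : ℕ ↪ ℕ) (f : S → Finset ℕ)
    (p : (Labels f → Amb F) × (Labels f → Amb F)) (i) :
    (relabelFrame ρ τ f p).2 i = relabelAmb τ (p.2 (labelBack f ρ i)) := rfl

lemma exists_labelBack_lab {S : Type} (f : S → Finset ℕ) (ρ : ℕ ↪ ℕ) (s : S)
    (i : ((f s).map ρ : Finset ℕ)) :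
    ∃ j : f s, ρ j.1 = i.1 ∧ labelBack f ρ (lab (fun s => (f s).map ρ) s i) = lab f s j := by
  obtain ⟨j, hj, h⟩ := Finset.mem_map.1 i.2
  exact ⟨⟨j, hj⟩, h, labelBack_eq _ _ h⟩

lemma IsFramePair.relabel {S : Type} (ρ τ : ℕ ↪ ℕ) {f g : S → Finset ℕ}
    {p : (Labels f → Amb F) × (Labels f → Amb F)} (hp : IsFramePair f g p) :
    IsFramePair (fun s => (f s).map ρ) (fun s => (g s).map τ) (relabelFrame ρ τ f p) where
  card_eq s := by rw [Finset.card_map, Finset.card_map, hp.card_eq]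
  mem_fst s i := by
    obtain ⟨j, -, h⟩ := exists_labelBack_lab f ρ s i
    rw [relabelFrame_fst, h]
    exact relabelAmb_mem ρ (hp.mem_fst s j)
  mem_snd s i := by
    obtain ⟨j, -, h⟩ := exists_labelBack_lab f ρ s i
    rw [relabelFrame_snd, h]
    exact relabelAmb_mem τ (hp.mem_snd s j)
  indep_fst s := by
    choose j hj h using exists_labelBack_lab f ρ s
    simp only [relabelFrame_fst, h]
    refine ((hp.indep_fst s).map' (relabelAmb ρ)
      (LinearMap.ker_eq_bot.2 (relabelAmb_injective ρ))).comp j fun i i' hi => Subtype.ext ?_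
    rw [← hj, ← hj, hi]
  indep_snd s := by
    choose j hj h using exists_labelBack_lab f ρ s
    simp only [relabelFrame_snd, h]
    refine ((hp.indep_snd s).map' (relabelAmb τ)
      (LinearMap.ker_eq_bot.2 (relabelAmb_injective τ))).comp j fun i i' hi => Subtype.ext ?_
    rw [← hj, ← hj, hi]

lemma frameGraph_relabel {S : Type} (ρ τ : ℕ ↪ ℕ) (f : S → Finset ℕ)
    (p : (Labels f → Amb F) × (Labels f → Amb F)) (s : S) :
    frameGraph (fun s => (f s).map ρ) (relabelFrame ρ τ f p) s =
      (frameGraph f p s).map ((relabelAmb ρ).prodMap (relabelAmb τ)) := by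
  rw [frameGraph, frameGraph, Submodule.map_span, ← Set.range_comp]
  congr 1
  ext x
  constructor
  · rintro ⟨i, rfl⟩
    obtain ⟨j, -, h⟩ := exists_labelBack_lab f ρ s i
    refine ⟨j, ?_⟩
    simp only [relabelFrame_fst, relabelFrame_snd, h]
    rfl
  · rintro ⟨j, rfl⟩
    refine ⟨⟨ρ j.1, Finset.mem_map_of_mem ρ j.2⟩, ?_⟩
    have h := labelBack_eq (lab (fun s => (f s).map ρ) s ⟨ρ j.1, Finset.mem_map_of_mem ρ j.2⟩)
      (lab f s j) rfl
    simp only [relabelFrame_fst, relabelFrame_snd, h]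
    rfl

/-- The relabelling of a morphism: the labels of its source are changed along `ρ`, and those of
its target along `τ`. -/
def Mor.relabel {S : Type} (ρ τ : ℕ ↪ ℕ) (φ : Mor F S) : Mor F S where
  dom s := (φ.dom s).map ρ
  cod s := (φ.cod s).map τ
  graph s := (φ.graph s).map ((relabelAmb ρ).prodMap (relabelAmb τ))
  dom_label := φ.dom_label.map ρ
  cod_label := φ.cod_label.map τ
  isIso := by
    obtain ⟨p, hp, h⟩ := φ.isIso
    exact ⟨_, hp.relabel ρ τ, fun s => by rw [frameGraph_relabel, h]⟩

lemma Mor.relabel_refl {S : Type} (φ : Mor F S) :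
    φ.relabel (Function.Embedding.refl ℕ) (Function.Embedding.refl ℕ) = φ := by
  refine Mor.ext (funext fun s => Finset.map_refl) (funext fun s => Finset.map_refl)
    (funext fun s => ?_)
  simp only [Mor.relabel, relabelAmb_id, LinearMap.prodMap_id, Submodule.map_id]

lemma Mor.continuous_relabel {S : Type} (ρ τ : ℕ ↪ ℕ) :
    Continuous (Mor.relabel (F := F) (S := S) ρ τ) := by
  refine continuous_iSup_dom.2 fun f => continuous_iSup_dom.2 fun g => ?_
  rw [continuous_coinduced_dom]
  let R : FramePair F f.1 g.1 → FramePair F (fun s => (f.1 s).map ρ) (fun s => (g.1 s).map τ) :=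
    fun p => ⟨relabelFrame ρ τ f.1 p.1, p.2.relabel ρ τ⟩
  have h1 : Continuous R := by
    have h0 : @Continuous (FramePair F f.1 g.1) _ _ (limitTopology F _) fun p => p.1 :=
      continuous_induced_dom
    have h0' := @Continuous.comp _ _ _ _ (limitTopology F _)
      (limitTopology F _) _ _ (continuous_linearMap (relabelFrame ρ τ f.1)) h0
    exact continuous_induced_rng.2 h0'
  have h2 := (Mor.continuous_mk' (F := F) (f.2.map ρ) (g.2.map τ)).comp h1
  convert h2 using 1
  funext p
  exact Mor.ext rfl rfl (funext fun s => (frameGraph_relabel ρ τ f.1 p.1 s).symm)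

lemma IsComp.relabel {S : Type} (ρ τ κ : ℕ ↪ ℕ) {φ ψ χ : Mor F S} (h : IsComp φ ψ χ) :
    IsComp (φ.relabel ρ τ) (ψ.relabel τ κ) (χ.relabel ρ κ) where
  cod_eq := funext fun s => congrArg (Finset.map τ) (congrFun h.cod_eq s)
  range_eq s := by
    have h1 : (LinearMap.snd F (Amb F) (Amb F)).comp ((relabelAmb ρ).prodMap (relabelAmb τ)) =
        (relabelAmb τ).comp (LinearMap.snd F (Amb F) (Amb F)) := rfl
    have h2 : (LinearMap.fst F (Amb F) (Amb F)).comp ((relabelAmb τ).prodMap (relabelAmb κ)) =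
        (relabelAmb τ).comp (LinearMap.fst F (Amb F) (Amb F)) := rfl
    simp only [Mor.relabel]
    rw [← Submodule.map_comp, ← Submodule.map_comp, h1, h2, Submodule.map_comp,
      Submodule.map_comp, h.range_eq]
  dom_comp := funext fun s => congrArg (Finset.map ρ) (congrFun h.dom_comp s)
  cod_comp := funext fun s => congrArg (Finset.map κ) (congrFun h.cod_comp s)
  mem_graph s x z := by
    constructor
    · rintro ⟨⟨x, z⟩, hxz, h'⟩
      obtain ⟨rfl, rfl⟩ := Prod.ext_iff.1 h'
      obtain ⟨y, h1, h2⟩ := (h.mem_graph s x z).1 hxz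
      exact ⟨relabelAmb τ y, ⟨_, h1, rfl⟩, ⟨_, h2, rfl⟩⟩
    · rintro ⟨_, ⟨⟨x, y⟩, h1, h1'⟩, ⟨⟨y', z⟩, h2, h2'⟩⟩
      obtain ⟨rfl, rfl⟩ := Prod.ext_iff.1 h1'
      obtain ⟨h3, rfl⟩ := Prod.ext_iff.1 h2'
      obtain rfl : y' = y := relabelAmb_injective τ h3
      exact ⟨_, (h.mem_graph s x z).2 ⟨_, h1, h2⟩, rfl⟩

lemma IsId.relabel {S : Type} (ρ : ℕ ↪ ℕ) {φ : Mor F S} (h : IsId φ) :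
    IsId (φ.relabel ρ ρ) where
  dom_eq := funext fun s => congrArg (Finset.map ρ) (congrFun h.dom_eq s)
  eq_of_mem s := by
    rintro _ ⟨p, hp, rfl⟩
    exact congrArg (relabelAmb ρ) (h.eq_of_mem s p hp)

lemma pullLabel_map {S T : Type} (γ : GammaHom S T) (ρ : ℕ ↪ ℕ) (f : T → Finset ℕ) (s : S) :
    pullLabel γ (fun t => (f t).map ρ) s = (pullLabel γ f s).map ρ := by
  ext i
  simp only [pullLabel, Finset.mem_biUnion, Finset.mem_map]
  constructor
  · rintro ⟨t, ht, j, hj, rfl⟩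
    exact ⟨j, ⟨t, ht, hj⟩, rfl⟩
  · rintro ⟨j, ⟨t, ht, hj⟩, rfl⟩
    exact ⟨t, ht, j, hj, rfl⟩

lemma Mor.relabel_pull {S T : Type} (γ : GammaHom S T) (ρ τ : ℕ ↪ ℕ) (φ : Mor F T) :
    (φ.relabel ρ τ).pull γ = (φ.pull γ).relabel ρ τ :=
  Mor.ext (funext fun s => pullLabel_map γ ρ φ.dom s) (funext fun s => pullLabel_map γ τ φ.cod s)
    (funext fun s => by simp only [Mor.pull, Mor.relabel, Submodule.map_iSup])

/-- The injection of `ℕ` onto the even numbers. -/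
def evenEmb : ℕ ↪ ℕ := ⟨fun n => 2 * n, fun a b h => by
  have : 2 * a = 2 * b := h
  omega⟩

/-- The injection of `ℕ` onto the odd numbers. -/
def oddEmb : ℕ ↪ ℕ := ⟨fun n => 2 * n + 1, fun a b h => by
  have : 2 * a + 1 = 2 * b + 1 := h
  omega⟩

lemma disjoint_even_odd (A B : Finset ℕ) : Disjoint (A.map evenEmb) (B.map oddEmb) := by
  rw [Finset.disjoint_left]
  intro i hi hi'
  obtain ⟨a, -, ha⟩ := Finset.mem_map.1 hi
  obtain ⟨b, -, hb⟩ := Finset.mem_map.1 hi'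
  have h1 : 2 * a = i := ha
  have h2 : 2 * b + 1 = i := hb
  omega

/-- The labels of a juxtaposition: even numbers on the left, odd numbers on the right. -/
def juxtLabel {S T : Type} (f : S → Finset ℕ) (g : T → Finset ℕ) : S ⊕ T → Finset ℕ :=
  Sum.elim (fun s => (f s).map evenEmb) fun t => (g t).map oddEmb

lemma IsLabelling.juxt {S T : Type} {f : S → Finset ℕ} {g : T → Finset ℕ} (hf : IsLabelling f)
    (hg : IsLabelling g) : IsLabelling (juxtLabel f g) := by
  rintro (s | s) (t | t) h
  · exact hf.map evenEmb fun h' => h (congrArg _ h')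
  · exact disjoint_even_odd _ _
  · exact (disjoint_even_odd _ _).symm
  · exact hg.map oddEmb fun h' => h (congrArg _ h')

open Classical in
/-- The part of the juxtaposition of two families of frames that comes from the left. -/
def juxtLeft {S T : Type} (f : S → Finset ℕ) (g : T → Finset ℕ) :
    (Labels (fun s => (f s).map evenEmb) → Amb F) →ₗ[F] (Labels (juxtLabel f g) → Amb F) where
  toFun b i := if h : ∃ s, i.1 ∈ (f s).map evenEmb then b ⟨i.1, h⟩ else 0
  map_add' b c := by
    ext1 i
    simp only [Pi.add_apply]
    split_ifs <;> simp
  map_smul' b c := by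
    ext1 i
    simp only [Pi.smul_apply, RingHom.id_apply]
    split_ifs <;> simp

open Classical in
/-- The part of the juxtaposition of two families of frames that comes from the right. -/
def juxtRight {S T : Type} (f : S → Finset ℕ) (g : T → Finset ℕ) :
    (Labels (fun t => (g t).map oddEmb) → Amb F) →ₗ[F] (Labels (juxtLabel f g) → Amb F) where
  toFun b i := if h : ∃ t, i.1 ∈ (g t).map oddEmb then b ⟨i.1, h⟩ else 0
  map_add' b c := by
    ext1 i
    simp only [Pi.add_apply]
    split_ifs <;> simp
  map_smul' b c := by
    ext1 i
    simp only [Pi.smul_apply, RingHom.id_apply]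
    split_ifs <;> simp

/-- The juxtaposition of two pairs of families of frames. -/
def juxtFrame {S T : Type} (f : S → Finset ℕ) (g : T → Finset ℕ)
    (p : (Labels f → Amb F) × (Labels f → Amb F)) (q : (Labels g → Amb F) × (Labels g → Amb F)) :
    (Labels (juxtLabel f g) → Amb F) × (Labels (juxtLabel f g) → Amb F) :=
  ((juxtLeft f g).prodMap (juxtLeft f g)) (relabelFrame evenEmb evenEmb f p) +
    ((juxtRight f g).prodMap (juxtRight f g)) (relabelFrame oddEmb oddEmb g q)

lemma juxt_inl {S T : Type} (f : S → Finset ℕ) (g : T → Finset ℕ)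
    (b : Labels (fun s => (f s).map evenEmb) → Amb F) (c : Labels (fun t => (g t).map oddEmb) → Amb F)
    (s : S) (i : ((f s).map evenEmb : Finset ℕ)) :
    (juxtLeft f g b + juxtRight f g c) (lab (juxtLabel f g) (Sum.inl s) i) =
      b (lab (fun s => (f s).map evenEmb) s i) := by
  have h1 : ∃ s, i.1 ∈ (f s).map evenEmb := ⟨s, i.2⟩
  have h2 : ¬ ∃ t, i.1 ∈ (g t).map oddEmb := fun ⟨t, ht⟩ =>
    Finset.disjoint_left.1 (disjoint_even_odd (f s) (g t)) i.2 ht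
  simp only [juxtLeft, juxtRight, Pi.add_apply, LinearMap.coe_mk, AddHom.coe_mk]
  rw [dif_pos h1, dif_neg h2, add_zero]

lemma juxt_inr {S T : Type} (f : S → Finset ℕ) (g : T → Finset ℕ)
    (b : Labels (fun s => (f s).map evenEmb) → Amb F) (c : Labels (fun t => (g t).map oddEmb) → Amb F)
    (t : T) (i : ((g t).map oddEmb : Finset ℕ)) :
    (juxtLeft f g b + juxtRight f g c) (lab (juxtLabel f g) (Sum.inr t) i) =
      c (lab (fun t => (g t).map oddEmb) t i) := by
  have h1 : ∃ t, i.1 ∈ (g t).map oddEmb := ⟨t, i.2⟩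
  have h2 : ¬ ∃ s, i.1 ∈ (f s).map evenEmb := fun ⟨s, hs⟩ =>
    Finset.disjoint_left.1 (disjoint_even_odd (f s) (g t)) hs i.2
  simp only [juxtLeft, juxtRight, Pi.add_apply, LinearMap.coe_mk, AddHom.coe_mk]
  rw [dif_pos h1, dif_neg h2, zero_add]

lemma juxtFrame_inl {S T : Type} (f : S → Finset ℕ) (g : T → Finset ℕ)
    (p : (Labels f → Amb F) × (Labels f → Amb F)) (q : (Labels g → Amb F) × (Labels g → Amb F))
    (s : S) (i : ((f s).map evenEmb : Finset ℕ)) :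
    (juxtFrame f g p q).1 (lab (juxtLabel f g) (Sum.inl s) i) =
        (relabelFrame evenEmb evenEmb f p).1 (lab (fun s => (f s).map evenEmb) s i) ∧
      (juxtFrame f g p q).2 (lab (juxtLabel f g) (Sum.inl s) i) =
        (relabelFrame evenEmb evenEmb f p).2 (lab (fun s => (f s).map evenEmb) s i) :=
  ⟨juxt_inl f g _ _ s i, juxt_inl f g _ _ s i⟩

lemma juxtFrame_inr {S T : Type} (f : S → Finset ℕ) (g : T → Finset ℕ)
    (p : (Labels f → Amb F) × (Labels f → Amb F)) (q : (Labels g → Amb F) × (Labels g → Amb F))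
    (t : T) (i : ((g t).map oddEmb : Finset ℕ)) :
    (juxtFrame f g p q).1 (lab (juxtLabel f g) (Sum.inr t) i) =
        (relabelFrame oddEmb oddEmb g q).1 (lab (fun t => (g t).map oddEmb) t i) ∧
      (juxtFrame f g p q).2 (lab (juxtLabel f g) (Sum.inr t) i) =
        (relabelFrame oddEmb oddEmb g q).2 (lab (fun t => (g t).map oddEmb) t i) :=
  ⟨juxt_inr f g _ _ t i, juxt_inr f g _ _ t i⟩

lemma IsFramePair.juxt {S T : Type} {f f' : S → Finset ℕ} {g g' : T → Finset ℕ}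
    {p : (Labels f → Amb F) × (Labels f → Amb F)} {q : (Labels g → Amb F) × (Labels g → Amb F)}
    (hp : IsFramePair f f' p) (hq : IsFramePair g g' q) :
    IsFramePair (juxtLabel f g) (juxtLabel f' g') (juxtFrame f g p q) := by
  have hp' := hp.relabel evenEmb evenEmb
  have hq' := hq.relabel oddEmb oddEmb
  refine ⟨?_, ?_, ?_, ?_, ?_⟩ <;> rintro (s | s)
  · exact hp'.card_eq s
  · exact hq'.card_eq s
  · intro i
    rw [(juxtFrame_inl f g p q s i).1]
    exact hp'.mem_fst s i
  · intro i
    rw [(juxtFrame_inr f g p q s i).1]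
    exact hq'.mem_fst s i
  · intro i
    rw [(juxtFrame_inl f g p q s i).2]
    exact hp'.mem_snd s i
  · intro i
    rw [(juxtFrame_inr f g p q s i).2]
    exact hq'.mem_snd s i
  · have h := hp'.indep_fst s
    rw [← funext fun i => (juxtFrame_inl f g p q s i).1] at h
    exact h
  · have h := hq'.indep_fst s
    rw [← funext fun i => (juxtFrame_inr f g p q s i).1] at h
    exact h
  · have h := hp'.indep_snd s
    rw [← funext fun i => (juxtFrame_inl f g p q s i).2] at h
    exact h
  · have h := hq'.indep_snd s
    rw [← funext fun i => (juxtFrame_inr f g p q s i).2] at h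
    exact h

lemma frameGraph_juxt_inl {S T : Type} (f : S → Finset ℕ) (g : T → Finset ℕ)
    (p : (Labels f → Amb F) × (Labels f → Amb F)) (q : (Labels g → Amb F) × (Labels g → Amb F))
    (s : S) : frameGraph (juxtLabel f g) (juxtFrame f g p q) (Sum.inl s) =
      (frameGraph f p s).map ((relabelAmb evenEmb).prodMap (relabelAmb evenEmb)) := by
  rw [← frameGraph_relabel]
  refine congrArg (fun h => Submodule.span F (Set.range h)) (funext fun i => ?_)
  exact Prod.ext (juxtFrame_inl f g p q s i).1 (juxtFrame_inl f g p q s i).2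

lemma frameGraph_juxt_inr {S T : Type} (f : S → Finset ℕ) (g : T → Finset ℕ)
    (p : (Labels f → Amb F) × (Labels f → Amb F)) (q : (Labels g → Amb F) × (Labels g → Amb F))
    (t : T) : frameGraph (juxtLabel f g) (juxtFrame f g p q) (Sum.inr t) =
      (frameGraph g q t).map ((relabelAmb oddEmb).prodMap (relabelAmb oddEmb)) := by
  rw [← frameGraph_relabel]
  refine congrArg (fun h => Submodule.span F (Set.range h)) (funext fun i => ?_)
  exact Prod.ext (juxtFrame_inr f g p q t i).1 (juxtFrame_inr f g p q t i).2

/-- The juxtaposition of two families of isomorphisms, made disjoint by means of even and odd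
labels. -/
def Mor.juxt {S T : Type} (φ : Mor F S) (ψ : Mor F T) : Mor F (S ⊕ T) where
  dom := juxtLabel φ.dom ψ.dom
  cod := juxtLabel φ.cod ψ.cod
  graph := Sum.elim (φ.relabel evenEmb evenEmb).graph (ψ.relabel oddEmb oddEmb).graph
  dom_label := φ.dom_label.juxt ψ.dom_label
  cod_label := φ.cod_label.juxt ψ.cod_label
  isIso := by
    obtain ⟨p, hp, h⟩ := φ.isIso
    obtain ⟨q, hq, h'⟩ := ψ.isIso
    refine ⟨_, hp.juxt hq, ?_⟩
    rintro (s | t)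
    · rw [frameGraph_juxt_inl, ← h]
      rfl
    · rw [frameGraph_juxt_inr, ← h']
      rfl

lemma IsComp.juxt {S T : Type} {φ ψ χ : Mor F S} {φ' ψ' χ' : Mor F T} (h : IsComp φ ψ χ)
    (h' : IsComp φ' ψ' χ') : IsComp (φ.juxt φ') (ψ.juxt ψ') (χ.juxt χ') where
  cod_eq := congrArg₂ juxtLabel h.cod_eq h'.cod_eq
  range_eq := by
    rintro (s | t)
    · exact (h.relabel evenEmb evenEmb evenEmb).range_eq s
    · exact (h'.relabel oddEmb oddEmb oddEmb).range_eq t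
  dom_comp := congrArg₂ juxtLabel h.dom_comp h'.dom_comp
  cod_comp := congrArg₂ juxtLabel h.cod_comp h'.cod_comp
  mem_graph := by
    rintro (s | t)
    · exact (h.relabel evenEmb evenEmb evenEmb).mem_graph s
    · exact (h'.relabel oddEmb oddEmb oddEmb).mem_graph t

lemma IsId.juxt {S T : Type} {φ : Mor F S} {ψ : Mor F T} (h : IsId φ) (h' : IsId ψ) :
    IsId (φ.juxt ψ) where
  dom_eq := congrArg₂ juxtLabel h.dom_eq h'.dom_eq
  eq_of_mem := by
    rintro (s | t)
    · exact (h.relabel evenEmb).eq_of_mem s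
    · exact (h'.relabel oddEmb).eq_of_mem t

end Relabel

/-! ### The direct limit topology and the continuity of sums of morphisms -/

section LimitTopology

/-- Joint continuity in k-spaces may be checked on the summands of disjoint unions. -/
lemma KContinuous₂.sigma.{t} {ι κ : Type*} {X : ι → Type*} {Y : κ → Type*} {Z : Type*}
    [∀ i, TopologicalSpace (X i)] [∀ j, TopologicalSpace (Y j)] [TopologicalSpace Z]
    {f : (Σ i, X i) → (Σ j, Y j) → Z}
    (h : ∀ i j, KContinuous₂.{t} fun x y => f ⟨i, x⟩ ⟨j, y⟩) : KContinuous₂.{t} f := by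
  intro T _ _ _ α β hα hβ
  rw [continuous_iff_continuousAt]
  intro t₀
  let U : Set T := α ⁻¹' Set.range (Sigma.mk (α t₀).1) ∩ β ⁻¹' Set.range (Sigma.mk (β t₀).1)
  have hU : IsOpen U := (isOpen_range_sigmaMk.preimage hα).inter (isOpen_range_sigmaMk.preimage hβ)
  have ht₀ : t₀ ∈ U := ⟨⟨_, rfl⟩, ⟨_, rfl⟩⟩
  have : LocallyCompactSpace U := hU.locallyCompactSpace
  choose a ha using fun t : U => t.2.1
  choose b hb using fun t : U => t.2.2
  have hca : Continuous a :=
    Topology.IsOpenEmbedding.sigmaMk.isInducing.continuous_iff.2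
      ((hα.comp continuous_subtype_val).congr fun t => (ha t).symm)
  have hcb : Continuous b :=
    Topology.IsOpenEmbedding.sigmaMk.isInducing.continuous_iff.2
      ((hβ.comp continuous_subtype_val).congr fun t => (hb t).symm)
  have h1 := h _ _ U a b hca hcb
  have h2 : ContinuousOn (fun t => f (α t) (β t)) U := by
    rw [continuousOn_iff_continuous_domRestrict]
    exact h1.congr fun t => congrArg₂ f (ha t) (hb t)
  exact h2.continuousAt (hU.mem_nhds ht₀)

variable {F : Type w} [RCLike F]

lemma continuous_limitTopology_of_finite {E : Type*} {V : Type w} [AddCommGroup E] [Module F E]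
    [TopologicalSpace E] [IsTopologicalAddGroup E] [ContinuousSMul F E] [T2Space E]
    [FiniteDimensional F E] [AddCommGroup V] [Module F V] (L : E →ₗ[F] V) :
    @Continuous _ _ _ (limitTopology F V) L := by
  let e := (Module.finBasis F E).equivFun
  have he : Continuous e := e.toLinearMap.continuous_of_finiteDimensional
  have h : @Continuous _ _ _ (limitTopology F V) (L.comp e.symm.toLinearMap) := by
    rw [continuous_iff_coinduced_le]
    exact le_iSup_of_le _ (le_iSup_of_le (L.comp e.symm.toLinearMap) le_rfl)
  have h2 := @Continuous.comp _ _ _ _ _ (limitTopology F V) _ _ h he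
  convert h2 using 1
  funext x
  simp

lemma continuous_of_limitTopology {E : Type*} {V : Type w} [AddCommGroup E] [Module F E]
    [TopologicalSpace E] [IsTopologicalAddGroup E] [ContinuousSMul F E]
    [AddCommGroup V] [Module F V] (L : V →ₗ[F] E) :
    @Continuous _ _ (limitTopology F V) _ L := by
  refine continuous_iSup_dom.2 fun k => continuous_iSup_dom.2 fun M => ?_
  rw [continuous_coinduced_dom]
  exact (L.comp M).continuous_of_finiteDimensional

/-- A space with the limit topology is a quotient of a disjoint union of finite-dimensional spaces,
which are locally compact. -/
lemma isQuotientMap_limitTopology (V : Type w) [AddCommGroup V] [Module F V] :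
    @Topology.IsQuotientMap (Σ i : (Σ k : ℕ, (Fin k → F) →ₗ[F] V), (Fin i.1 → F)) V _
      (limitTopology F V) (fun x => x.1.2 x.2) := by
  let _ := limitTopology F V
  refine ⟨Topology.isCoinducing_iff.2 fun s => ?_, fun v => ?_⟩
  rotate_left
  · exact ⟨⟨⟨1, (LinearMap.toSpanSingleton F V v).comp (LinearMap.proj 0)⟩, fun _ => 1⟩, by simp⟩
  · rw [isOpen_sigma_iff, isOpen_iSup_iff, Sigma.forall]
    simp only [isOpen_iSup_iff, isOpen_coinduced]
    rfl

lemma uCompactlyGeneratedSpace_limitTopology (V : Type w) [AddCommGroup V] [Module F V] :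
    @UCompactlyGeneratedSpace.{w} V (limitTopology F V) := by
  let _ := limitTopology F V
  have : ∀ i : (Σ k : ℕ, (Fin k → F) →ₗ[F] V), UCompactlyGeneratedSpace.{w} (Fin i.1 → F) :=
    fun _ => uCompactlyGeneratedSpace_of_locallyCompactSpace
  exact uCompactlyGeneratedSpace_of_isQuotientMap (isQuotientMap_limitTopology (F := F) V)

/-- Addition is jointly continuous, in k-spaces, for the direct limit topology. -/
lemma kContinuous₂_add.{t} (V : Type w) [AddCommGroup V] [Module F V] :
    @KContinuous₂.{t} V V V (limitTopology F V) (limitTopology F V) (limitTopology F V)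
      fun x y => x + y := by
  let _ := limitTopology F V
  have : ∀ i : (Σ k : ℕ, (Fin k → F) →ₗ[F] V), UCompactlyGeneratedSpace.{w} (Fin i.1 → F) :=
    fun _ => uCompactlyGeneratedSpace_of_locallyCompactSpace
  refine KContinuous₂.of_isQuotientMap (isQuotientMap_limitTopology (F := F) V)
    (isQuotientMap_limitTopology (F := F) V) (KContinuous₂.sigma fun i j => ?_)
  intro T _ _ _ α β hα hβ
  have h := continuous_limitTopology_of_finite (i.2.coprod j.2)
  exact (h.comp (hα.prodMk hβ)).congr fun t => by simp

/-- Linear independence of finitely many vectors is an open condition in the limit topology. -/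
lemma isOpen_linearIndependent {V : Type w} {M ι : Type*} [Fintype ι] [AddCommGroup V] [Module F V]
    [AddCommGroup M] [Module F M] (L : V →ₗ[F] ι → M) :
    @IsOpen V (limitTopology F V) {p | LinearIndependent F (L p)} := by
  classical
  let _ := limitTopology F V
  rw [isOpen_iff_mem_nhds]
  intro p hp
  -- A left inverse of the frame at `p` yields a determinant that detects independence nearby.
  obtain ⟨g, hg⟩ := (Fintype.linearCombination F (L p)).exists_leftInverse_of_injective
    (LinearMap.ker_eq_bot.2 (linearIndependent_iff_injective_fintypeLinearCombination.1 hp))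
  let N : V →ₗ[F] ι → ι → F := (g.compLeft ι).comp L
  have hN : Continuous N := continuous_of_limitTopology N
  have hdet : Continuous fun q => Matrix.det (Matrix.of (N q)) :=
    Continuous.matrix_det hN
  have hp1 : Matrix.det (Matrix.of (N p)) ≠ 0 := by
    have : Matrix.of (N p) = 1 := by
      ext i j
      have h1 := LinearMap.congr_fun hg (Pi.single i 1)
      simp only [LinearMap.comp_apply, Fintype.linearCombination_apply_single, one_smul,
        LinearMap.id_apply] at h1
      change g (L p i) j = _
      rw [h1, Matrix.one_apply, Pi.single_apply]
      simp only [eq_comm]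
    rw [this, Matrix.det_one]
    exact one_ne_zero
  filter_upwards [(isOpen_ne.preimage hdet).mem_nhds hp1] with q hq
  have h2 : LinearIndependent F (N q) :=
    Matrix.linearIndependent_rows_of_det_ne_zero (A := Matrix.of (N q)) hq
  exact LinearIndependent.of_comp g h2

lemma exists_projection {V : Type*} [AddCommGroup V] [Module F V] (M : Submodule F V) :
    ∃ π : V →ₗ[F] M, ∀ p : M, π p = p := by
  obtain ⟨π, hπ⟩ := M.subtype.exists_leftInverse_of_injective M.ker_subtype
  exact ⟨π, fun p => LinearMap.congr_fun hπ p⟩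

/-- The pairs of vectors of a family of frames, without the independence conditions. -/
def frameSubmodule {S : Type} (f g : S → Finset ℕ) :
    Submodule F ((Labels f → Amb F) × (Labels f → Amb F)) where
  carrier := {p | ∀ s (i : f s), p.1 (lab f s i) ∈ labelled F (f s) ∧
    p.2 (lab f s i) ∈ labelled F (g s)}
  add_mem' h h' s i := ⟨add_mem (h s i).1 (h' s i).1, add_mem (h s i).2 (h' s i).2⟩
  zero_mem' _ _ := ⟨zero_mem _, zero_mem _⟩
  smul_mem' c _ h s i := ⟨Submodule.smul_mem _ c (h s i).1, Submodule.smul_mem _ c (h s i).2⟩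

/-- The space of pairs of frames is a retract of an open subset of a vector space that carries
the direct limit topology. -/
lemma uCompactlyGeneratedSpace_framePair {S : Type} [Finite S] (f g : S → Finset ℕ) :
    UCompactlyGeneratedSpace.{w} (FramePair F f g) := by
  let V := (Labels f → Amb F) × (Labels f → Amb F)
  let tV : TopologicalSpace V := limitTopology F V
  have hV : UCompactlyGeneratedSpace.{w} V := uCompactlyGeneratedSpace_limitTopology (F := F) V
  let M : Submodule F V := frameSubmodule f g
  obtain ⟨π, hπ⟩ := exists_projection M
  -- The projection to `M` retracts the open set of those vectors whose projection is a pair of frames.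
  let Q : V →ₗ[F] V := M.subtype.comp π
  have hQ : @Continuous V V tV tV Q := continuous_linearMap Q
  have hQM : ∀ p ∈ M, Q p = p := fun p hp =>
    congrArg M.subtype (hπ ⟨p, hp⟩)
  let U : Set V := {p | IsFramePair f g (Q p)}
  have hU : @IsOpen V tV U := by
    have h1 : ∀ s, @IsOpen V tV {p | LinearIndependent F fun i : f s => (Q p).1 (lab f s i)} :=
      fun s => isOpen_linearIndependent
        ((LinearMap.funLeft F (Amb F) (lab f s)).comp ((LinearMap.fst F _ _).comp Q))
    have h2 : ∀ s, @IsOpen V tV {p | LinearIndependent F fun i : f s => (Q p).2 (lab f s i)} :=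
      fun s => isOpen_linearIndependent
        ((LinearMap.funLeft F (Amb F) (lab f s)).comp ((LinearMap.snd F _ _).comp Q))
    have h3 : U = {p | ∀ s, (f s).card = (g s).card} ∩
        ((⋂ s, {p | LinearIndependent F fun i : f s => (Q p).1 (lab f s i)}) ∩
          ⋂ s, {p | LinearIndependent F fun i : f s => (Q p).2 (lab f s i)}) := by
      ext p
      simp only [Set.mem_inter_iff, Set.mem_iInter]
      exact ⟨fun h => ⟨h.card_eq, h.indep_fst, h.indep_snd⟩,
        fun h => ⟨h.1, fun s i => ((π p).2 s i).1, fun s i => ((π p).2 s i).2, h.2.1, h.2.2⟩⟩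
    rw [h3]
    exact (@isOpen_const V tV _).inter
      ((isOpen_iInter_of_finite h1).inter (isOpen_iInter_of_finite h2))
  have hU' : UCompactlyGeneratedSpace.{w} U := uCompactlyGeneratedSpace_of_isOpen_subtype hU
  let r : U → FramePair F f g := fun p => ⟨Q p.1, p.2⟩
  have hr : Continuous r := continuous_induced_rng.2 (hQ.comp continuous_subtype_val)
  have hM : ∀ p : FramePair F f g, Q p.1 = p.1 := fun p =>
    hQM _ fun s i => ⟨p.2.mem_fst s i, p.2.mem_snd s i⟩
  let i : FramePair F f g → U := fun p => ⟨p.1, by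
    change IsFramePair f g (Q p.1)
    rw [hM]
    exact p.2⟩
  have hi : Continuous i := by
    have h0 : @Continuous (FramePair F f g) V _ tV fun p => p.1 := continuous_induced_dom
    exact Continuous.subtype_mk h0 _
  exact uCompactlyGeneratedSpace_of_isQuotientMap
    (Topology.IsQuotientMap.of_inverse hi hr fun p => Subtype.ext (hM p))

end LimitTopology

section MorSum

variable {F : Type w} [RCLike F]

/-- The space of morphisms is a quotient of the disjoint union of the spaces of pairs of families of
frames. -/
lemma Mor.isQuotientMap (S : Type) : Topology.IsQuotientMap
    (fun x : (Σ i : {f : S → Finset ℕ // IsLabelling f} × {g : S → Finset ℕ // IsLabelling g},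
      FramePair F i.1.1 i.2.1) => Mor.mk' x.1.1.2 x.1.2.2 x.2) := by
  refine ⟨Topology.isCoinducing_iff.2 fun s => ?_, fun φ => ?_⟩
  rotate_left
  · obtain ⟨p, hp, h⟩ := φ.isIso
    exact ⟨⟨⟨⟨φ.dom, φ.dom_label⟩, ⟨φ.cod, φ.cod_label⟩⟩, ⟨p, hp⟩⟩,
      Mor.ext rfl rfl (funext fun s => (h s).symm)⟩
  · rw [isOpen_sigma_iff, isOpen_iSup_iff, Prod.forall]
    simp only [isOpen_iSup_iff, isOpen_coinduced]
    rfl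

/-- Both spaces of morphisms are quotients of compactly generated spaces of frames, and on frames
the juxtaposition is a sum of two linear maps. Since quotients do not commute with products, the
continuity holds in k-spaces only. -/
lemma Mor.kContinuous₂_juxt.{t} {S T : Type} [Finite S] [Finite T] :
    KContinuous₂.{t} (Mor.juxt (F := F) (S := S) (T := T)) := by
  have h1 : ∀ (S : Type) [Finite S]
      (i : {f : S → Finset ℕ // IsLabelling f} × {g : S → Finset ℕ // IsLabelling g}),
      UCompactlyGeneratedSpace.{w} (FramePair F i.1.1 i.2.1) :=
    fun S _ i => uCompactlyGeneratedSpace_framePair _ _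
  have := h1 S
  have := h1 T
  refine KContinuous₂.of_isQuotientMap (Mor.isQuotientMap S) (Mor.isQuotientMap T)
    (KContinuous₂.sigma fun i j => ?_)
  intro X _ _ _ α β hα hβ
  let R : X → FramePair F (juxtLabel i.1.1 j.1.1) (juxtLabel i.2.1 j.2.1) := fun x =>
    ⟨juxtFrame _ _ (α x).1 (β x).1, (α x).2.juxt (β x).2⟩
  have hR : Continuous R := by
    refine continuous_induced_rng.2 ?_
    have h0 : @Continuous (FramePair F i.1.1 i.2.1) _ _ (limitTopology F _) fun p => p.1 :=
      continuous_induced_dom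
    have h0' : @Continuous (FramePair F j.1.1 j.2.1) _ _ (limitTopology F _) fun p => p.1 :=
      continuous_induced_dom
    have h2 := @Continuous.comp _ _ _ _ (limitTopology F _) (limitTopology F _) _ _
      (continuous_linearMap (((juxtLeft i.1.1 j.1.1).prodMap (juxtLeft i.1.1 j.1.1)).comp
        (relabelFrame (F := F) evenEmb evenEmb i.1.1)))
      (@Continuous.comp _ _ _ _ _ (limitTopology F _) _ _ h0 hα)
    have h3 := @Continuous.comp _ _ _ _ (limitTopology F _) (limitTopology F _) _ _
      (continuous_linearMap (((juxtRight i.1.1 j.1.1).prodMap (juxtRight i.1.1 j.1.1)).comp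
        (relabelFrame (F := F) oddEmb oddEmb j.1.1)))
      (@Continuous.comp _ _ _ _ _ (limitTopology F _) _ _ h0' hβ)
    exact kContinuous₂_add (F := F) _ X _ _ h2 h3
  refine ((Mor.continuous_mk' (i.1.2.juxt j.1.2) (i.2.2.juxt j.2.2)).comp hR).congr fun x => ?_
  refine Mor.ext rfl rfl (funext ?_)
  rintro (s | s)
  · exact frameGraph_juxt_inl _ _ _ _ s
  · exact frameGraph_juxt_inr _ _ _ _ s

open Classical in
/-- The morphism of `Γ` that folds `S ⊕ S` onto `S`. -/
def foldGamma (S : Type) : GammaHom S (S ⊕ S) where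
  toFun s := {Sum.inl s, Sum.inr s}
  disjoint s t h := by
    simp only [Finset.disjoint_left, Finset.mem_insert, Finset.mem_singleton]
    rintro _ (rfl | rfl) (h' | h')
    · exact h (Sum.inl_injective h')
    · cases h'
    · cases h'
    · exact h (Sum.inr_injective h')

/-- The direct sum of two families of isomorphisms. -/
def Mor.sum {S : Type} (φ ψ : Mor F S) : Mor F S := (φ.juxt ψ).pull (foldGamma S)

lemma Mor.kContinuous₂_sum.{t} {S : Type} [Finite S] :
    KContinuous₂.{t} (Mor.sum (F := F) (S := S)) := fun X _ _ _ α β hα hβ =>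
  (Mor.continuous_pull (foldGamma S)).comp (Mor.kContinuous₂_juxt X α β hα hβ)

lemma IsComp.sum {S : Type} {φ ψ χ φ' ψ' χ' : Mor F S} (h : IsComp φ ψ χ)
    (h' : IsComp φ' ψ' χ') : IsComp (φ.sum φ') (ψ.sum ψ') (χ.sum χ') := (h.juxt h').pull _

lemma IsId.sum {S : Type} {φ ψ : Mor F S} (h : IsId φ) (h' : IsId ψ) : IsId (φ.sum ψ) :=
  (h.juxt h').pull _

lemma pullLabel_fold {S : Type} (f g : S → Finset ℕ) :
    pullLabel (foldGamma S) (juxtLabel f g) =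
      fun s => (f s).map evenEmb ∪ (g s).map oddEmb := by
  classical
  funext s
  simp only [pullLabel, foldGamma, juxtLabel]
  rw [Finset.biUnion_insert, Finset.singleton_biUnion]
  rfl

lemma Mor.sum_graph {S : Type} (φ ψ : Mor F S) (s : S) :
    (φ.sum ψ).graph s =
      (φ.relabel evenEmb evenEmb).graph s ⊔ (ψ.relabel oddEmb oddEmb).graph s := by
  classical
  simp only [Mor.sum, Mor.pull, foldGamma, Mor.juxt]
  rw [Finset.iSup_insert, Finset.iSup_singleton]
  rfl

lemma Mor.sum_dom {S : Type} (φ ψ : Mor F S) :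
    (φ.sum ψ).dom = fun s => (φ.dom s).map evenEmb ∪ (ψ.dom s).map oddEmb := pullLabel_fold _ _

lemma Mor.sum_cod {S : Type} (φ ψ : Mor F S) :
    (φ.sum ψ).cod = fun s => (φ.cod s).map evenEmb ∪ (ψ.cod s).map oddEmb := pullLabel_fold _ _

lemma pullLabel_union {S T : Type} (γ : GammaHom S T) (f g : T → Finset ℕ) :
    pullLabel γ (fun t => f t ∪ g t) = fun s => pullLabel γ f s ∪ pullLabel γ g s := by
  funext s
  ext i
  simp only [pullLabel, Finset.mem_biUnion, Finset.mem_union]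
  grind

lemma Mor.sum_pull {S T : Type} (γ : GammaHom S T) (φ ψ : Mor F T) :
    (φ.sum ψ).pull γ = (φ.pull γ).sum (ψ.pull γ) := by
  refine Mor.ext ?_ ?_ (funext fun s => ?_)
  · rw [Mor.sum_dom]
    change pullLabel γ (φ.sum ψ).dom = _
    rw [Mor.sum_dom, pullLabel_union]
    simp only [pullLabel_map]
    rfl
  · rw [Mor.sum_cod]
    change pullLabel γ (φ.sum ψ).cod = _
    rw [Mor.sum_cod, pullLabel_union]
    simp only [pullLabel_map]
    rfl
  · rw [Mor.sum_graph, ← Mor.relabel_pull, ← Mor.relabel_pull]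
    change ⨆ t ∈ γ.toFun s, (φ.sum ψ).graph t = _
    simp only [Mor.sum_graph, iSup_sup_eq]
    rfl

lemma Mor.graph_eq_bot {S : Type} {φ : Mor F S} {s : S} (h : φ.dom s = ∅) : φ.graph s = ⊥ := by
  obtain ⟨p, hp, h'⟩ := φ.isIso
  rw [h', frameGraph, Submodule.span_eq_bot]
  rintro _ ⟨i, rfl⟩
  exact (Finset.eq_empty_iff_forall_notMem.1 h _ i.2).elim

lemma Mor.cod_eq_empty {S : Type} {φ : Mor F S} {s : S} (h : φ.dom s = ∅) : φ.cod s = ∅ := by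
  obtain ⟨p, hp, h'⟩ := φ.isIso
  rw [← Finset.card_eq_zero, ← hp.card_eq, h, Finset.card_empty]

/-- The direct sum with zero objects is not the identity: it moves the labels to the even numbers.
-/
lemma Mor.sum_zero {S : Type} (φ ψ : Mor F S) (h : ∀ s, ψ.dom s = ∅) :
    φ.sum ψ = φ.relabel evenEmb evenEmb := by
  refine Mor.ext ?_ ?_ (funext fun s => ?_)
  · rw [Mor.sum_dom]
    simp only [h, Finset.map_empty, Finset.union_empty]
    rfl
  · rw [Mor.sum_cod]
    simp only [Mor.cod_eq_empty (h _), Finset.map_empty, Finset.union_empty]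
    rfl
  · rw [Mor.sum_graph, Mor.graph_eq_bot (φ := ψ.relabel oddEmb oddEmb), sup_bot_eq]
    simp only [Mor.relabel, h, Finset.map_empty]

lemma Mor.zero_sum {S : Type} (φ ψ : Mor F S) (h : ∀ s, φ.dom s = ∅) :
    φ.sum ψ = ψ.relabel oddEmb oddEmb := by
  refine Mor.ext ?_ ?_ (funext fun s => ?_)
  · rw [Mor.sum_dom]
    simp only [h, Finset.map_empty, Finset.empty_union]
    rfl
  · rw [Mor.sum_cod]
    simp only [Mor.cod_eq_empty (h _), Finset.map_empty, Finset.empty_union]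
    rfl
  · rw [Mor.sum_graph, Mor.graph_eq_bot (φ := φ.relabel evenEmb evenEmb), bot_sup_eq]
    simp only [Mor.relabel, h, Finset.map_empty]

end MorSum

/-! ### Products of geometric realizations -/

section Coupling

variable {m k r : ℕ}

/-- The mass of the vertices that come before the `i`-th one. -/
def cumul (t : stdSimplex ℝ (Fin (m + 1))) (i : ℕ) : ℝ :=
  ∑ a : Fin (m + 1), if (a : ℕ) < i then t a else 0

/-- The monotone coupling of two probability measures on finite ordered sets: the measure on the
product whose cumulative distribution function is the minimum of those of the marginals. -/
def coupling (t : stdSimplex ℝ (Fin (m + 1))) (u : stdSimplex ℝ (Fin (k + 1)))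
    (q : Fin (m + 1) × Fin (k + 1)) : ℝ :=
  min (cumul t (q.1 + 1)) (cumul u (q.2 + 1)) - min (cumul t (q.1 + 1)) (cumul u q.2) -
    min (cumul t q.1) (cumul u (q.2 + 1)) + min (cumul t q.1) (cumul u q.2)

lemma simplex_map_apply {X Y : Type} [Fintype X] [Fintype Y] [DecidableEq Y] (f : X → Y)
    (v : stdSimplex ℝ X) (y : Y) : stdSimplex.map f v y = ∑ x, if f x = y then v x else 0 := by
  rw [stdSimplex.map_coe, FunOnFinite.linearMap_apply_apply, Finset.sum_filter]

lemma cumul_zero (t : stdSimplex ℝ (Fin (m + 1))) : cumul t 0 = 0 := by simp [cumul]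

lemma cumul_last (t : stdSimplex ℝ (Fin (m + 1))) : cumul t (m + 1) = 1 := by
  rw [cumul, ← stdSimplex.sum_eq_one t]
  exact Finset.sum_congr rfl fun a _ => if_pos a.2

lemma cumul_succ (t : stdSimplex ℝ (Fin (m + 1))) (i : Fin (m + 1)) :
    cumul t (i + 1) = cumul t i + t i := by
  have h : t i = ∑ a : Fin (m + 1), if a = i then t a else 0 := by simp
  rw [h, cumul, cumul, ← Finset.sum_add_distrib]
  refine Finset.sum_congr rfl fun a _ => ?_
  rcases lt_trichotomy a i with h | h | h
  · rw [if_pos (by omega), if_pos (by omega), if_neg h.ne, add_zero]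
  · rw [if_pos (by omega), if_neg (by omega), if_pos h, zero_add]
  · rw [if_neg (by omega), if_neg (by omega), if_neg h.ne', add_zero]

lemma cumul_mono (t : stdSimplex ℝ (Fin (m + 1))) {i j : ℕ} (h : i ≤ j) :
    cumul t i ≤ cumul t j := by
  refine Finset.sum_le_sum fun a _ => ?_
  by_cases h1 : (a : ℕ) < i
  · rw [if_pos h1, if_pos (h1.trans_le h)]
  · rw [if_neg h1]
    split_ifs
    · exact stdSimplex.zero_le t a
    · exact le_rfl

lemma cumul_nonneg (t : stdSimplex ℝ (Fin (m + 1))) (i : ℕ) : 0 ≤ cumul t i :=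
  (cumul_zero t).symm.le.trans (cumul_mono t (Nat.zero_le i))

lemma cumul_le_one (t : stdSimplex ℝ (Fin (m + 1))) (i : Fin (m + 1)) :
    cumul t i ≤ 1 ∧ cumul t (i + 1) ≤ 1 :=
  ⟨(cumul_mono t (by omega)).trans (cumul_last t).le, (cumul_mono t (by omega)).trans (cumul_last t).le⟩

lemma continuous_cumul (i : ℕ) : Continuous fun t : stdSimplex ℝ (Fin (m + 1)) => cumul t i := by
  refine continuous_finsetSum _ fun a _ => ?_
  split_ifs
  · exact (continuous_apply a).comp continuous_subtype_val
  · exact continuous_const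

lemma continuous_coupling (q : Fin (m + 1) × Fin (k + 1)) :
    Continuous fun p : stdSimplex ℝ (Fin (m + 1)) × stdSimplex ℝ (Fin (k + 1)) =>
      coupling p.1 p.2 q := by
  have h1 := fun i => (continuous_cumul (m := m) i).comp
    (continuous_fst (Y := stdSimplex ℝ (Fin (k + 1))))
  have h2 := fun i => (continuous_cumul (m := k) i).comp
    (continuous_snd (X := stdSimplex ℝ (Fin (m + 1))))
  exact ((((h1 _).min (h2 _)).sub ((h1 _).min (h2 _))).sub ((h1 _).min (h2 _))).add
    ((h1 _).min (h2 _))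

lemma coupling_swap (t : stdSimplex ℝ (Fin (m + 1))) (u : stdSimplex ℝ (Fin (k + 1)))
    (q : Fin (m + 1) × Fin (k + 1)) : coupling u t q.swap = coupling t u q := by
  simp only [coupling, Prod.fst_swap, Prod.snd_swap, min_comm (cumul u _)]
  ring

lemma cumul_map (c : Fin (r + 1) → Fin (m + 1)) (v : stdSimplex ℝ (Fin (r + 1))) (i : ℕ) :
    cumul (stdSimplex.map c v) i = ∑ l, if (c l : ℕ) < i then v l else 0 := by
  simp only [cumul, simplex_map_apply]
  have : ∀ a : Fin (m + 1), (if (a : ℕ) < i then ∑ l, if c l = a then v l else 0 else 0) =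
      ∑ l, if c l = a then (if (c l : ℕ) < i then v l else 0) else 0 := by
    intro a
    split_ifs with h
    · refine Finset.sum_congr rfl fun l _ => ?_
      split_ifs with h1 h3
      · rfl
      · exact absurd (h1 ▸ h) h3
      · rfl
    · refine (Finset.sum_eq_zero fun l _ => ?_).symm
      split_ifs with h1 h2
      · exact absurd (h1 ▸ h2) h
      · rfl
      · rfl
  simp only [this]
  rw [Finset.sum_comm]
  simp

/-- The sets `{l | c₁ l < i}` and `{l | c₂ l < j}` are initial segments, hence nested. -/
lemma min_cumul_map (c₁ : Fin (r + 1) →o Fin (m + 1)) (c₂ : Fin (r + 1) →o Fin (k + 1))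
    (v : stdSimplex ℝ (Fin (r + 1))) (i j : ℕ) :
    min (cumul (stdSimplex.map c₁ v) i) (cumul (stdSimplex.map c₂ v) j) =
      ∑ l, if (c₁ l : ℕ) < i ∧ (c₂ l : ℕ) < j then v l else 0 := by
  rw [cumul_map, cumul_map]
  by_cases h : ∀ l, (c₁ l : ℕ) < i → (c₂ l : ℕ) < j
  · rw [min_eq_left]
    · exact Finset.sum_congr rfl fun l _ => by
        by_cases h3 : (c₁ l : ℕ) < i
        · simp [h3, h l h3]
        · simp [h3]
    · refine Finset.sum_le_sum fun l _ => ?_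
      split_ifs with h1 h2 h2
      · exact le_rfl
      · exact absurd (h l h1) h2
      · exact stdSimplex.zero_le v l
      · exact le_rfl
  · push Not at h
    obtain ⟨l₀, h1, h2⟩ := h
    have h' : ∀ l, (c₂ l : ℕ) < j → (c₁ l : ℕ) < i := by
      intro l hl
      rcases le_total l l₀ with h3 | h3
      · exact lt_of_le_of_lt (c₁.monotone h3 : c₁ l ≤ c₁ l₀) h1
      · have h4 : (c₂ l₀ : ℕ) ≤ c₂ l := c₂.monotone h3
        exact absurd (h4.trans_lt hl) h2.not_gt
    rw [min_eq_right]
    · exact Finset.sum_congr rfl fun l _ => by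
        by_cases h3 : (c₂ l : ℕ) < j
        · simp [h3, h' l h3]
        · simp [h3]
    · refine Finset.sum_le_sum fun l _ => ?_
      split_ifs with h1 h2 h2
      · exact le_rfl
      · exact absurd (h' l h1) h2
      · exact stdSimplex.zero_le v l
      · exact le_rfl

/-- A measure carried by a chain of the product is the monotone coupling of its marginals. -/
lemma coupling_map (c₁ : Fin (r + 1) →o Fin (m + 1)) (c₂ : Fin (r + 1) →o Fin (k + 1))
    (v : stdSimplex ℝ (Fin (r + 1))) (q : Fin (m + 1) × Fin (k + 1)) :
    coupling (stdSimplex.map c₁ v) (stdSimplex.map c₂ v) q =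
      ∑ l, if (c₁ l, c₂ l) = q then v l else 0 := by
  obtain ⟨i, j⟩ := q
  simp only [coupling, min_cumul_map]
  rw [← Finset.sum_sub_distrib, ← Finset.sum_sub_distrib, ← Finset.sum_add_distrib]
  refine Finset.sum_congr rfl fun l _ => ?_
  have h : ((c₁ l, c₂ l) = (i, j)) ↔ (c₁ l : ℕ) = i ∧ (c₂ l : ℕ) = j := by
    rw [Prod.ext_iff, Fin.ext_iff, Fin.ext_iff]
  simp only [h]
  split_ifs <;> first | (exfalso; omega) | ring

/-- The coupling as the length of the intersection of two intervals: `t` and `u` decompose `[0,1]`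
into intervals, and the atom at `(i, j)` is the part that is common to the `i`-th and the `j`-th
one. -/
lemma coupling_eq_max (t : stdSimplex ℝ (Fin (m + 1))) (u : stdSimplex ℝ (Fin (k + 1)))
    (q : Fin (m + 1) × Fin (k + 1)) : coupling t u q =
      max 0 (min (cumul t (q.1 + 1)) (cumul u (q.2 + 1)) - max (cumul t q.1) (cumul u q.2)) := by
  have h1 := cumul_mono t (Nat.le_add_right (q.1 : ℕ) 1)
  have h2 := cumul_mono u (Nat.le_add_right (q.2 : ℕ) 1)
  simp only [coupling]
  grind

lemma coupling_nonneg (t : stdSimplex ℝ (Fin (m + 1))) (u : stdSimplex ℝ (Fin (k + 1)))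
    (q : Fin (m + 1) × Fin (k + 1)) : 0 ≤ coupling t u q := by
  rw [coupling_eq_max]
  exact le_max_left _ _

lemma sum_coupling_snd (t : stdSimplex ℝ (Fin (m + 1))) (u : stdSimplex ℝ (Fin (k + 1)))
    (i : Fin (m + 1)) : ∑ j, coupling t u (i, j) = t i := by
  let g : ℕ → ℝ := fun n => min (cumul t (i + 1)) (cumul u n) - min (cumul t i) (cumul u n)
  have h : ∀ j : Fin (k + 1), coupling t u (i, j) = g (j + 1) - g j := fun j => by
    simp only [coupling, g]
    ring
  rw [Finset.sum_congr rfl fun j _ => h j,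
    Fin.sum_univ_eq_sum_range (fun n => g (n + 1) - g n) (k + 1), Finset.sum_range_sub]
  simp only [g]
  rw [cumul_last, cumul_zero,
    min_eq_left (cumul_le_one t i).1, min_eq_left (cumul_le_one t i).2,
    min_eq_right (cumul_nonneg t _), min_eq_right (cumul_nonneg t _), cumul_succ]
  ring

lemma sum_coupling_fst (t : stdSimplex ℝ (Fin (m + 1))) (u : stdSimplex ℝ (Fin (k + 1)))
    (j : Fin (k + 1)) : ∑ i, coupling t u (i, j) = u j := by
  rw [← sum_coupling_snd u t j]
  exact Finset.sum_congr rfl fun i _ => (coupling_swap t u (i, j)).symm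

/-- The support of the coupling. -/
def couplingSupport (t : stdSimplex ℝ (Fin (m + 1))) (u : stdSimplex ℝ (Fin (k + 1))) :
    Finset (Fin (m + 1) × Fin (k + 1)) := Finset.univ.filter fun q => 0 < coupling t u q

/-- The intervals of the two decompositions are met in increasing order. -/
lemma couplingSupport_isChain (t : stdSimplex ℝ (Fin (m + 1))) (u : stdSimplex ℝ (Fin (k + 1))) :
    IsChain (· ≤ ·) (couplingSupport t u : Set (Fin (m + 1) × Fin (k + 1))) := by
  have key : ∀ q q' : Fin (m + 1) × Fin (k + 1), 0 < coupling t u q → 0 < coupling t u q' →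
      q.1 < q'.1 → q.2 ≤ q'.2 := by
    intro q q' h h' h1
    by_contra h2
    rw [not_le] at h2
    rw [coupling_eq_max] at h h'
    have h3 := cumul_mono t (show (q.1 : ℕ) + 1 ≤ q'.1 from h1)
    have h4 := cumul_mono u (show (q'.2 : ℕ) + 1 ≤ q.2 from h2)
    grind
  intro q hq q' hq' hne
  simp only [couplingSupport, Finset.coe_filter, Finset.mem_univ, true_and, Set.mem_ofPred_eq]
    at hq hq'
  rcases lt_trichotomy q.1 q'.1 with h | h | h
  · exact Or.inl ⟨h.le, key q q' hq hq' h⟩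
  · rcases le_total q.2 q'.2 with h' | h'
    · exact Or.inl ⟨h.le, h'⟩
    · exact Or.inr ⟨h.ge, h'⟩
  · exact Or.inr ⟨h.le, key q' q hq' hq h⟩

lemma couplingSupport_nonempty (t : stdSimplex ℝ (Fin (m + 1)))
    (u : stdSimplex ℝ (Fin (k + 1))) : (couplingSupport t u).Nonempty := by
  by_contra h
  rw [Finset.not_nonempty_iff_eq_empty, couplingSupport, Finset.filter_eq_empty_iff] at h
  have h1 := stdSimplex.sum_eq_one t
  simp only [← sum_coupling_snd t u] at h1
  rw [Finset.sum_eq_zero fun i _ => Finset.sum_eq_zero fun j _ =>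
    le_antisymm (not_lt.1 (h (Finset.mem_univ _))) (coupling_nonneg t u _)] at h1
  exact zero_ne_one h1

/-- The increasing enumeration of a nonempty chain of a product of two finite ordered sets. -/
lemma exists_chain_enum {C : Finset (Fin (m + 1) × Fin (k + 1))} (hC : C.Nonempty)
    (hC' : IsChain (· ≤ ·) (C : Set (Fin (m + 1) × Fin (k + 1)))) :
    ∃ (r : ℕ) (c₁ : Fin (r + 1) →o Fin (m + 1)) (c₂ : Fin (r + 1) →o Fin (k + 1)),
      Function.Injective (fun l => (c₁ l, c₂ l)) ∧ ∀ q, q ∈ C ↔ ∃ l, (c₁ l, c₂ l) = q := by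
  let D : Finset (Fin (m + 1) ×ₗ Fin (k + 1)) := C.map toLex.toEmbedding
  obtain ⟨r, hr⟩ : ∃ r, D.card = r + 1 :=
    Nat.exists_eq_add_one.2 (by rw [Finset.card_map]; exact hC.card_pos)
  let e := D.orderEmbOfFin hr
  have he : ∀ l, ofLex (e l) ∈ C := fun l => by
    obtain ⟨q, hq, h⟩ := Finset.mem_map.1 (D.orderEmbOfFin_mem hr l)
    change ofLex (D.orderEmbOfFin hr l) ∈ C
    rw [← h]
    exact hq
  have hmono : ∀ l l', l ≤ l' → ofLex (e l) ≤ ofLex (e l') := by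
    intro l l' h
    rcases hC'.total (he l) (he l') with h1 | h1
    · exact h1
    · have h2 : e l' ≤ e l := Prod.Lex.toLex_mono h1
      rw [le_antisymm h (e.le_iff_le.1 h2)]
  refine ⟨r, ⟨fun l => (ofLex (e l)).1, fun l l' h => (hmono l l' h).1⟩,
    ⟨fun l => (ofLex (e l)).2, fun l l' h => (hmono l l' h).2⟩, ?_, fun q => ?_⟩
  · intro l l' h
    exact e.injective (congrArg toLex (show ofLex (e l) = ofLex (e l') from h))
  · constructor
    · intro hq
      have h1 : toLex q ∈ Set.range (D.orderEmbOfFin hr) := by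
        rw [Finset.range_orderEmbOfFin]
        exact Finset.mem_coe.2 (Finset.mem_map_of_mem _ hq)
      obtain ⟨l, hl⟩ := h1
      exact ⟨l, congrArg ofLex hl⟩
    · rintro ⟨l, rfl⟩
      exact he l

/-- If the coupling is carried by a chain, then it is a probability measure on the chain, and the
marginals are its images. -/
lemma coupling_chain {c₁ : Fin (r + 1) →o Fin (m + 1)} {c₂ : Fin (r + 1) →o Fin (k + 1)}
    (hc : Function.Injective fun l => (c₁ l, c₂ l)) {t : stdSimplex ℝ (Fin (m + 1))}
    {u : stdSimplex ℝ (Fin (k + 1))}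
    (h : ∀ q, (∀ l, (c₁ l, c₂ l) ≠ q) → coupling t u q = 0) :
    ∃ hv : (fun l => coupling t u (c₁ l, c₂ l)) ∈ stdSimplex ℝ (Fin (r + 1)),
      stdSimplex.map c₁ ⟨_, hv⟩ = t ∧ stdSimplex.map c₂ ⟨_, hv⟩ = u := by
  have key : ∀ f : Fin (m + 1) × Fin (k + 1) → ℝ, (∀ q, coupling t u q = 0 → f q = 0) →
      ∑ l, f (c₁ l, c₂ l) = ∑ q, f q := by
    intro f hf
    rw [← Finset.sum_image (f := f) (s := Finset.univ) (g := fun l => (c₁ l, c₂ l))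
      fun _ _ _ _ h => hc h]
    refine Finset.sum_subset (Finset.subset_univ _) fun q _ hq => hf q (h q fun l hl => hq ?_)
    exact Finset.mem_image.2 ⟨l, Finset.mem_univ _, hl⟩
  have hv : (fun l => coupling t u (c₁ l, c₂ l)) ∈ stdSimplex ℝ (Fin (r + 1)) := by
    refine ⟨fun l => coupling_nonneg t u _, ?_⟩
    rw [key (coupling t u) fun _ h => h, Fintype.sum_prod_type]
    simp only [sum_coupling_snd]
    exact stdSimplex.sum_eq_one t
  refine ⟨hv, ?_, ?_⟩
  · ext i
    rw [simplex_map_apply]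
    refine (key (fun q => if q.1 = i then coupling t u q else 0) fun q h => by simp [h]).trans ?_
    rw [Fintype.sum_prod_type, Finset.sum_eq_single i (fun i' _ hi => by simp [hi]) (by simp)]
    simp [sum_coupling_snd]
  · ext j
    rw [simplex_map_apply]
    refine (key (fun q => if q.2 = j then coupling t u q else 0) fun q h => by simp [h]).trans ?_
    rw [Fintype.sum_prod_type_right, Finset.sum_eq_single j (fun j' _ hj => by simp [hj]) (by simp)]
    simp [sum_coupling_fst]

/-- Any two points of simplices are the images of one point of a simplex of the product of the
ordered sets, and the simplex may be chosen nondegenerate. This is the surjectivity part of the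
statement that the nondegenerate simplices of `Δ^m × Δ^k` triangulate the product of the standard
simplices. -/
lemma exists_coupling (t : stdSimplex ℝ (Fin (m + 1))) (u : stdSimplex ℝ (Fin (k + 1))) :
    ∃ (r : ℕ) (c₁ : Fin (r + 1) →o Fin (m + 1)) (c₂ : Fin (r + 1) →o Fin (k + 1))
      (v : stdSimplex ℝ (Fin (r + 1))), Function.Injective (fun l => (c₁ l, c₂ l)) ∧
      stdSimplex.map c₁ v = t ∧ stdSimplex.map c₂ v = u := by
  obtain ⟨r, c₁, c₂, hc, h⟩ :=
    exists_chain_enum (couplingSupport_nonempty t u) (couplingSupport_isChain t u)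
  obtain ⟨hv, h1, h2⟩ := coupling_chain (t := t) (u := u) hc fun q hq => by
    by_contra h3
    obtain ⟨l, hl⟩ := (h q).1 (Finset.mem_filter.2
      ⟨Finset.mem_univ _, lt_of_le_of_ne (coupling_nonneg t u q) (Ne.symm h3)⟩)
    exact hq l hl
  exact ⟨r, c₁, c₂, _, hc, h1, h2⟩

/-- Every point of a simplex lies in the interior of a face. -/
lemma exists_full_support (v : stdSimplex ℝ (Fin (r + 1))) :
    ∃ (r' : ℕ) (ι : Fin (r' + 1) ↪o Fin (r + 1)) (v' : stdSimplex ℝ (Fin (r' + 1))),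
      stdSimplex.map ι v' = v ∧ ∀ l, 0 < v' l := by
  let S : Finset (Fin (r + 1)) := Finset.univ.filter fun l => 0 < v l
  have hS : ∀ l, l ∉ S → v l = 0 := fun l hl => le_antisymm
    (not_lt.1 fun h => hl (Finset.mem_filter.2 ⟨Finset.mem_univ _, h⟩)) (stdSimplex.zero_le v l)
  have hne : S.Nonempty := by
    by_contra h
    have h1 := stdSimplex.sum_eq_one v
    rw [Finset.sum_eq_zero fun l _ => hS l fun h' => h ⟨l, h'⟩] at h1
    exact zero_ne_one h1
  obtain ⟨r', hr⟩ := Nat.exists_eq_add_one.2 hne.card_pos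
  let ι := S.orderEmbOfFin hr
  have hι : ∀ f : Fin (r + 1) → ℝ, (∀ l, v l = 0 → f l = 0) → ∑ l, f (ι l) = ∑ l, f l := by
    intro f hf
    rw [← Finset.sum_image (f := f) (s := Finset.univ) (g := ι) fun _ _ _ _ h => ι.injective h]
    refine Finset.sum_subset (Finset.subset_univ _) fun l _ hl => hf l (hS l fun h => hl ?_)
    have : l ∈ Set.range ι := by
      rw [Finset.range_orderEmbOfFin]
      exact h
    obtain ⟨l', rfl⟩ := this
    exact Finset.mem_image_of_mem _ (Finset.mem_univ _)
  refine ⟨r', ι, ⟨fun l => v (ι l), fun l => stdSimplex.zero_le v _, ?_⟩, ?_, fun l => ?_⟩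
  · rw [hι v fun _ h => h]
    exact stdSimplex.sum_eq_one v
  · ext l
    rw [simplex_map_apply]
    refine (hι (fun l' => if l' = l then v l' else 0) fun l' h => by simp [h]).trans (by simp)
  · exact (Finset.mem_filter.1 (S.orderEmbOfFin_mem hr l)).2

end Coupling

section Pairing

universe x y z

/-- The geometric realization of `N`, with identifications along the maps that satisfy `P`. -/
abbrev Realization (N : ℕ → Type x) (str : ∀ {n m : ℕ}, (Fin (n + 1) →o Fin (m + 1)) → N m → N n)
    (P : ∀ {n m : ℕ}, (Fin (n + 1) →o Fin (m + 1)) → Prop) : Type x :=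
  Quot (RealRel N str P)

/-- A pairing of simplicial sets, levelwise and compatible with the simplicial structures. The
identifications of the realizations are either along all maps or along injective maps. -/
structure Pairing (N₁ : ℕ → Type x) (s₁ : ∀ {n m : ℕ}, (Fin (n + 1) →o Fin (m + 1)) → N₁ m → N₁ n)
    (N₂ : ℕ → Type y) (s₂ : ∀ {n m : ℕ}, (Fin (n + 1) →o Fin (m + 1)) → N₂ m → N₂ n)
    (N₃ : ℕ → Type z) (s₃ : ∀ {n m : ℕ}, (Fin (n + 1) →o Fin (m + 1)) → N₃ m → N₃ n)
    (P : ∀ {n m : ℕ}, (Fin (n + 1) →o Fin (m + 1)) → Prop) where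
  pair : ∀ {r}, N₁ r → N₂ r → N₃ r
  pair_str : ∀ {n m} (θ : Fin (n + 1) →o Fin (m + 1)) a b,
    s₃ θ (pair a b) = pair (s₁ θ a) (s₂ θ b)
  comp₁ : ∀ {l n m} (η : Fin (l + 1) →o Fin (n + 1)) (θ : Fin (n + 1) →o Fin (m + 1)) a,
    s₁ η (s₁ θ a) = s₁ (θ.comp η) a
  comp₂ : ∀ {l n m} (η : Fin (l + 1) →o Fin (n + 1)) (θ : Fin (n + 1) →o Fin (m + 1)) a,
    s₂ η (s₂ θ a) = s₂ (θ.comp η) a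
  of_injective : ∀ {n m} (θ : Fin (n + 1) →o Fin (m + 1)), Function.Injective θ → P θ
  injective_or : (∀ {n m} (θ : Fin (n + 1) →o Fin (m + 1)), P θ → Function.Injective θ) ∨
    ∀ {n m} (θ : Fin (n + 1) →o Fin (m + 1)), P θ

namespace Pairing

variable {N₁ : ℕ → Type x} {s₁ : ∀ {n m : ℕ}, (Fin (n + 1) →o Fin (m + 1)) → N₁ m → N₁ n}
  {N₂ : ℕ → Type y} {s₂ : ∀ {n m : ℕ}, (Fin (n + 1) →o Fin (m + 1)) → N₂ m → N₂ n}
  {N₃ : ℕ → Type z} {s₃ : ∀ {n m : ℕ}, (Fin (n + 1) →o Fin (m + 1)) → N₃ m → N₃ n}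
  {P : ∀ {n m : ℕ}, (Fin (n + 1) →o Fin (m + 1)) → Prop}
  (B : Pairing N₁ s₁ N₂ s₂ N₃ s₃ P)

/-- The point of the realization of `N₃` that a chain of a product of simplices defines. -/
def point {m k r : ℕ} (a : N₁ m) (b : N₂ k) (c₁ : Fin (r + 1) →o Fin (m + 1))
    (c₂ : Fin (r + 1) →o Fin (k + 1)) (v : stdSimplex ℝ (Fin (r + 1))) : Realization N₃ s₃ P :=
  Quot.mk _ ⟨r, B.pair (s₁ c₁ a) (s₂ c₂ b), v⟩

lemma point_map {m k r r' : ℕ} (a : N₁ m) (b : N₂ k) (c₁ : Fin (r + 1) →o Fin (m + 1))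
    (c₂ : Fin (r + 1) →o Fin (k + 1)) (θ : Fin (r' + 1) →o Fin (r + 1)) (hθ : P θ)
    (v : stdSimplex ℝ (Fin (r' + 1))) :
    B.point a b c₁ c₂ (stdSimplex.map θ v) = B.point a b (c₁.comp θ) (c₂.comp θ) v := by
  rw [point, point, ← B.comp₁, ← B.comp₂, ← B.pair_str]
  exact (Quot.sound (RealRel.glue θ hθ _ v)).symm

variable (P) in
/-- The chains that may be used to compute products: for the realizations with identifications
along injective maps only, the chains without repetition. -/
def Admissible {m k r : ℕ} (c₁ : Fin (r + 1) →o Fin (m + 1))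
    (c₂ : Fin (r + 1) →o Fin (k + 1)) : Prop :=
  Function.Injective (fun l => (c₁ l, c₂ l)) ∨
    ∀ {n m} (θ : Fin (n + 1) →o Fin (m + 1)), P θ

include B in
lemma Admissible.P_of_comp {m k r r' : ℕ} {c₁ : Fin (r + 1) →o Fin (m + 1)}
    {c₂ : Fin (r + 1) →o Fin (k + 1)} (hc : Admissible P c₁ c₂)
    (s : Fin (r + 1) →o Fin (r' + 1)) (e : Fin (r' + 1) → Fin (m + 1) × Fin (k + 1))
    (h : ∀ l, e (s l) = (c₁ l, c₂ l)) : P s := by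
  rcases hc with hc | hc
  · refine B.of_injective s fun l l' hl => hc ?_
    simp only
    rw [← h, ← h, hl]
  · exact hc s

/-- Two chains that carry measures with the same marginals define the same point, if the first
measure has full support and the second chain has no repetition. -/
lemma point_eq_of_full_support {m k r r' : ℕ} (a : N₁ m) (b : N₂ k)
    {c₁ : Fin (r + 1) →o Fin (m + 1)} {c₂ : Fin (r + 1) →o Fin (k + 1)}
    {e₁ : Fin (r' + 1) →o Fin (m + 1)} {e₂ : Fin (r' + 1) →o Fin (k + 1)}
    {v : stdSimplex ℝ (Fin (r + 1))} {v' : stdSimplex ℝ (Fin (r' + 1))}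
    (hc : Admissible P c₁ c₂) (he : Function.Injective fun l => (e₁ l, e₂ l))
    (hv : ∀ l, 0 < v l)
    (h₁ : stdSimplex.map c₁ v = stdSimplex.map e₁ v')
    (h₂ : stdSimplex.map c₂ v = stdSimplex.map e₂ v') :
    B.point a b c₁ c₂ v = B.point a b e₁ e₂ v' := by
  have hw : ∀ q, ∑ l, (if (c₁ l, c₂ l) = q then v l else 0) =
      ∑ l, if (e₁ l, e₂ l) = q then v' l else 0 := fun q => by
    rw [← coupling_map, ← coupling_map, h₁, h₂]
  -- Both measures have the same image in `[m] × [k]`, namely the coupling of their common marginals.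
  -- As the first one has full support, the elements of the first chain belong to the second one.
  have hs : ∀ l, ∃ l', (e₁ l', e₂ l') = (c₁ l, c₂ l) := by
    intro l
    by_contra hl
    push Not at hl
    have h3 := hw (c₁ l, c₂ l)
    rw [Finset.sum_eq_zero (s := Finset.univ)
      (f := fun l' => if (e₁ l', e₂ l') = (c₁ l, c₂ l) then v' l' else 0)
      fun l' _ => if_neg (hl l')] at h3
    have h4 := Finset.single_le_sum
      (f := fun l' => if (c₁ l', c₂ l') = (c₁ l, c₂ l) then v l' else 0)
      (fun l' _ => by
        split_ifs
        · exact (hv l').le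
        · exact le_rfl) (Finset.mem_univ l)
    rw [h3, if_pos rfl] at h4
    exact absurd h4 (hv l).not_ge
  choose s hs using hs
  have hmono : Monotone s := by
    intro l l' hl
    by_contra h3
    rw [not_le] at h3
    refine h3.ne (he ?_)
    have h4 := hs l
    have h5 := hs l'
    rw [Prod.ext_iff] at h4 h5
    refine Prod.ext (le_antisymm (e₁.monotone h3.le) ?_) (le_antisymm (e₂.monotone h3.le) ?_)
    · exact (h4.1.le.trans (c₁.monotone hl)).trans h5.1.ge
    · exact (h4.2.le.trans (c₂.monotone hl)).trans h5.2.ge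
  let S : Fin (r + 1) →o Fin (r' + 1) := ⟨s, hmono⟩
  -- The first measure is the second one, up to the repetitions of the first chain.
  have hS : v' = stdSimplex.map S v := by
    ext l
    have h3 := hw (e₁ l, e₂ l)
    rw [simplex_map_apply]
    refine Eq.trans ?_ (h3.symm.trans (Finset.sum_congr rfl fun l' _ => ?_))
    · rw [Finset.sum_eq_single l (fun l' _ hl' => if_neg fun h => hl' (he h)) (by simp), if_pos rfl]
    · rw [← hs l']
      exact if_congr (he.eq_iff (a := s l') (b := l)) rfl rfl
  rw [hS, B.point_map a b e₁ e₂ S (hc.P_of_comp B S (fun l => (e₁ l, e₂ l)) hs)]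
  have h5 : e₁.comp S = c₁ := OrderHom.ext _ _ (funext fun l => (Prod.ext_iff.1 (hs l)).1)
  have h6 : e₂.comp S = c₂ := OrderHom.ext _ _ (funext fun l => (Prod.ext_iff.1 (hs l)).2)
  rw [h5, h6]

/-- The point defined by a chain depends only on the marginals of the measure. -/
lemma point_eq {m k r r' : ℕ} (a : N₁ m) (b : N₂ k)
    {c₁ : Fin (r + 1) →o Fin (m + 1)} {c₂ : Fin (r + 1) →o Fin (k + 1)}
    {e₁ : Fin (r' + 1) →o Fin (m + 1)} {e₂ : Fin (r' + 1) →o Fin (k + 1)}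
    {v : stdSimplex ℝ (Fin (r + 1))} {v' : stdSimplex ℝ (Fin (r' + 1))}
    (hc : Admissible P c₁ c₂) (he : Function.Injective fun l => (e₁ l, e₂ l))
    (h₁ : stdSimplex.map c₁ v = stdSimplex.map e₁ v')
    (h₂ : stdSimplex.map c₂ v = stdSimplex.map e₂ v') :
    B.point a b c₁ c₂ v = B.point a b e₁ e₂ v' := by
  obtain ⟨n, ι, y, rfl, hy⟩ := exists_full_support v
  rw [stdSimplex.map_comp_apply] at h₁ h₂
  have h3 := B.point_map a b c₁ c₂ ι.toOrderHom (B.of_injective _ ι.injective) y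
  refine h3.trans (B.point_eq_of_full_support a b ?_ he hy h₁ h₂)
  exact hc.imp_left fun hc => hc.comp ι.injective

/-- The product of two points given by representatives. -/
def prodAux (p : Σ m, N₁ m × stdSimplex ℝ (Fin (m + 1)))
    (q : Σ k, N₂ k × stdSimplex ℝ (Fin (k + 1))) : Realization N₃ s₃ P :=
  let h := exists_coupling p.2.2 q.2.2
  B.point p.2.1 q.2.1 h.choose_spec.choose h.choose_spec.choose_spec.choose
    h.choose_spec.choose_spec.choose_spec.choose

lemma prodAux_eq {m k r : ℕ} (a : N₁ m) (b : N₂ k)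
    {c₁ : Fin (r + 1) →o Fin (m + 1)} {c₂ : Fin (r + 1) →o Fin (k + 1)}
    (hc : Admissible P c₁ c₂) (v : stdSimplex ℝ (Fin (r + 1))) :
    B.prodAux ⟨m, a, stdSimplex.map c₁ v⟩ ⟨k, b, stdSimplex.map c₂ v⟩ =
      B.point a b c₁ c₂ v := by
  have h := (exists_coupling (stdSimplex.map c₁ v)
    (stdSimplex.map c₂ v)).choose_spec.choose_spec.choose_spec.choose_spec
  exact (B.point_eq a b hc h.1 h.2.1.symm h.2.2.symm).symm

lemma Admissible.comp_left {m m' k r : ℕ} {c₁ : Fin (r + 1) →o Fin (m + 1)}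
    {c₂ : Fin (r + 1) →o Fin (k + 1)} (hc : Function.Injective fun l => (c₁ l, c₂ l))
    (θ : Fin (m + 1) →o Fin (m' + 1)) (hθ : Function.Injective θ ∨
      ∀ {n m} (θ : Fin (n + 1) →o Fin (m + 1)), P θ) :
    Admissible P (θ.comp c₁) c₂ :=
  hθ.imp_left fun hθ _ _ h => hc (Prod.ext (hθ (Prod.ext_iff.1 h).1) (Prod.ext_iff.1 h).2)

lemma Admissible.comp_right {m k k' r : ℕ} {c₁ : Fin (r + 1) →o Fin (m + 1)}
    {c₂ : Fin (r + 1) →o Fin (k + 1)} (hc : Function.Injective fun l => (c₁ l, c₂ l))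
    (θ : Fin (k + 1) →o Fin (k' + 1)) (hθ : Function.Injective θ ∨
      ∀ {n m} (θ : Fin (n + 1) →o Fin (m + 1)), P θ) :
    Admissible P c₁ (θ.comp c₂) :=
  hθ.imp_left fun hθ _ _ h => hc (Prod.ext (Prod.ext_iff.1 h).1 (hθ (Prod.ext_iff.1 h).2))

lemma prodAux_glue_right (p : Σ m, N₁ m × stdSimplex ℝ (Fin (m + 1)))
    (q q' : Σ k, N₂ k × stdSimplex ℝ (Fin (k + 1))) (h : RealRel N₂ s₂ P q q') :
    B.prodAux p q = B.prodAux p q' := by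
  obtain ⟨m, a, t⟩ := p
  obtain ⟨θ, hθ, b, u⟩ := h
  obtain ⟨r, c₁, c₂, v, hc, rfl, rfl⟩ := exists_coupling t u
  have h1 := B.prodAux_eq a (s₂ θ b) (Or.inl hc) v
  have h2 := B.prodAux_eq a b (Admissible.comp_right (P := P) hc θ
    (B.injective_or.imp (fun h => h θ hθ) id)) v
  rw [point, B.comp₂] at h1
  rw [stdSimplex.map_comp_apply]
  exact h1.trans h2.symm

lemma prodAux_glue_left (p p' : Σ m, N₁ m × stdSimplex ℝ (Fin (m + 1)))
    (q : Σ k, N₂ k × stdSimplex ℝ (Fin (k + 1))) (h : RealRel N₁ s₁ P p p') :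
    B.prodAux p q = B.prodAux p' q := by
  obtain ⟨k, b, t⟩ := q
  obtain ⟨θ, hθ, a, u⟩ := h
  obtain ⟨r, c₁, c₂, v, hc, rfl, rfl⟩ := exists_coupling u t
  have h1 := B.prodAux_eq (s₁ θ a) b (Or.inl hc) v
  have h2 := B.prodAux_eq a b (Admissible.comp_left (P := P) hc θ
    (B.injective_or.imp (fun h => h θ hθ) id)) v
  rw [point, B.comp₁] at h1
  rw [stdSimplex.map_comp_apply]
  exact h1.trans h2.symm

/-- The map of realizations that is induced by a pairing. -/
def prod : Realization N₁ s₁ P → Realization N₂ s₂ P → Realization N₃ s₃ P :=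
  Quot.lift₂ B.prodAux B.prodAux_glue_right B.prodAux_glue_left

lemma prod_mk {m k r : ℕ} (a : N₁ m) (b : N₂ k)
    {c₁ : Fin (r + 1) →o Fin (m + 1)} {c₂ : Fin (r + 1) →o Fin (k + 1)}
    (hc : Function.Injective fun l => (c₁ l, c₂ l)) (v : stdSimplex ℝ (Fin (r + 1))) :
    B.prod (Quot.mk _ ⟨m, a, stdSimplex.map c₁ v⟩) (Quot.mk _ ⟨k, b, stdSimplex.map c₂ v⟩) =
      Quot.mk _ ⟨r, B.pair (s₁ c₁ a) (s₂ c₂ b), v⟩ :=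
  B.prodAux_eq a b (Or.inl hc) v

lemma prod_vertex_right {m : ℕ} (a : N₁ m) (b : N₂ 0) (v : stdSimplex ℝ (Fin (m + 1)))
    (u : stdSimplex ℝ (Fin 1)) :
    B.prod (Quot.mk _ ⟨m, a, v⟩) (Quot.mk _ ⟨0, b, u⟩) =
      Quot.mk _ ⟨m, B.pair (s₁ OrderHom.id a) (s₂ (OrderHom.const _ 0) b), v⟩ := by
  have h := B.prod_mk a b (c₁ := OrderHom.id) (c₂ := OrderHom.const _ 0)
    (fun l l' h => (Prod.ext_iff.1 h).1) v
  have h1 : stdSimplex.map (OrderHom.id : Fin (m + 1) →o Fin (m + 1)) v = v :=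
    stdSimplex.map_id_apply v
  rwa [h1, Subsingleton.elim (stdSimplex.map _ v) u] at h

lemma prod_vertex_left {m : ℕ} (a : N₁ 0) (b : N₂ m) (v : stdSimplex ℝ (Fin (m + 1)))
    (u : stdSimplex ℝ (Fin 1)) :
    B.prod (Quot.mk _ ⟨0, a, u⟩) (Quot.mk _ ⟨m, b, v⟩) =
      Quot.mk _ ⟨m, B.pair (s₁ (OrderHom.const _ 0) a) (s₂ OrderHom.id b), v⟩ := by
  have h := B.prod_mk a b (c₁ := OrderHom.const _ 0) (c₂ := OrderHom.id)
    (fun l l' h => (Prod.ext_iff.1 h).2) v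
  have h1 : stdSimplex.map (OrderHom.id : Fin (m + 1) →o Fin (m + 1)) v = v :=
    stdSimplex.map_id_apply v
  rwa [h1, Subsingleton.elim (stdSimplex.map _ v) u] at h

variable [∀ m, TopologicalSpace (N₁ m)] [∀ m, TopologicalSpace (N₂ m)]
  [∀ m, TopologicalSpace (N₃ m)]

/-- The product is jointly continuous in k-spaces. On `Δ^m × Δ^k` it is continuous because the
chains of `[m] × [k]` yield a finite closed covering by the sets where the coupling is carried by
a given chain. -/
theorem kContinuous₂_prod.{a, b, t} [∀ m, UCompactlyGeneratedSpace.{a} (N₁ m)]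
    [∀ m, UCompactlyGeneratedSpace.{b} (N₂ m)]
    (h₁ : ∀ {n m} (θ : Fin (n + 1) →o Fin (m + 1)), Continuous (s₁ θ))
    (h₂ : ∀ {n m} (θ : Fin (n + 1) →o Fin (m + 1)), Continuous (s₂ θ))
    (hp : ∀ r, KContinuous₂.{max a b} (B.pair (r := r))) : KContinuous₂.{t} B.prod := by
  have i1 : ∀ m, UCompactlyGeneratedSpace.{a} (N₁ m × stdSimplex ℝ (Fin (m + 1))) := fun m => by
    have : LocallyCompactSpace (stdSimplex ℝ (Fin (m + 1))) := locallyCompactSpace_of_compactSpace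
    exact uCompactlyGeneratedSpace_prod.{_, 0, a}
  have i2 : ∀ m, UCompactlyGeneratedSpace.{b} (N₂ m × stdSimplex ℝ (Fin (m + 1))) := fun m => by
    have : LocallyCompactSpace (stdSimplex ℝ (Fin (m + 1))) := locallyCompactSpace_of_compactSpace
    exact uCompactlyGeneratedSpace_prod.{_, 0, b}
  refine KContinuous₂.of_isQuotientMap.{a, b, t} (f := B.prod) isQuotientMap_quot_mk
    isQuotientMap_quot_mk (KContinuous₂.sigma fun m k => ?_)
  intro T _ _ _ α β hα hβ
  let w : T → Fin (m + 1) × Fin (k + 1) → ℝ := fun x q => coupling (α x).2 (β x).2 q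
  have hw : ∀ q, Continuous fun x => w x q := fun q =>
    (continuous_coupling q).comp (hα.snd.prodMk hβ.snd)
  -- The couplings that are carried by the chain `C`.
  let R : {C : Finset (Fin (m + 1) × Fin (k + 1)) //
      C.Nonempty ∧ IsChain (· ≤ ·) (C : Set (Fin (m + 1) × Fin (k + 1)))} → Set T :=
    fun C => {x | ∀ q, q ∉ C.1 → w x q = 0}
  refine (locallyFinite_of_finite R).continuous ?_ (fun C => ?_) fun C => ?_
  · refine Set.eq_univ_of_forall fun x => Set.mem_iUnion.2
      ⟨⟨couplingSupport (α x).2 (β x).2, couplingSupport_nonempty _ _,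
        couplingSupport_isChain _ _⟩, fun q hq => ?_⟩
    by_contra h
    exact hq (Finset.mem_filter.2
      ⟨Finset.mem_univ _, lt_of_le_of_ne (coupling_nonneg _ _ q) (Ne.symm h)⟩)
  · simp only [R, Set.ofPred_forall]
    exact isClosed_iInter fun q => isClosed_iInter fun _ => isClosed_eq (hw q) continuous_const
  · obtain ⟨r, c₁, c₂, hc, hC⟩ := exists_chain_enum C.2.1 C.2.2
    rw [continuousOn_iff_continuous_domRestrict]
    have key : ∀ x : R C, ∃ hv : (fun l => w x (c₁ l, c₂ l)) ∈ stdSimplex ℝ (Fin (r + 1)),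
        stdSimplex.map c₁ ⟨_, hv⟩ = (α x).2 ∧ stdSimplex.map c₂ ⟨_, hv⟩ = (β x).2 := fun x =>
      coupling_chain hc fun q hq => x.2 q fun h => by
        obtain ⟨l, hl⟩ := (hC q).1 h
        exact hq l hl
    choose hv hv₁ hv₂ using key
    have h3 : Continuous fun x : R C => (Quot.mk _ ⟨r, B.pair (s₁ c₁ (α x).1) (s₂ c₂ (β x).1),
        ⟨_, hv x⟩⟩ : Realization N₃ s₃ P) := by
      refine continuous_quot_mk.comp (continuous_sigmaMk.comp (Continuous.prodMk ?_ ?_))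
      · exact (hp r T _ _ ((h₁ c₁).comp hα.fst)
          ((h₂ c₂).comp hβ.fst)).comp continuous_subtype_val
      · exact Continuous.subtype_mk
          (continuous_pi fun l => (hw _).comp continuous_subtype_val) _
    refine h3.congr fun x => ?_
    have h4 := B.prod_mk (α x).1 (β x).1 hc ⟨_, hv x⟩
    rw [hv₁, hv₂] at h4
    exact h4.symm

end Pairing
end Pairing

/-! ### Direct sums and deformations of the equivariant Gamma-space -/

section FuncSimplexSum

variable {F : Type w} [RCLike F] {G : Type u} [TopologicalSpace G] {m : ℕ} {S : Type}

instance : UCompactlyGeneratedSpace.{max u w} (FuncSimplex F G m S) :=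
  uCompactlyGeneratedSpace_compactlyGenerated (FuncSimplex.mapTopology m S)

lemma FuncSimplex.continuous_iff {T : Type*} [TopologicalSpace T]
    [UCompactlyGeneratedSpace.{max u w} T] {f : T → FuncSimplex F G m S} :
    Continuous f ↔ (∀ i, Continuous fun t => (f t).fn i) ∧ ∀ p, Continuous fun t => (f t).nt p := by
  constructor
  · intro hf
    have h0 := continuous_compactlyGenerated_id.{max u w}
      (tY := FuncSimplex.mapTopology (F := F) (G := G) m S)
    have h1 := @Continuous.comp T (FuncSimplex F G m S) (FuncSimplex F G m S) _
      (instTopologicalSpaceFuncSimplex m S) (FuncSimplex.mapTopology m S) f id h0 hf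
    have h2 := continuous_induced_rng.1 h1
    exact ⟨fun i => (continuous_apply i).comp h2.fst, fun p => (continuous_apply p).comp h2.snd⟩
  · rintro ⟨h1, h2⟩
    refine continuous_to_compactlyGenerated.{_, max u w, max u w}
      (tY := FuncSimplex.mapTopology m S) ?_
    exact continuous_induced_rng.2 ((continuous_pi h1).prodMk (continuous_pi h2))

lemma FuncSimplex.continuous_fn (i : Fin (m + 1)) :
    Continuous fun x : FuncSimplex F G m S => x.fn i :=
  (FuncSimplex.continuous_iff.1 continuous_id).1 i

lemma FuncSimplex.continuous_nt (p : {p : Fin (m + 1) × Fin (m + 1) // p.1 ≤ p.2}) :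
    Continuous fun x : FuncSimplex F G m S => x.nt p :=
  (FuncSimplex.continuous_iff.1 continuous_id).2 p

lemma FuncSimplex.continuous_reindex {n : ℕ} (θ : Fin (n + 1) →o Fin (m + 1)) :
    Continuous fun x : FuncSimplex F G m S => x.reindex θ :=
  FuncSimplex.continuous_iff.2 ⟨fun i => FuncSimplex.continuous_fn (θ i),
    fun _ => FuncSimplex.continuous_nt _⟩

lemma FuncSimplex.continuous_pull {T : Type} (γ : GammaHom S T) :
    Continuous fun x : FuncSimplex F G m T => x.pull γ :=
  FuncSimplex.continuous_iff.2
    ⟨fun i => (ContinuousMap.continuous_postcomp _).comp (FuncSimplex.continuous_fn i),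
      fun p => (ContinuousMap.continuous_postcomp _).comp (FuncSimplex.continuous_nt p)⟩

/-- The simplex obtained by changing the labels along `κ i` at the `i`-th vertex. -/
def FuncSimplex.relabel (κ : Fin (m + 1) → (ℕ ↪ ℕ)) (x : FuncSimplex F G m S) :
    FuncSimplex F G m S where
  fn i := (ContinuousMap.mk _ (Mor.continuous_relabel (κ i) (κ i))).comp (x.fn i)
  nt p := (ContinuousMap.mk _ (Mor.continuous_relabel (κ p.1.1) (κ p.1.2))).comp (x.nt p)
  fn_id i g := (x.fn_id i g).relabel _
  fn_comp i g h k := (x.fn_comp i g h k).relabel _ _ _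
  nt_natural i j hij g h := by
    obtain ⟨d, h1, h2⟩ := x.nt_natural i j hij g h
    exact ⟨_, h1.relabel (κ i) (κ i) (κ j), h2.relabel (κ i) (κ j) (κ j)⟩
  nt_id i g := congrArg (Mor.relabel (κ i) (κ i)) (x.nt_id i g)
  nt_comp i j k hij hjk g := (x.nt_comp i j k hij hjk g).relabel _ _ _

lemma FuncSimplex.continuous_relabel (κ : Fin (m + 1) → (ℕ ↪ ℕ)) :
    Continuous fun x : FuncSimplex F G m S => x.relabel κ :=
  FuncSimplex.continuous_iff.2
    ⟨fun i => (ContinuousMap.continuous_postcomp _).comp (FuncSimplex.continuous_fn i),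
      fun p => (ContinuousMap.continuous_postcomp _).comp (FuncSimplex.continuous_nt p)⟩

lemma FuncSimplex.relabel_pull {T : Type} (γ : GammaHom S T) (κ : Fin (m + 1) → (ℕ ↪ ℕ))
    (x : FuncSimplex F G m T) : (x.relabel κ).pull γ = (x.pull γ).relabel κ :=
  FuncSimplex.ext (funext fun _ => ContinuousMap.ext fun _ => Mor.relabel_pull _ _ _ _)
    (funext fun _ => ContinuousMap.ext fun _ => Mor.relabel_pull _ _ _ _)

lemma FuncSimplex.relabel_refl (x : FuncSimplex F G m S) :
    x.relabel (fun _ => Function.Embedding.refl ℕ) = x :=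
  FuncSimplex.ext (funext fun _ => ContinuousMap.ext fun _ => Mor.relabel_refl _)
    (funext fun _ => ContinuousMap.ext fun _ => Mor.relabel_refl _)

lemma Mor.pull_pull {S' T : Type} {γ : GammaHom S T} {γ' : GammaHom S' S} {γ'' : GammaHom S' T}
    (h : ∀ s t, t ∈ γ''.toFun s ↔ ∃ r ∈ γ'.toFun s, t ∈ γ.toFun r) (φ : Mor F T) :
    (φ.pull γ).pull γ' = φ.pull γ'' := by
  have key : ∀ f : T → Finset ℕ, pullLabel γ' (pullLabel γ f) = pullLabel γ'' f := by
    intro f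
    funext s
    ext i
    simp only [pullLabel, Finset.mem_biUnion, h]
    grind
  refine Mor.ext (key _) (key _) (funext fun s => ?_)
  change ⨆ r ∈ γ'.toFun s, ⨆ t ∈ γ.toFun r, φ.graph t = ⨆ t ∈ γ''.toFun s, φ.graph t
  refine le_antisymm (iSup₂_le fun r hr => iSup₂_le fun t ht =>
    le_iSup₂_of_le t ((h s t).2 ⟨r, hr, ht⟩) le_rfl) (iSup₂_le fun t ht => ?_)
  obtain ⟨r, hr, ht⟩ := (h s t).1 ht
  exact le_iSup₂_of_le r hr (le_iSup₂_of_le t ht le_rfl)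

lemma Mor.pull_id {γ : GammaHom S S} (h : ∀ s t, t ∈ γ.toFun s ↔ t = s) (φ : Mor F S) :
    φ.pull γ = φ := by
  have h' : ∀ s, γ.toFun s = {s} := fun s => Finset.ext fun t => by rw [h, Finset.mem_singleton]
  have key : ∀ f : S → Finset ℕ, pullLabel γ f = f := by
    intro f
    funext s
    rw [pullLabel, h', Finset.singleton_biUnion]
  refine Mor.ext (key _) (key _) (funext fun s => ?_)
  change ⨆ t ∈ γ.toFun s, φ.graph t = _
  rw [h', Finset.iSup_singleton]

lemma FuncSimplex.pull_pull {S' T : Type} {γ : GammaHom S T} {γ' : GammaHom S' S}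
    {γ'' : GammaHom S' T} (h : ∀ s t, t ∈ γ''.toFun s ↔ ∃ r ∈ γ'.toFun s, t ∈ γ.toFun r)
    (x : FuncSimplex F G m T) : (x.pull γ).pull γ' = x.pull γ'' :=
  FuncSimplex.ext (funext fun _ => ContinuousMap.ext fun _ => Mor.pull_pull h _)
    (funext fun _ => ContinuousMap.ext fun _ => Mor.pull_pull h _)

lemma FuncSimplex.pull_id {γ : GammaHom S S} (h : ∀ s t, t ∈ γ.toFun s ↔ t = s)
    (x : FuncSimplex F G m S) : x.pull γ = x :=
  FuncSimplex.ext (funext fun _ => ContinuousMap.ext fun _ => Mor.pull_id h _)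
    (funext fun _ => ContinuousMap.ext fun _ => Mor.pull_id h _)

instance : Subsingleton (FuncSimplex F G m (Fin 0)) :=
  ⟨fun _ _ => FuncSimplex.ext (funext fun _ => ContinuousMap.ext fun _ => Subsingleton.elim _ _)
    (funext fun _ => ContinuousMap.ext fun _ => Subsingleton.elim _ _)⟩

lemma pullLabel_fin_zero (γ : GammaHom S (Fin 0)) (f : Fin 0 → Finset ℕ) (s : S) :
    pullLabel γ f s = ∅ := by
  ext i
  simp only [pullLabel, Finset.mem_biUnion, Finset.notMem_empty, iff_false]
  rintro ⟨t, -⟩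
  exact t.elim0

variable [LocallyCompactSpace G] [T2Space G] [Finite S]

lemma continuous_mor_sum {T : Type*} [TopologicalSpace T] [LocallyCompactSpace T] [T2Space T]
    {φ ψ : T → Mor F S} (hφ : Continuous φ) (hψ : Continuous ψ) :
    Continuous fun t => (φ t).sum (ψ t) :=
  Mor.kContinuous₂_sum T φ ψ hφ hψ

/-- The direct sum of two simplices of the nerve. -/
def FuncSimplex.sum (x y : FuncSimplex F G m S) : FuncSimplex F G m S where
  fn i := ⟨fun p => (x.fn i p).sum (y.fn i p),
    continuous_mor_sum (x.fn i).continuous (y.fn i).continuous⟩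
  nt p := ⟨fun g => (x.nt p g).sum (y.nt p g),
    continuous_mor_sum (x.nt p).continuous (y.nt p).continuous⟩
  fn_id i g := (x.fn_id i g).sum (y.fn_id i g)
  fn_comp i g h k := (x.fn_comp i g h k).sum (y.fn_comp i g h k)
  nt_natural i j hij g h := by
    obtain ⟨d, h1, h2⟩ := x.nt_natural i j hij g h
    obtain ⟨d', h1', h2'⟩ := y.nt_natural i j hij g h
    exact ⟨_, h1.sum h1', h2.sum h2'⟩
  nt_id i g := congrArg₂ Mor.sum (x.nt_id i g) (y.nt_id i g)
  nt_comp i j k hij hjk g := (x.nt_comp i j k hij hjk g).sum (y.nt_comp i j k hij hjk g)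

omit [Finite S] in
lemma continuous_map_mor_sum [Finite S] {T K : Type*} [TopologicalSpace T] [LocallyCompactSpace T]
    [T2Space T] [TopologicalSpace K] [LocallyCompactSpace K] [T2Space K]
    {φ ψ χ : T → C(K, Mor F S)} (hφ : Continuous φ) (hψ : Continuous ψ)
    (h : ∀ t k, χ t k = (φ t k).sum (ψ t k)) : Continuous χ := by
  have h1 : Continuous fun p : T × K => χ p.1 p.2 := by
    simp only [h]
    exact continuous_mor_sum (ContinuousMap.continuous_uncurry_of_continuous ⟨_, hφ⟩)
      (ContinuousMap.continuous_uncurry_of_continuous ⟨_, hψ⟩)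
  exact (ContinuousMap.curry ⟨_, h1⟩).continuous

lemma FuncSimplex.kContinuous₂_sum :
    KContinuous₂.{max u w} (FuncSimplex.sum (F := F) (G := G) (m := m) (S := S)) := by
  intro T _ _ _ α β hα hβ
  have : UCompactlyGeneratedSpace.{max u w} T := uCompactlyGeneratedSpace_of_locallyCompactSpace
  refine FuncSimplex.continuous_iff.2 ⟨fun i => ?_, fun p => ?_⟩
  · exact continuous_map_mor_sum ((FuncSimplex.continuous_fn i).comp hα)
      ((FuncSimplex.continuous_fn i).comp hβ) fun _ _ => rfl
  · exact continuous_map_mor_sum ((FuncSimplex.continuous_nt p).comp hα)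
      ((FuncSimplex.continuous_nt p).comp hβ) fun _ _ => rfl

lemma FuncSimplex.sum_pull {T : Type} [Finite T] (γ : GammaHom S T) (x y : FuncSimplex F G m T) :
    (x.sum y).pull γ = (x.pull γ).sum (y.pull γ) :=
  FuncSimplex.ext (funext fun _ => ContinuousMap.ext fun _ => Mor.sum_pull _ _ _)
    (funext fun _ => ContinuousMap.ext fun _ => Mor.sum_pull _ _ _)

lemma FuncSimplex.sum_pull_zero (γ : GammaHom S (Fin 0)) (x : FuncSimplex F G m S)
    (y : FuncSimplex F G m (Fin 0)) : x.sum (y.pull γ) = x.relabel fun _ => evenEmb :=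
  FuncSimplex.ext (funext fun _ => ContinuousMap.ext fun _ =>
      Mor.sum_zero _ _ (pullLabel_fin_zero γ _))
    (funext fun _ => ContinuousMap.ext fun _ => Mor.sum_zero _ _ (pullLabel_fin_zero γ _))

lemma FuncSimplex.pull_zero_sum (γ : GammaHom S (Fin 0)) (x : FuncSimplex F G m S)
    (y : FuncSimplex F G m (Fin 0)) : (y.pull γ).sum x = x.relabel fun _ => oddEmb :=
  FuncSimplex.ext (funext fun _ => ContinuousMap.ext fun _ =>
      Mor.zero_sum _ _ (pullLabel_fin_zero γ _))
    (funext fun _ => ContinuousMap.ext fun _ => Mor.zero_sum _ _ (pullLabel_fin_zero γ _))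

end FuncSimplexSum

section Interval

/-- The simplices of the simplicial interval. -/
def IntervalSimplex (m : ℕ) : Type := Fin (m + 1) →o Fin 2

instance (m : ℕ) : TopologicalSpace (IntervalSimplex m) := ⊥

instance (m : ℕ) : DiscreteTopology (IntervalSimplex m) := ⟨rfl⟩

/-- The point of the realization of the simplicial interval with parameter `s`. -/
def intervalPoint (s : I) : Realization IntervalSimplex
    (fun θ (α : Fin (_ + 1) →o Fin 2) => α.comp θ) fun _ => True :=
  Quot.mk _ ⟨1, (OrderHom.id : Fin 2 →o Fin 2), stdSimplexHomeomorphUnitInterval.symm s⟩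

lemma continuous_intervalPoint : Continuous intervalPoint :=
  continuous_quot_mk.comp (continuous_sigmaMk.comp (continuous_const.prodMk
    stdSimplexHomeomorphUnitInterval.symm.continuous))

/-- The end points of the interval are given by vertices. -/
lemma intervalPoint_vertex (j : Fin 2) :
    intervalPoint (stdSimplexHomeomorphUnitInterval (stdSimplex.vertex j)) =
      Quot.mk _ ⟨0, (OrderHom.const _ j : Fin 1 →o Fin 2), stdSimplex.vertex 0⟩ := by
  have h := RealRel.glue (N := IntervalSimplex)
    (str := fun θ (α : Fin (_ + 1) →o Fin 2) => α.comp θ) (P := fun _ => True)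
    (OrderHom.const _ j : Fin (0 + 1) →o Fin (1 + 1)) trivial (OrderHom.id : Fin 2 →o Fin 2)
    (stdSimplex.vertex 0)
  rw [stdSimplex.map_vertex] at h
  rw [intervalPoint, Homeomorph.symm_apply_apply]
  exact (Quot.sound h).symm

end Interval

section VecSum

variable {F : Type w} [RCLike F] {G : Type u} [TopologicalSpace G] {S : Type}

/-- The simplices of the nerve, paired with the simplices of the interval: the labels are changed
along `ρ` over the end point of the interval. -/
def intervalPairing (F : Type w) [RCLike F] (G : Type u) [TopologicalSpace G] (S : Type)
    (ρ : ℕ ↪ ℕ) : Pairing (fun m => FuncSimplex F G m S) (fun θ x => x.reindex θ)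
      IntervalSimplex (fun θ (α : Fin (_ + 1) →o Fin 2) => α.comp θ)
      (fun m => FuncSimplex F G m S) (fun θ x => x.reindex θ) (fun _ => True) where
  pair x (α : Fin (_ + 1) →o Fin 2) := x.relabel fun i => if α i = 0 then Function.Embedding.refl ℕ else ρ
  pair_str _ _ _ := rfl
  comp₁ _ _ _ := rfl
  comp₂ _ _ _ := rfl
  of_injective _ _ := trivial
  injective_or := Or.inr fun _ => trivial

instance (m : ℕ) : UCompactlyGeneratedSpace.{max u w}
    (FuncSimplex F G m S × stdSimplex ℝ (Fin (m + 1))) := by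
  have : LocallyCompactSpace (stdSimplex ℝ (Fin (m + 1))) := locallyCompactSpace_of_compactSpace
  exact uCompactlyGeneratedSpace_prod.{_, 0, max u w}

instance : UCompactlyGeneratedSpace.{max u w} (Vec F G S) :=
  uCompactlyGeneratedSpace_of_isQuotientMap
    (X := Σ m, FuncSimplex F G m S × stdSimplex ℝ (Fin (m + 1))) isQuotientMap_quot_mk

/-- The deformation of `Vec F G S` that changes the labels along `ρ`. -/
def Vec.deform (ρ : ℕ ↪ ℕ) (z : Vec F G S) (s : I) : Vec F G S :=
  (intervalPairing F G S ρ).prod z (intervalPoint s)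

lemma Vec.continuous_deform (ρ : ℕ ↪ ℕ) :
    Continuous fun p : Vec F G S × I => Vec.deform ρ p.1 p.2 := by
  have h : KContinuous₂.{max u w} (intervalPairing F G S ρ).prod := by
    refine Pairing.kContinuous₂_prod.{_, _, _, max u w, 0} _
      (fun θ => FuncSimplex.continuous_reindex θ) (fun θ => continuous_of_discreteTopology)
      fun r => ?_
    intro T _ _ _ α β hα hβ
    have h1 : Continuous fun p : IntervalSimplex r × FuncSimplex F G r S =>
        (intervalPairing F G S ρ).pair p.2 p.1 :=
      continuous_prod_of_discrete_left.2 fun (a : Fin (r + 1) →o Fin 2) =>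
        FuncSimplex.continuous_relabel fun i => if a i = 0 then Function.Embedding.refl ℕ else ρ
    exact h1.comp (hβ.prodMk hα)
  have : UCompactlyGeneratedSpace.{max u w} (Vec F G S × I) :=
    uCompactlyGeneratedSpace_prod.{_, 0, max u w}
  exact h.continuous_comp continuous_fst (continuous_intervalPoint.comp continuous_snd)

/-- The map of `Vec F G S` that changes the labels along `ρ`. -/
def Vec.relabel (ρ : ℕ ↪ ℕ) : Vec F G S → Vec F G S :=
  Quot.map (fun x => ⟨x.1, x.2.1.relabel fun _ => ρ, x.2.2⟩) (by
    rintro _ _ ⟨θ, -, a, t⟩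
    exact RealRel.glue (N := fun m => FuncSimplex F G m S) θ trivial (a.relabel fun _ => ρ) t)

lemma Vec.deform_zero (ρ : ℕ ↪ ℕ) (z : Vec F G S) : Vec.deform ρ z 0 = z := by
  obtain ⟨m, x, t⟩ := z
  have h := intervalPoint_vertex 0
  rw [stdSimplexHomeomorphUnitInterval_zero] at h
  change (intervalPairing F G S ρ).prod _ (intervalPoint _) = _
  rw [h]
  refine ((intervalPairing F G S ρ).prod_vertex_right x _ t _).trans ?_
  exact congrArg (fun x => (Quot.mk _ ⟨m, x, t⟩ : Vec F G S)) (FuncSimplex.relabel_refl x)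

lemma Vec.deform_one (ρ : ℕ ↪ ℕ) (z : Vec F G S) : Vec.deform ρ z 1 = z.relabel ρ := by
  obtain ⟨m, x, t⟩ := z
  have h := intervalPoint_vertex 1
  rw [stdSimplexHomeomorphUnitInterval_one] at h
  change (intervalPairing F G S ρ).prod _ (intervalPoint _) = _
  rw [h]
  exact (intervalPairing F G S ρ).prod_vertex_right x _ t _

/-- Deformation and functoriality in the finite set act on different factors of a simplex, once both
points are represented on a common chain. -/
lemma Vec.deform_pull {T : Type} (γ : GammaHom S T) (ρ : ℕ ↪ ℕ) (z : Vec F G T) (s : I) :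
    (Vec.deform ρ z s).pull γ = Vec.deform ρ (z.pull γ) s := by
  obtain ⟨m, x, t⟩ := z
  obtain ⟨r, c₁, c₂, v, hc, rfl, hs⟩ :=
    exists_coupling t (stdSimplexHomeomorphUnitInterval.symm s)
  change Vec.pull γ ((intervalPairing F G T ρ).prod _ (intervalPoint s)) =
    (intervalPairing F G S ρ).prod _ (intervalPoint s)
  rw [intervalPoint, ← hs]
  have h1 := (intervalPairing F G T ρ).prod_mk x (OrderHom.id : Fin 2 →o Fin 2) hc v
  have h2 := (intervalPairing F G S ρ).prod_mk (x.pull γ) (OrderHom.id : Fin 2 →o Fin 2) hc v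
  refine (congrArg (Vec.pull γ) h1).trans (Eq.trans ?_ h2.symm)
  exact congrArg (fun x => (Quot.mk _ ⟨r, x, v⟩ : Vec F G S)) (FuncSimplex.relabel_pull _ _ _)

lemma Vec.pull_pull {S' T : Type} {γ : GammaHom S T} {γ' : GammaHom S' S}
    {γ'' : GammaHom S' T} (h : ∀ s t, t ∈ γ''.toFun s ↔ ∃ r ∈ γ'.toFun s, t ∈ γ.toFun r)
    (z : Vec F G T) : (z.pull γ).pull γ' = z.pull γ'' := by
  obtain ⟨m, x, t⟩ := z
  exact congrArg (fun x => (Quot.mk _ ⟨m, x, t⟩ : Vec F G S')) (FuncSimplex.pull_pull h x)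

lemma Vec.pull_id {γ : GammaHom S S} (h : ∀ s t, t ∈ γ.toFun s ↔ t = s)
    (z : Vec F G S) : z.pull γ = z := by
  obtain ⟨m, x, t⟩ := z
  exact congrArg (fun x => (Quot.mk _ ⟨m, x, t⟩ : Vec F G S)) (FuncSimplex.pull_id h x)

lemma Vec.continuous_pull {T : Type} (γ : GammaHom S T) :
    Continuous fun z : Vec F G T => z.pull γ := by
  refine continuous_quot_lift _ ?_
  refine continuous_quot_mk.comp (continuous_sigma fun m => ?_)
  refine continuous_sigmaMk.comp ?_
  exact ((FuncSimplex.continuous_pull γ).comp continuous_fst).prodMk continuous_snd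

instance : Subsingleton (Vec F G (Fin 0)) := by
  have key : ∀ (m : ℕ) (x : FuncSimplex F G m (Fin 0)) (t : stdSimplex ℝ (Fin (m + 1))),
      ∃ y u, (Quot.mk _ ⟨m, x, t⟩ : Vec F G (Fin 0)) = Quot.mk _ ⟨0, y, u⟩ := by
    intro m x t
    let θ : Fin (m + 1) →o Fin (0 + 1) := OrderHom.const _ 0
    refine ⟨x.reindex (OrderHom.const _ 0), stdSimplex.map θ t, ?_⟩
    rw [Subsingleton.elim x ((x.reindex (OrderHom.const (Fin (0 + 1)) 0)).reindex θ)]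
    exact Quot.sound (RealRel.glue (N := fun m => FuncSimplex F G m (Fin 0)) θ trivial _ t)
  refine ⟨?_⟩
  rintro ⟨m, x, t⟩ ⟨n, y, u⟩
  obtain ⟨x', t', h1⟩ := key m x t
  obtain ⟨y', u', h2⟩ := key n y u
  rw [h1, h2, Subsingleton.elim x' y', Subsingleton.elim t' u']

lemma Vec.exists_zero (z : Vec F G (Fin 0)) : ∃ x t, z = Quot.mk _ ⟨0, x, t⟩ := by
  obtain ⟨m, x, t⟩ := z
  exact ⟨x.reindex (OrderHom.const _ 0), stdSimplex.vertex 0, Subsingleton.elim _ _⟩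

variable [LocallyCompactSpace G] [T2Space G] [Finite S]

/-- The levelwise direct sum. -/
def sumPairing (F : Type w) [RCLike F] (G : Type u) [TopologicalSpace G] [LocallyCompactSpace G]
    [T2Space G] (S : Type) [Finite S] :
    Pairing (fun m => FuncSimplex F G m S) (fun θ x => x.reindex θ)
      (fun m => FuncSimplex F G m S) (fun θ x => x.reindex θ)
      (fun m => FuncSimplex F G m S) (fun θ x => x.reindex θ) (fun _ => True) where
  pair x y := x.sum y
  pair_str _ _ _ := rfl
  comp₁ _ _ _ := rfl
  comp₂ _ _ _ := rfl
  of_injective _ _ := trivial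
  injective_or := Or.inr fun _ => trivial

/-- The direct sum of two points of `Vec F G S`. -/
def Vec.sum (z z' : Vec F G S) : Vec F G S := (sumPairing F G S).prod z z'

lemma Vec.kContinuous₂_sum.{t} : KContinuous₂.{t} (Vec.sum (F := F) (G := G) (S := S)) :=
  Pairing.kContinuous₂_prod.{_, _, _, max u w, max u w} (sumPairing F G S)
    (fun θ => FuncSimplex.continuous_reindex θ)
    (fun θ => FuncSimplex.continuous_reindex θ) fun _ => FuncSimplex.kContinuous₂_sum

lemma Vec.sum_pull {T : Type} [Finite T] (γ : GammaHom S T) (z z' : Vec F G T) :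
    (z.sum z').pull γ = (z.pull γ).sum (z'.pull γ) := by
  obtain ⟨m, x, t⟩ := z
  obtain ⟨k, y, s⟩ := z'
  obtain ⟨r, c₁, c₂, v, hc, rfl, rfl⟩ := exists_coupling t s
  have h1 := (sumPairing F G T).prod_mk x y hc v
  have h2 := (sumPairing F G S).prod_mk (x.pull γ) (y.pull γ) hc v
  refine (congrArg (Vec.pull γ) h1).trans (Eq.trans ?_ h2.symm)
  exact congrArg (fun x => (Quot.mk _ ⟨r, x, v⟩ : Vec F G S)) (FuncSimplex.sum_pull γ _ _)

lemma Vec.sum_pull_zero (γ : GammaHom S (Fin 0)) (z : Vec F G S) (z₀ : Vec F G (Fin 0)) :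
    z.sum (z₀.pull γ) = z.relabel evenEmb := by
  obtain ⟨m, x, t⟩ := z
  obtain ⟨y, s, rfl⟩ := z₀.exists_zero
  have h := (sumPairing F G S).prod_vertex_right x (y.pull γ) t s
  have h' : (sumPairing F G S).pair (x.reindex OrderHom.id) ((y.pull γ).reindex (OrderHom.const _ 0)) =
      x.relabel fun _ => evenEmb := FuncSimplex.sum_pull_zero γ x (y.reindex (OrderHom.const _ 0))
  rw [h'] at h
  exact h

lemma Vec.pull_zero_sum (γ : GammaHom S (Fin 0)) (z : Vec F G S) (z₀ : Vec F G (Fin 0)) :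
    (z₀.pull γ).sum z = z.relabel oddEmb := by
  obtain ⟨m, x, t⟩ := z
  obtain ⟨y, s, rfl⟩ := z₀.exists_zero
  have h := (sumPairing F G S).prod_vertex_left (y.pull γ) x t s
  have h' : (sumPairing F G S).pair ((y.pull γ).reindex (OrderHom.const _ 0)) (x.reindex OrderHom.id) =
      x.relabel fun _ => oddEmb := FuncSimplex.pull_zero_sum γ x (y.reindex (OrderHom.const _ 0))
  rw [h'] at h
  exact h

end VecSum

/-! ### The addition of the classifying space -/

section GammaOfOrderHom

lemma mem_gammaOfOrderHom {n m : ℕ} (δ : Fin (n + 1) →o Fin (m + 1)) (k : Fin n) (j : Fin m) :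
    j ∈ (gammaOfOrderHom δ).toFun k ↔
      (δ k.castSucc : ℕ) < (j : ℕ) + 1 ∧ (j : ℕ) + 1 ≤ (δ k.succ : ℕ) := by
  simp [gammaOfOrderHom]

lemma mem_gammaOfOrderHom_id {n : ℕ} (s t : Fin n) :
    t ∈ (gammaOfOrderHom (OrderHom.id : Fin (n + 1) →o Fin (n + 1))).toFun s ↔ t = s := by
  rw [mem_gammaOfOrderHom, Fin.ext_iff]
  simp only [OrderHom.id_coe, id_eq, Fin.val_castSucc, Fin.val_succ]
  omega

lemma mem_gammaOfOrderHom_comp {l n m : ℕ} (η : Fin (l + 1) →o Fin (n + 1))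
    (θ : Fin (n + 1) →o Fin (m + 1)) (s : Fin l) (t : Fin m) :
    t ∈ (gammaOfOrderHom (θ.comp η)).toFun s ↔
      ∃ r ∈ (gammaOfOrderHom η).toFun s, t ∈ (gammaOfOrderHom θ).toFun r := by
  simp only [mem_gammaOfOrderHom, OrderHom.comp_coe, Function.comp_apply]
  constructor
  · rintro ⟨h1, h2⟩
    -- `r + 1` is the first element that `θ` maps beyond `t`.
    have hex : ∃ k, ∃ hk : k < n + 1, (t : ℕ) + 1 ≤ θ ⟨k, hk⟩ :=
      ⟨η s.succ, (η s.succ).2, h2⟩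
    classical
    obtain ⟨hk, hk'⟩ := Nat.find_spec hex
    have hle : Nat.find hex ≤ η s.succ := Nat.find_min' hex ⟨(η s.succ).2, h2⟩
    have hgt : (η s.castSucc : ℕ) < Nat.find hex := by
      by_contra h3
      have h4 : θ ⟨Nat.find hex, hk⟩ ≤ θ (η s.castSucc) := θ.monotone (by
        rw [Fin.le_def]
        exact not_lt.1 h3)
      rw [Fin.le_def] at h4
      omega
    obtain ⟨k, hk0⟩ : ∃ k, Nat.find hex = k + 1 := ⟨Nat.find hex - 1, by omega⟩
    have hmin := Nat.find_min hex (m := k) (by omega)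
    simp only [hk0] at hk hk' hle hgt
    refine ⟨⟨k, by omega⟩, ⟨hgt, hle⟩, ?_, hk'⟩
    by_contra h3
    exact hmin ⟨by omega, not_lt.1 h3⟩
  · rintro ⟨r, ⟨h1, h2⟩, h3, h4⟩
    have h5 : θ (η s.castSucc) ≤ θ r.castSucc := θ.monotone (by
      rw [Fin.le_def]
      exact Nat.lt_succ_iff.1 h1)
    have h6 : θ r.succ ≤ θ (η s.succ) := θ.monotone (by
      rw [Fin.le_def]
      exact h2)
    rw [Fin.le_def] at h5 h6
    exact ⟨by omega, by omega⟩

end GammaOfOrderHom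

section BVecSum

variable {F : Type w} [RCLike F] {G : Type u} [TopologicalSpace G]

/-- The deformation of `BVec F G` that changes the labels along `ρ`. -/
def BVec.deform (ρ : ℕ ↪ ℕ) (c : BVec F G) (s : I) : BVec F G :=
  Quot.map (fun x => ⟨x.1, Vec.deform ρ x.2.1 s, x.2.2⟩) (by
    rintro _ _ ⟨θ, hθ, a, t⟩
    dsimp only
    rw [← Vec.deform_pull]
    exact RealRel.glue (N := fun m => Vec F G (Fin m))
      (str := fun θ x => x.pull (gammaOfOrderHom θ)) θ hθ (Vec.deform ρ a s) t) c

lemma BVec.continuous_deform (ρ : ℕ ↪ ℕ) :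
    Continuous fun p : BVec F G × I => BVec.deform ρ p.1 p.2 := by
  have h1 : ∀ c : BVec F G, Continuous fun s : I => BVec.deform ρ c s := by
    rintro ⟨m, x, t⟩
    refine continuous_quot_mk.comp (continuous_sigmaMk.comp (Continuous.prodMk ?_
      continuous_const))
    exact (Vec.continuous_deform ρ).comp (continuous_const.prodMk continuous_id)
  have h2 : Continuous fun c : BVec F G => (⟨fun s => BVec.deform ρ c s, h1 c⟩ : C(I, BVec F G)) := by
    refine isQuotientMap_quot_mk.continuous_iff.2 (continuous_sigma fun m => ?_)
    have h3 : Continuous fun p : (Vec F G (Fin m) × stdSimplex ℝ (Fin (m + 1))) × I =>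
        BVec.deform ρ (Quot.mk _ ⟨m, p.1⟩) p.2 := by
      have h4 := (Vec.continuous_deform (F := F) (G := G) (S := Fin m) ρ).comp
        ((continuous_fst (X := Vec F G (Fin m) × stdSimplex ℝ (Fin (m + 1))) (Y := I)).fst.prodMk
          continuous_snd)
      exact continuous_quot_mk.comp (continuous_sigmaMk.comp (h4.prodMk continuous_fst.snd))
    exact (ContinuousMap.curry ⟨_, h3⟩).continuous
  exact ContinuousMap.continuous_uncurry_of_continuous ⟨_, h2⟩

lemma BVec.deform_zero (ρ : ℕ ↪ ℕ) (c : BVec F G) : BVec.deform ρ c 0 = c := by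
  obtain ⟨m, x, t⟩ := c
  exact congrArg (fun x => (Quot.mk _ ⟨m, x, t⟩ : BVec F G)) (Vec.deform_zero ρ x)

lemma BVec.deform_base [Group G] (ρ : ℕ ↪ ℕ) (s : I) :
    BVec.deform ρ (BVec.base F G) s = BVec.base F G :=
  congrArg (fun x => (Quot.mk _ ⟨0, x, stdSimplex.vertex 0⟩ : BVec F G)) (Subsingleton.elim _ _)

section Smul

variable [Group G] [IsTopologicalGroup G] {S : Type}

lemma Vec.smul_deform (ρ : ℕ ↪ ℕ) (a : G) (z : Vec F G S) (s : I) :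
    a • Vec.deform ρ z s = Vec.deform ρ (a • z) s := by
  obtain ⟨m, x, t⟩ := z
  obtain ⟨r, c₁, c₂, v, hc, rfl, hs⟩ :=
    exists_coupling t (stdSimplexHomeomorphUnitInterval.symm s)
  have key : ∀ z : Vec F G S, Vec.deform ρ z s =
      (intervalPairing F G S ρ).prod z (Quot.mk _ ⟨1, (OrderHom.id : Fin 2 →o Fin 2),
        stdSimplex.map c₂ v⟩) := fun z => by rw [hs]; rfl
  have h1 := (intervalPairing F G S ρ).prod_mk x (OrderHom.id : Fin 2 →o Fin 2) hc v
  have h2 := (intervalPairing F G S ρ).prod_mk (a • x) (OrderHom.id : Fin 2 →o Fin 2) hc v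
  exact (congrArg (fun z : Vec F G S => a • z) ((key _).trans h1)).trans ((key _).trans h2).symm

lemma BVec.smul_deform (ρ : ℕ ↪ ℕ) (a : G) (c : BVec F G) (s : I) :
    a • BVec.deform ρ c s = BVec.deform ρ (a • c) s := by
  obtain ⟨m, x, t⟩ := c
  exact congrArg (fun x => (Quot.mk _ ⟨m, x, t⟩ : BVec F G)) (Vec.smul_deform ρ a x s)

end Smul

variable [LocallyCompactSpace G] [T2Space G]

/-- The direct sum, as a pairing of the simplicial spaces that define `BVec F G`. -/
def outerPairing (F : Type w) [RCLike F] (G : Type u) [TopologicalSpace G] [LocallyCompactSpace G]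
    [T2Space G] :
    Pairing (fun m => Vec F G (Fin m)) (fun θ x => x.pull (gammaOfOrderHom θ))
      (fun m => Vec F G (Fin m)) (fun θ x => x.pull (gammaOfOrderHom θ))
      (fun m => Vec F G (Fin m)) (fun θ x => x.pull (gammaOfOrderHom θ))
      (fun θ => Function.Injective θ) where
  pair x y := x.sum y
  pair_str _ a b := Vec.sum_pull _ a b
  comp₁ η θ a := Vec.pull_pull (mem_gammaOfOrderHom_comp η θ) a
  comp₂ η θ a := Vec.pull_pull (mem_gammaOfOrderHom_comp η θ) a
  of_injective _ h := h
  injective_or := Or.inl fun _ h => h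

/-- The addition of `BVec F G`. -/
def BVec.add (c d : BVec F G) : BVec F G := (outerPairing F G).prod c d

lemma BVec.kContinuous₂_add.{t} : KContinuous₂.{t} (BVec.add (F := F) (G := G)) :=
  Pairing.kContinuous₂_prod.{_, _, _, max u w, max u w} (outerPairing F G)
    (fun _ => Vec.continuous_pull _) (fun _ => Vec.continuous_pull _) fun r => Vec.kContinuous₂_sum (S := Fin r)

/-- Adding the base point on the right moves the labels to the even numbers, which is the end of a
deformation of the identity. -/
lemma BVec.add_base [Group G] (c : BVec F G) :
    c.add (BVec.base F G) = BVec.deform evenEmb c 1 := by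
  obtain ⟨m, x, t⟩ := c
  have h := (outerPairing F G).prod_vertex_right x
    (Quot.mk _ ⟨0, FuncSimplex.base, stdSimplex.vertex 0⟩) t (stdSimplex.vertex 0)
  refine h.trans (congrArg (fun x => (Quot.mk _ ⟨m, x, t⟩ : BVec F G)) ?_)
  rw [Vec.deform_one, Vec.pull_id mem_gammaOfOrderHom_id]
  exact Vec.sum_pull_zero _ _ _

lemma BVec.base_add [Group G] (c : BVec F G) :
    (BVec.base F G).add c = BVec.deform oddEmb c 1 := by
  obtain ⟨m, x, t⟩ := c
  have h := (outerPairing F G).prod_vertex_left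
    (Quot.mk _ ⟨0, FuncSimplex.base, stdSimplex.vertex 0⟩) x t (stdSimplex.vertex 0)
  refine h.trans (congrArg (fun x => (Quot.mk _ ⟨m, x, t⟩ : BVec F G)) ?_)
  rw [Vec.deform_one, Vec.pull_id mem_gammaOfOrderHom_id]
  exact Vec.pull_zero_sum (gammaOfOrderHom (OrderHom.const (Fin (m + 1)) (0 : Fin (0 + 1)))) x
    (Quot.mk _ ⟨0, FuncSimplex.base, stdSimplex.vertex 0⟩)

variable [Group G] [IsTopologicalGroup G]

lemma Vec.smul_sum {S : Type} [Finite S] (a : G) (z z' : Vec F G S) :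
    a • z.sum z' = (a • z).sum (a • z') := by
  obtain ⟨m, x, t⟩ := z
  obtain ⟨k, y, s⟩ := z'
  obtain ⟨r, c₁, c₂, v, hc, rfl, rfl⟩ := exists_coupling t s
  have h1 := (sumPairing F G S).prod_mk x y hc v
  have h2 := (sumPairing F G S).prod_mk (a • x) (a • y) hc v
  exact (congrArg (fun z : Vec F G S => a • z) h1).trans h2.symm

lemma BVec.smul_add (a : G) (c d : BVec F G) : a • c.add d = (a • c).add (a • d) := by
  obtain ⟨m, x, t⟩ := c
  obtain ⟨k, y, s⟩ := d
  obtain ⟨r, c₁, c₂, v, hc, rfl, rfl⟩ := exists_coupling t s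
  have h1 := (outerPairing F G).prod_mk x y hc v
  have h2 := (outerPairing F G).prod_mk (a • x) (a • y) hc v
  refine (congrArg (fun z : BVec F G => a • z) h1).trans (Eq.trans ?_ h2.symm)
  refine congrArg (fun x => (Quot.mk _ ⟨r, x, v⟩ : BVec F G)) ?_
  rw [← Vec.smul_pull, ← Vec.smul_pull]
  exact Vec.smul_sum a _ _

end BVecSum

/-! ### Point-set topology of `G`-CW-complexes and extension of homotopies -/

section RelGCWTopology

variable {G : Type u} [Group G] [TopologicalSpace G] {X : Type v} [TopologicalSpace X]
  [MulAction G X]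

/-- A `G`-CW-complex is compactly generated, as its cells `(G/H) × D^n` are quotients of the locally
compact spaces `G × D^n`. -/
lemma IsGCW.uCompactlyGeneratedSpace [IsTopologicalGroup G] [LocallyCompactSpace G] [T2Space G]
    (h : IsGCW G X) : UCompactlyGeneratedSpace.{u} X := by
  obtain ⟨R⟩ := h
  have hcell : ∀ (H : Subgroup G) n, UCompactlyGeneratedSpace.{u} ((G ⧸ H) × Disk n) := by
    intro H n
    have : LocallyCompactSpace (Disk n) := locallyCompactSpace_of_compactSpace
    have : UCompactlyGeneratedSpace.{u} (G × Disk n) :=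
      uCompactlyGeneratedSpace_of_locallyCompactSpace
    have hq : IsOpenQuotientMap fun p : G × Disk n => ((p.1 : G ⧸ H), p.2) :=
      (QuotientGroup.isOpenQuotientMap_mk (N := H)).prodMap IsOpenQuotientMap.id
    exact uCompactlyGeneratedSpace_of_isQuotientMap.{u} hq.isQuotientMap
  refine uCompactlyGeneratedSpace_of_isClosed fun C hC => R.isClosed_of_sk C fun n => ?_
  induction n with
  | zero =>
    have : IsEmpty (R.sk 0) := by
      rw [R.sk_zero]
      infer_instance
    rw [Subsingleton.elim ((↑) ⁻¹' C : Set (R.sk 0)) ∅]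
    exact isClosed_empty
  | succ n ih =>
    refine R.isClosed_of_char n C ih fun i => ?_
    have := hcell (R.stab n i) n
    refine UCompactlyGeneratedSpace.isClosed.{u} fun S f => ?_
    exact hC S ((R.char n i).comp f)

end RelGCWTopology

section Retraction

variable {n : ℕ}

/-- The retraction of the Euclidean space to the unit disk. -/
def diskRetract (v : EuclideanSpace ℝ (Fin n)) : Disk n :=
  ⟨(max 1 ‖v‖)⁻¹ • v, by
    have h : 0 < max 1 ‖v‖ := lt_max_of_lt_left one_pos
    rw [mem_closedBall_zero_iff, norm_smul, norm_inv, Real.norm_of_nonneg h.le,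
      inv_mul_le_one₀ h]
    exact le_max_right _ _⟩

lemma continuous_diskRetract : Continuous (diskRetract (n := n)) :=
  Continuous.subtype_mk (((continuous_const.max continuous_norm).inv₀ fun _ =>
    (lt_max_of_lt_left one_pos).ne').smul continuous_id) _

lemma diskRetract_of_norm_le {v : EuclideanSpace ℝ (Fin n)} (h : ‖v‖ ≤ 1) :
    (diskRetract v).1 = v := by
  simp [diskRetract, h]

/-- The radial projection to the sphere, on the complement of the ball of radius `1/2`. -/
def radial (x : Disk n) : Disk n := diskRetract ((max (‖x.1‖) 2⁻¹)⁻¹ • x.1)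

lemma max_norm_pos (x : Disk n) : 0 < max ‖x.1‖ 2⁻¹ := lt_max_of_lt_right (by norm_num)

lemma continuous_radial : Continuous (radial (n := n)) :=
  continuous_diskRetract.comp ((((continuous_norm.comp continuous_subtype_val).max
    continuous_const).inv₀ fun x => (max_norm_pos x).ne').smul continuous_subtype_val)

lemma radial_val (x : Disk n) : (radial x).1 = (max ‖x.1‖ 2⁻¹)⁻¹ • x.1 := by
  refine diskRetract_of_norm_le ?_
  rw [norm_smul, norm_inv, Real.norm_of_nonneg (max_norm_pos x).le, inv_mul_le_one₀ (max_norm_pos x)]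
  exact le_max_left _ _

lemma norm_radial {x : Disk n} (h : 2⁻¹ ≤ ‖x.1‖) : ‖(radial x).1‖ = 1 := by
  have h0 : 0 < ‖x.1‖ := lt_of_lt_of_le (by norm_num) h
  rw [radial_val, max_eq_left h, norm_smul, norm_inv, norm_norm, inv_mul_cancel₀ h0.ne']

lemma radial_of_norm_eq_one {x : Disk n} (h : ‖x.1‖ = 1) : radial x = x := by
  refine Subtype.ext ?_
  rw [radial_val, h, max_eq_left (by norm_num), inv_one, one_smul]

/-- The time at which the ray from the point `(0, 2)` through `(x, t)` reaches `S^(n-1) × I`. -/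
def radialTime (x : Disk n) (t : I) : I :=
  Set.projIcc 0 1 zero_le_one (2 - (2 - (t : ℝ)) / max ‖x.1‖ 2⁻¹)

lemma continuous_radialTime {T : Type*} [TopologicalSpace T] {x : T → Disk n} {t : T → I}
    (hx : Continuous x) (ht : Continuous t) : Continuous fun q => radialTime (x q) (t q) := by
  have h1 : Continuous fun q => (2 - (t q : ℝ)) / max ‖(x q).1‖ 2⁻¹ :=
    Continuous.div (by fun_prop) (by fun_prop) fun q => (max_norm_pos (x q)).ne'
  exact continuous_projIcc.comp (continuous_const.sub h1)

lemma radialTime_of_norm_eq_one {x : Disk n} (h : ‖x.1‖ = 1) (t : I) : radialTime x t = t := by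
  rw [radialTime, h, max_eq_left (by norm_num), div_one, sub_sub_cancel]
  exact Set.projIcc_val _ t

lemma radialTime_of_eq {x : Disk n} {t : I} (h : 2 * ‖x.1‖ = 2 - t) : radialTime x t = 0 := by
  have h1 : (2 : ℝ)⁻¹ ≤ ‖x.1‖ := by linarith [t.2.2]
  have h0 : 0 < ‖x.1‖ := lt_of_lt_of_le (by norm_num) h1
  rw [radialTime, max_eq_left h1, ← h, mul_div_assoc, div_self h0.ne']
  norm_num

/-- The intersection of `D^n × 0` with the ray from `(0, 2)` through `(x, t)`. -/
def bottom (x : Disk n) (t : I) : Disk n := diskRetract ((2 / (2 - (t : ℝ))) • x.1)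

lemma two_sub_pos (t : I) : 0 < 2 - (t : ℝ) := by linarith [t.2.2]

lemma continuous_bottom {T : Type*} [TopologicalSpace T] {x : T → Disk n} {t : T → I}
    (hx : Continuous x) (ht : Continuous t) : Continuous fun q => bottom (x q) (t q) := by
  have h1 : Continuous fun q => 2 / (2 - (t q : ℝ)) :=
    Continuous.div (by fun_prop) (by fun_prop) fun q => (two_sub_pos (t q)).ne'
  exact continuous_diskRetract.comp (h1.smul (continuous_subtype_val.comp hx))

lemma bottom_zero (x : Disk n) : bottom x 0 = x := by
  refine Subtype.ext ?_
  have h : (2 / (2 - ((0 : I) : ℝ))) • x.1 = x.1 := by simp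
  rw [bottom, h, diskRetract_of_norm_le (mem_closedBall_zero_iff.1 x.2)]

lemma bottom_of_eq {x : Disk n} {t : I} (h : 2 * ‖x.1‖ = 2 - t) : bottom x t = radial x := by
  have h1 : (2 : ℝ)⁻¹ ≤ ‖x.1‖ := by linarith [t.2.2]
  have h0 : 0 < ‖x.1‖ := lt_of_lt_of_le (by norm_num) h1
  have h2 : 2 / (2 - (t : ℝ)) = (max ‖x.1‖ 2⁻¹)⁻¹ := by
    rw [← h, max_eq_left h1]
    field_simp
  rw [bottom, h2, radial]

end Retraction

section HomotopyExtension

variable {G : Type u} [Group G] [TopologicalSpace G] {X : Type v} [TopologicalSpace X]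
  [MulAction G X] {A : Set X} (R : RelGCW G A)
  {Z : Type w} [TopologicalSpace Z]

/-- The extension of a homotopy over a cell, by means of the retraction of `D^n × I` to
`(D^n × 0) ∪ (S^(n-1) × I)`. -/
def RelGCW.cellHomotopy (n : ℕ) (f : X → Z) (h : X → C(I, Z)) (i : R.cell n)
    (p : (G ⧸ R.stab n i) × Disk n) (t : I) : Z :=
  if 2 * ‖p.2.1‖ ≤ 2 - (t : ℝ) then f (R.char n i (p.1, bottom p.2 t))
  else h (R.char n i (p.1, radial p.2)) (radialTime p.2 t)

variable {R} {n : ℕ} {f : X → Z} {h : X → C(I, Z)}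

lemma RelGCW.continuous_cellHomotopy (hf : Continuous f) (hh : ContinuousOn h (R.sk n))
    (hfh : ∀ x ∈ R.sk n, h x 0 = f x) (i : R.cell n) :
    Continuous fun q : ((G ⧸ R.stab n i) × Disk n) × I => R.cellHomotopy n f h i q.1 q.2 := by
  have key : ∀ q : ((G ⧸ R.stab n i) × Disk n) × I, 2 - (q.2 : ℝ) ≤ 2 * ‖q.1.2.1‖ →
      R.char n i (q.1.1, radial q.1.2) ∈ R.sk n := fun q hq =>
    R.char_sphere n i _ _ (norm_radial (by linarith [q.2.2.2]))
  have h0 : Continuous fun q : ((G ⧸ R.stab n i) × Disk n) × I =>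
      R.char n i (q.1.1, bottom q.1.2 q.2) :=
    (R.char n i).continuous.comp (continuous_fst.fst.prodMk
      (continuous_bottom continuous_fst.snd continuous_snd))
  have h1 : Continuous fun q : ((G ⧸ R.stab n i) × Disk n) × I =>
      R.char n i (q.1.1, radial q.1.2) :=
    (R.char n i).continuous.comp (continuous_fst.fst.prodMk
      (continuous_radial.comp continuous_fst.snd))
  have h2 : Continuous fun q : ((G ⧸ R.stab n i) × Disk n) × I => radialTime q.1.2 q.2 :=
    continuous_radialTime continuous_fst.snd continuous_snd
  have h3 : Continuous fun p : C(I, Z) × I => p.1 p.2 := continuous_eval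
  have h4 : ContinuousOn (fun q : ((G ⧸ R.stab n i) × Disk n) × I =>
      h (R.char n i (q.1.1, radial q.1.2))) {q | 2 - (q.2 : ℝ) ≤ 2 * ‖q.1.2.1‖} :=
    hh.comp h1.continuousOn key
  have h5 : ContinuousOn (fun q : ((G ⧸ R.stab n i) × Disk n) × I =>
      h (R.char n i (q.1.1, radial q.1.2)) (radialTime q.1.2 q.2))
      {q | 2 - (q.2 : ℝ) ≤ 2 * ‖q.1.2.1‖} :=
    h3.comp_continuousOn (h4.prodMk h2.continuousOn)
  have h6 : Continuous fun q : ((G ⧸ R.stab n i) × Disk n) × I => 2 * ‖q.1.2.1‖ :=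
    continuous_const.mul (continuous_norm.comp (continuous_subtype_val.comp continuous_fst.snd))
  have h7 : Continuous fun q : ((G ⧸ R.stab n i) × Disk n) × I => 2 - (q.2 : ℝ) :=
    continuous_const.sub (continuous_subtype_val.comp continuous_snd)
  have h8 : ∀ q : ((G ⧸ R.stab n i) × Disk n) × I, 2 * ‖q.1.2.1‖ = 2 - (q.2 : ℝ) →
      f (R.char n i (q.1.1, bottom q.1.2 q.2)) =
        h (R.char n i (q.1.1, radial q.1.2)) (radialTime q.1.2 q.2) := by
    intro q hq
    rw [radialTime_of_eq hq, hfh _ (key q hq.ge), bottom_of_eq hq]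
  have h9 := continuous_if_le h6 h7 (hf.comp h0).continuousOn h5 h8
  exact h9

lemma RelGCW.cellHomotopy_of_norm_eq_one (hfh : ∀ x ∈ R.sk n, h x 0 = f x) (i : R.cell n)
    (p : (G ⧸ R.stab n i) × Disk n) (hp : ‖p.2.1‖ = 1) (t : I) :
    R.cellHomotopy n f h i p t = h (R.char n i p) t := by
  rw [cellHomotopy]
  split_ifs with h1
  · have ht : t = 0 := by
      refine Subtype.ext (le_antisymm ?_ t.2.1)
      rw [hp] at h1
      change (t : ℝ) ≤ 0
      linarith
    subst ht
    rw [bottom_zero, hfh _ (R.char_sphere n i _ _ hp)]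
  · rw [radial_of_norm_eq_one hp, radialTime_of_norm_eq_one hp]

lemma RelGCW.cellHomotopy_zero (i : R.cell n) (p : (G ⧸ R.stab n i) × Disk n) :
    R.cellHomotopy n f h i p 0 = f (R.char n i p) := by
  have h1 : ‖p.2.1‖ ≤ 1 := mem_closedBall_zero_iff.1 p.2.2
  rw [cellHomotopy, if_pos, bottom_zero]
  simpa using h1

/-- The extension of a homotopy from `sk n` to `sk (n + 1)`. -/
lemma RelGCW.exists_extension_succ [SMul G Z] {S : Set Z} (hf : Continuous f)
    (hfG : ∀ (a : G) x, f (a • x) = a • f x) (hfS : ∀ x, f x ∈ S)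
    (hh : ContinuousOn h (R.sk n)) (hfh : ∀ x ∈ R.sk n, h x 0 = f x)
    (hG : ∀ (a : G), ∀ x ∈ R.sk n, ∀ t, h (a • x) t = a • h x t)
    (hS : ∀ x ∈ R.sk n, ∀ t, h x t ∈ S) :
    ∃ h' : X → C(I, Z), Set.EqOn h' h (R.sk n) ∧ ContinuousOn h' (R.sk (n + 1)) ∧
      (∀ x ∈ R.sk (n + 1), h' x 0 = f x) ∧
      (∀ (a : G), ∀ x ∈ R.sk (n + 1), ∀ t, h' (a • x) t = a • h' x t) ∧
      ∀ x ∈ R.sk (n + 1), ∀ t, h' x t ∈ S := by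
  classical
  -- Homotopies are treated as maps to `C(I, Z)`, for which continuity may be tested on the cells.
  obtain ⟨c, hc⟩ : ∃ c : ∀ i : R.cell n, C((G ⧸ R.stab n i) × Disk n, C(I, Z)),
      ∀ i p t, c i p t = R.cellHomotopy n f h i p t :=
    ⟨fun i => ContinuousMap.curry ⟨_, RelGCW.continuous_cellHomotopy hf hh hfh i⟩,
      fun _ _ _ => rfl⟩
  have hex : ∀ x, x ∈ R.sk (n + 1) \ R.sk n →
      ∃ z : Σ i : R.cell n, (G ⧸ R.stab n i) × Disk n, ‖z.2.2.1‖ < 1 ∧ R.char n z.1 z.2 = x := by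
    intro x hx
    rw [← R.char_range] at hx
    obtain ⟨i, q, y, hy, rfl⟩ := hx
    exact ⟨⟨i, q, y⟩, hy, rfl⟩
  let h' : X → C(I, Z) := fun x =>
    if hx : x ∈ R.sk (n + 1) \ R.sk n then c (hex x hx).choose.1 (hex x hx).choose.2 else h x
  have h'_old : Set.EqOn h' h (R.sk n) := fun x hx => dif_neg fun h => h.2 hx
  have char_notMem : ∀ i q (y : Disk n), ‖y.1‖ < 1 →
      R.char n i (q, y) ∈ R.sk (n + 1) \ R.sk n := by
    intro i q y hy
    rw [← R.char_range]
    exact ⟨i, q, y, hy, rfl⟩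
  -- On the open cell this is the definition, on its boundary both sides are `h`.
  have h'_char : ∀ i p, h' (R.char n i p) = c i p := by
    rintro i ⟨q, y⟩
    rcases (mem_closedBall_zero_iff.1 y.2).lt_or_eq with hy | hy
    · have hx := char_notMem i q y hy
      obtain ⟨h1, h2⟩ := (hex _ hx).choose_spec
      have h3 := R.char_injective n _ i _ q _ y h1 hy h2
      have h4 : h' (R.char n i (q, y)) = c (hex _ hx).choose.1 (hex _ hx).choose.2 := dif_pos hx
      rw [h4]
      exact congrArg (fun z : Σ i : R.cell n, (G ⧸ R.stab n i) × Disk n => c z.1 z.2) h3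
    · rw [h'_old (R.char_sphere n i q y hy)]
      ext t
      rw [hc]
      exact (RelGCW.cellHomotopy_of_norm_eq_one hfh i (q, y) hy t).symm
  have hcases : ∀ x ∈ R.sk (n + 1), x ∈ R.sk n ∨ ∃ i p, R.char n i p = x := by
    intro x hx
    by_cases hx' : x ∈ R.sk n
    · exact Or.inl hx'
    · obtain ⟨z, -, hz⟩ := hex x ⟨hx, hx'⟩
      exact Or.inr ⟨z.1, z.2, hz⟩
  refine ⟨h', h'_old, ?_, ?_, ?_, ?_⟩
  · rw [continuousOn_iff_continuous_domRestrict]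
    refine continuous_iff_isClosed.2 fun C hC => ?_
    refine R.isClosed_of_char n (h' ⁻¹' C) ?_ fun i => ?_
    · have h1 := (continuousOn_iff_continuous_domRestrict.1 (hh.congr h'_old))
      exact hC.preimage h1
    · have h2 : R.char n i ⁻¹' (h' ⁻¹' C) = c i ⁻¹' C := by
        ext p
        simp only [Set.mem_preimage, h'_char]
      rw [h2]
      exact hC.preimage (c i).continuous
  · intro x hx
    rcases hcases x hx with hx' | ⟨i, p, rfl⟩
    · rw [h'_old hx', hfh x hx']
    · rw [h'_char, hc]
      exact RelGCW.cellHomotopy_zero i p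
  · intro a x hx t
    rcases hcases x hx with hx' | ⟨i, p, rfl⟩
    · rw [h'_old hx', h'_old (R.sk_smul n a x hx'), hG a x hx']
    · rw [← R.char_smul, h'_char, h'_char, hc, hc]
      rw [cellHomotopy, cellHomotopy]
      split_ifs with h1
      · rw [R.char_smul, hfG]
      · rw [R.char_smul, hG]
        exact R.char_sphere n i _ _ (norm_radial (by simp only at h1; linarith [t.2.2]))
  · intro x hx t
    rcases hcases x hx with hx' | ⟨i, p, rfl⟩
    · rw [h'_old hx']
      exact hS x hx' t
    · rw [h'_char, hc, cellHomotopy]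
      split_ifs with h1
      · exact hfS _
      · exact hS _ (R.char_sphere n i _ _ (norm_radial (by linarith [t.2.2]))) _

/-- The equivariant homotopy extension property of relative `G`-CW-complexes, for homotopies of
maps with values in the subset `S` of `Z`. -/
theorem IsRelGCW.exists_extension {A : SubMulAction G X} (hA : IsRelGCW G (A : Set X)) [SMul G Z]
    {S : Set Z} (f : C(X, Z)) (hfG : ∀ (a : G) x, f (a • x) = a • f x) (hfS : ∀ x, f x ∈ S)
    (h : C(A, C(I, Z))) (hfh : ∀ x, h x 0 = f x)
    (hG : ∀ (a : G) x t, h (a • x) t = a • h x t) (hS : ∀ x t, h x t ∈ S) :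
    ∃ H : C(X, C(I, Z)), (∀ x, H x 0 = f x) ∧ (∀ x : A, H x = h x) ∧
      (∀ (a : G) x t, H (a • x) t = a • H x t) ∧ ∀ x t, H x t ∈ S := by
  classical
  obtain ⟨R⟩ := hA
  let Good : ℕ → (X → C(I, Z)) → Prop := fun n h =>
    ContinuousOn h (R.sk n) ∧ (∀ x ∈ R.sk n, h x 0 = f x) ∧
      (∀ (a : G), ∀ x ∈ R.sk n, ∀ t, h (a • x) t = a • h x t) ∧ ∀ x ∈ R.sk n, ∀ t, h x t ∈ S
  let h₀ : X → C(I, Z) := fun x =>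
    if hx : x ∈ A then h ⟨x, hx⟩ else ContinuousMap.const _ (f x)
  have h₀A : ∀ x : A, h₀ x = h x := fun x => dif_pos x.2
  have good₀ : Good 0 h₀ := by
    refine ⟨?_, ?_, ?_, ?_⟩
    · rw [continuousOn_iff_continuous_domRestrict, R.sk_zero]
      exact h.continuous.congr fun x => (h₀A x).symm
    · rw [R.sk_zero]
      intro x hx
      rw [h₀A ⟨x, hx⟩, hfh]
    · rw [R.sk_zero]
      intro a x hx t
      have h1 : h₀ (a • x) = h (a • (⟨x, hx⟩ : A)) := h₀A (a • (⟨x, hx⟩ : A))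
      rw [h1, hG, h₀A ⟨x, hx⟩]
    · rw [R.sk_zero]
      intro x hx t
      rw [h₀A ⟨x, hx⟩]
      exact hS _ t
  have step : ∀ n (g : {g // Good n g}), ∃ g' : {g // Good (n + 1) g}, Set.EqOn g'.1 g.1 (R.sk n) := by
    rintro n ⟨g, h1, h2, h3, h4⟩
    obtain ⟨g', h5, h6⟩ := RelGCW.exists_extension_succ f.continuous hfG hfS h1 h2 h3 h4
    exact ⟨⟨g', h6⟩, h5⟩
  choose next hnext using step
  let s : ∀ n, {g // Good n g} := fun n => Nat.rec ⟨h₀, good₀⟩ (fun n g => next n g) n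
  -- The successive extensions agree where they are defined, so that they have a common limit.
  have hs : ∀ n k, Set.EqOn (s (n + k)).1 (s n).1 (R.sk n) := by
    intro n k
    induction k with
    | zero => exact fun _ _ => rfl
    | succ k ih =>
      intro x hx
      have hx' : x ∈ R.sk (n + k) := monotone_nat_of_le_succ R.sk_mono (Nat.le_add_right n k) hx
      exact (hnext (n + k) (s (n + k)) hx').trans (ih hx)
  have hex : ∀ x, ∃ n, x ∈ R.sk n := fun x => Set.mem_iUnion.1 (R.iUnion_sk.symm ▸ Set.mem_univ x)
  let H : X → C(I, Z) := fun x => (s (Nat.find (hex x))).1 x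
  have hH : ∀ n, Set.EqOn H (s n).1 (R.sk n) := by
    intro n x hx
    obtain ⟨k, hk⟩ := Nat.exists_eq_add_of_le (Nat.find_min' (hex x) hx)
    have h1 := hs (Nat.find (hex x)) k (Nat.find_spec (hex x))
    rw [← hk] at h1
    exact h1.symm
  refine ⟨⟨H, ?_⟩, fun x => ?_, fun x => ?_, fun a x t => ?_, fun x t => ?_⟩
  · refine continuous_iff_isClosed.2 fun C hC => R.isClosed_of_sk _ fun n => ?_
    exact hC.preimage (continuousOn_iff_continuous_domRestrict.1 ((s n).2.1.congr (hH n)))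
  · obtain ⟨n, hn⟩ := hex x
    exact (congrArg (fun g => g 0) (hH n hn)).trans ((s n).2.2.1 x hn)
  · exact (hH 0 (by rw [R.sk_zero]; exact x.2)).trans (h₀A x)
  · obtain ⟨n, hn⟩ := hex x
    refine (congrArg (fun g => g t) (hH n (R.sk_smul n a x hn))).trans
      (((s n).2.2.2.1 a x hn t).trans ?_)
    exact congrArg (fun g => a • g t) (hH n hn).symm
  · obtain ⟨n, hn⟩ := hex x
    change H x t ∈ S
    rw [hH n hn]
    exact (s n).2.2.2.2 x hn t

end HomotopyExtension

/-! ### Equivariant maps relative to a subspace and their homotopy groups -/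

/-- A `G`-space with an invariant base point. -/
class PointedGSpace (G : Type u) [Group G] (W : Type w) [MulAction G W] where
  pt : W
  smul_pt : ∀ a : G, a • pt = pt

/-- An equivariant H-space: a pointed `G`-space with an addition that is continuous in the sense of
k-spaces, and for which the base point is a unit up to equivariant pointed deformations. -/
class EquivariantHSpace (G : Type u) [Group G] (W : Type w) [TopologicalSpace W] [MulAction G W]
    extends PointedGSpace G W where
  add : W → W → W
  kContinuous₂_add : KContinuous₂.{u} add
  smul_add : ∀ (a : G) c d, a • add c d = add (a • c) (a • d)
  rightUnit : W → I → W
  continuous_rightUnit : Continuous fun p : W × I => rightUnit p.1 p.2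
  rightUnit_zero : ∀ c, rightUnit c 0 = c
  rightUnit_one : ∀ c, rightUnit c 1 = add c pt
  rightUnit_pt : ∀ s, rightUnit pt s = pt
  smul_rightUnit : ∀ (a : G) c s, a • rightUnit c s = rightUnit (a • c) s
  leftUnit : W → I → W
  continuous_leftUnit : Continuous fun p : W × I => leftUnit p.1 p.2
  leftUnit_zero : ∀ c, leftUnit c 0 = c
  leftUnit_one : ∀ c, leftUnit c 1 = add pt c
  leftUnit_pt : ∀ s, leftUnit pt s = pt
  smul_leftUnit : ∀ (a : G) c s, a • leftUnit c s = leftUnit (a • c) s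

section RelMap

variable {G : Type u} [Group G] {X : Type v} [TopologicalSpace X] [MulAction G X]

/-- The equivariant maps from `X × K` to a pointed `G`-space `W` that map `A × K` and `X × D` to
the base point. The group `G` acts trivially on `K`. -/
@[ext] structure RelMap (A : SubMulAction G X) (W : Type w) [TopologicalSpace W] [MulAction G W]
    [PointedGSpace G W] {K : Type} [TopologicalSpace K] (D : Set K) where
  toFun : X → K → W
  continuous' : Continuous fun p : X × K => toFun p.1 p.2
  map_smul' : ∀ (a : G) x k, toFun (a • x) k = a • toFun x k
  map_sub' : ∀ x ∈ A, ∀ k, toFun x k = PointedGSpace.pt G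
  map_bd' : ∀ x, ∀ k ∈ D, toFun x k = PointedGSpace.pt G

namespace RelMap

variable {A : SubMulAction G X} {W : Type w} [TopologicalSpace W] [MulAction G W]
  [PointedGSpace G W] {K K' L : Type} [TopologicalSpace K] [TopologicalSpace K']
  [TopologicalSpace L] {D : Set K} {D' : Set K'} {E : Set L}

instance : CoeFun (RelMap A W D) fun _ => X → K → W := ⟨toFun⟩

lemma ext' {f g : RelMap A W D} (h : ∀ x k, f x k = g x k) : f = g :=
  RelMap.ext (funext fun x => funext (h x))

lemma continuous_apply (f : RelMap A W D) {T : Type*} [TopologicalSpace T] {x : T → X} {k : T → K}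
    (hx : Continuous x) (hk : Continuous k) : Continuous fun t => f (x t) (k t) :=
  f.continuous'.comp (hx.prodMk hk)

lemma map_smul (f : RelMap A W D) (a : G) (x : X) (k : K) : f (a • x) k = a • f x k :=
  f.map_smul' a x k

lemma map_sub (f : RelMap A W D) {x : X} (hx : x ∈ A) (k : K) : f x k = PointedGSpace.pt G :=
  f.map_sub' x hx k

lemma map_bd (f : RelMap A W D) (x : X) {k : K} (hk : k ∈ D) : f x k = PointedGSpace.pt G :=
  f.map_bd' x k hk

/-- The precomposition with a map of the parameter spaces. -/
def comp (f : RelMap A W D) (κ : C(K', K)) (hκ : ∀ k ∈ D', κ k ∈ D) : RelMap A W D' where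
  toFun x k := f x (κ k)
  continuous' := f.continuous_apply continuous_fst (κ.continuous.comp continuous_snd)
  map_smul' a x _ := f.map_smul a x _
  map_sub' _ hx _ := f.map_sub hx _
  map_bd' x k hk := f.map_bd x (hκ k hk)

@[simp] lemma comp_apply (f : RelMap A W D) (κ : C(K', K)) (hκ : ∀ k ∈ D', κ k ∈ D) (x : X)
    (k : K') : f.comp κ hκ x k = f x (κ k) := rfl

/-- The trivial map. -/
instance : Zero (RelMap A W D) where
  zero :=
    { toFun := fun _ _ => PointedGSpace.pt G
      continuous' := continuous_const
      map_smul' := fun a _ _ => (PointedGSpace.smul_pt a).symm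
      map_sub' := fun _ _ _ => rfl
      map_bd' := fun _ _ _ => rfl }

@[simp] lemma zero_apply (x : X) (k : K) : (0 : RelMap A W D) x k = PointedGSpace.pt G := rfl

/-- Homotopies relative to `A × K` and `X × D`. -/
def Homotopic (f g : RelMap A W D) : Prop :=
  ∃ H : RelMap A W (Prod.snd ⁻¹' D : Set (I × K)), (∀ x k, H x (0, k) = f x k) ∧
    ∀ x k, H x (1, k) = g x k

/-- The parametrization of the first half of a concatenation. -/
def firstHalf (t : I) : I := Set.projIcc 0 1 zero_le_one (2 * (t : ℝ))

/-- The parametrization of the second half of a concatenation. -/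
def secondHalf (t : I) : I := Set.projIcc 0 1 zero_le_one (2 * (t : ℝ) - 1)

@[fun_prop] lemma continuous_firstHalf : Continuous firstHalf :=
  continuous_projIcc.comp (by fun_prop)

@[fun_prop] lemma continuous_secondHalf : Continuous secondHalf :=
  continuous_projIcc.comp (by fun_prop)

lemma firstHalf_zero : firstHalf 0 = 0 :=
  Set.projIcc_of_le_left _ (by simp)

lemma firstHalf_of_le {t : I} (h : (1 / 2 : ℝ) ≤ t) : firstHalf t = 1 :=
  Set.projIcc_of_right_le _ (by linarith)

lemma secondHalf_one : secondHalf 1 = 1 :=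
  Set.projIcc_of_right_le _ (by norm_num)

lemma secondHalf_of_le {t : I} (h : (t : ℝ) ≤ 1 / 2) : secondHalf t = 0 :=
  Set.projIcc_of_le_left _ (by linarith)

lemma one_not_le_half : ¬ ((1 : I) : ℝ) ≤ 1 / 2 := by norm_num

lemma zero_le_half : ((0 : I) : ℝ) ≤ 1 / 2 := by norm_num

/-- The concatenation of two maps along a face of `I × L`. -/
def concat (f g : RelMap A W (Prod.snd ⁻¹' E : Set (I × L)))
    (h : ∀ x l, f x (1, l) = g x (0, l)) : RelMap A W (Prod.snd ⁻¹' E : Set (I × L)) where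
  toFun x p := if (p.1 : ℝ) ≤ 1 / 2 then f x (firstHalf p.1, p.2) else g x (secondHalf p.1, p.2)
  continuous' := by
    have h1 : Continuous fun q : X × I × L => f q.1 (firstHalf q.2.1, q.2.2) :=
      f.continuous_apply continuous_fst (by fun_prop)
    have h2 : Continuous fun q : X × I × L => g q.1 (secondHalf q.2.1, q.2.2) :=
      g.continuous_apply continuous_fst (by fun_prop)
    have h3 : Continuous fun q : X × I × L => (q.2.1 : ℝ) := by fun_prop
    refine Continuous.if_le h1 h2 h3 continuous_const fun q hq => ?_
    rw [firstHalf_of_le hq.ge, secondHalf_of_le hq.le, h]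
  map_smul' a x p := by
    split_ifs
    · exact f.map_smul _ _ _
    · exact g.map_smul _ _ _
  map_sub' x hx p := by
    rw [f.map_sub hx, g.map_sub hx, ite_self]
  map_bd' x p hp := by
    have h1 : ∀ t, (t, p.2) ∈ (Prod.snd ⁻¹' E : Set (I × L)) := fun t => hp
    rw [f.map_bd x (h1 _), g.map_bd x (h1 _), ite_self]

lemma concat_apply (f g : RelMap A W (Prod.snd ⁻¹' E : Set (I × L)))
    (h : ∀ x l, f x (1, l) = g x (0, l)) (x : X) (p : I × L) : f.concat g h x p =
      if (p.1 : ℝ) ≤ 1 / 2 then f x (firstHalf p.1, p.2) else g x (secondHalf p.1, p.2) := rfl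

lemma concat_zero_left (f g : RelMap A W (Prod.snd ⁻¹' E : Set (I × L)))
    (h : ∀ x l, f x (1, l) = g x (0, l)) (x : X) (l : L) :
    f.concat g h x (0, l) = f x (0, l) := by
  rw [concat_apply, if_pos zero_le_half, firstHalf_zero]

lemma concat_one_left (f g : RelMap A W (Prod.snd ⁻¹' E : Set (I × L)))
    (h : ∀ x l, f x (1, l) = g x (0, l)) (x : X) (l : L) :
    f.concat g h x (1, l) = g x (1, l) := by
  rw [concat_apply, if_neg one_not_le_half, secondHalf_one]

/-- The inversion of the first parameter. -/
def reverse (f : RelMap A W (Prod.snd ⁻¹' E : Set (I × L))) :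
    RelMap A W (Prod.snd ⁻¹' E : Set (I × L)) :=
  f.comp ((⟨unitInterval.symm, unitInterval.continuous_symm⟩ : C(I, I)).prodMap
    (ContinuousMap.id L)) fun _ h => h

@[simp] lemma reverse_apply (f : RelMap A W (Prod.snd ⁻¹' E : Set (I × L))) (x : X) (t : I)
    (l : L) : f.reverse x (t, l) = f x (unitInterval.symm t, l) := rfl

/-- The constant homotopy. -/
def const (f : RelMap A W E) : RelMap A W (Prod.snd ⁻¹' E : Set (I × L)) :=
  f.comp ⟨Prod.snd, continuous_snd⟩ fun _ h => h

/-- Equivariant homotopy relative to `A` and to `D`. -/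
instance setoid : Setoid (RelMap A W D) where
  r := Homotopic
  iseqv :=
    { refl := fun f => ⟨f.const, fun _ _ => rfl, fun _ _ => rfl⟩
      symm := fun ⟨H, h0, h1⟩ => ⟨H.reverse, fun x k => by
        rw [reverse_apply, unitInterval.symm_zero, h1], fun x k => by
        rw [reverse_apply, unitInterval.symm_one, h0]⟩
      trans := fun ⟨H, h0, h1⟩ ⟨H', h0', h1'⟩ =>
        ⟨H.concat H' fun x k => (h1 x k).trans (h0' x k).symm,
          fun x k => (concat_zero_left _ _ _ x k).trans (h0 x k),
          fun x k => (concat_one_left _ _ _ x k).trans (h1' x k)⟩ }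

lemma Homotopic.comp {f g : RelMap A W D} (h : f ≈ g) (κ : C(K', K))
    (hκ : ∀ k ∈ D', κ k ∈ D) : f.comp κ hκ ≈ g.comp κ hκ := by
  obtain ⟨H, h0, h1⟩ := h
  exact ⟨H.comp ((ContinuousMap.id I).prodMap κ) fun p hp => hκ p.2 hp, fun x k => h0 x _,
    fun x k => h1 x _⟩

/-- The boundary of `I × L`, where `E` is the boundary of `L`. -/
def bd (E : Set L) : Set (I × L) := {p | p.1 = 0 ∨ p.1 = 1 ∨ p.2 ∈ E}

omit [TopologicalSpace L] in
lemma zero_mem_bd (l : L) : ((0, l) : I × L) ∈ bd E := Or.inl rfl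

omit [TopologicalSpace L] in
lemma one_mem_bd (l : L) : ((1, l) : I × L) ∈ bd E := Or.inr (Or.inl rfl)

omit [TopologicalSpace L] in
lemma mem_bd_of_snd {p : I × L} (h : p.2 ∈ E) : p ∈ bd E := Or.inr (Or.inr h)

/-- A map that is trivial on the boundary of `I × L`, as a homotopy of maps on `L`. -/
def relax (f : RelMap A W (bd E)) : RelMap A W (Prod.snd ⁻¹' E : Set (I × L)) :=
  f.comp (ContinuousMap.id _) fun _ h => mem_bd_of_snd h

@[simp] lemma relax_apply (f : RelMap A W (bd E)) (x : X) (p : I × L) : f.relax x p = f x p := rfl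

/-- A homotopy between trivial maps on `L`, as a map on `I × L`. -/
def restrain (f : RelMap A W (Prod.snd ⁻¹' E : Set (I × L)))
    (h0 : ∀ x l, f x (0, l) = PointedGSpace.pt G) (h1 : ∀ x l, f x (1, l) = PointedGSpace.pt G) :
    RelMap A W (bd E) where
  toFun := f.toFun
  continuous' := f.continuous'
  map_smul' := f.map_smul'
  map_sub' := f.map_sub'
  map_bd' := by
    rintro x ⟨t, l⟩ (ht | ht | hl)
    · obtain rfl : t = 0 := ht
      exact h0 x l
    · obtain rfl : t = 1 := ht
      exact h1 x l
    · exact f.map_bd x hl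

/-- The concatenation in the first coordinate, which is the loop parameter. -/
instance : Add (RelMap A W (bd E)) where
  add f g := (f.relax.concat g.relax fun x l => by
      rw [relax_apply, relax_apply, f.map_bd x (one_mem_bd l), g.map_bd x (zero_mem_bd l)]).restrain
    (fun x l => by rw [concat_zero_left, relax_apply, f.map_bd x (zero_mem_bd l)])
    (fun x l => by rw [concat_one_left, relax_apply, g.map_bd x (one_mem_bd l)])

lemma add_apply (f g : RelMap A W (bd E)) (x : X) (p : I × L) : (f + g) x p =
    if (p.1 : ℝ) ≤ 1 / 2 then f x (firstHalf p.1, p.2) else g x (secondHalf p.1, p.2) := rfl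

/-- The exchange of the two coordinates of the square. -/
def swap (L : Type) [TopologicalSpace L] : C(I × I × L, I × I × L) :=
  ⟨fun p => (p.2.1, p.1, p.2.2), by fun_prop⟩

/-- The concatenation along the second coordinate of maps on `I × (I × L)`. -/
def innerAdd (f g : RelMap A W (Prod.snd ⁻¹' bd E : Set (I × I × L))) :
    RelMap A W (Prod.snd ⁻¹' bd E : Set (I × I × L)) :=
  (f.comp (swap L) (D' := bd (Prod.snd ⁻¹' E : Set (I × L))) (fun _ h => h) +
    g.comp (swap L) (D' := bd (Prod.snd ⁻¹' E : Set (I × L))) fun _ h => h).comp (swap L)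
    fun _ h => h

lemma innerAdd_apply (f g : RelMap A W (Prod.snd ⁻¹' bd E : Set (I × I × L))) (x : X)
    (p : I × I × L) : f.innerAdd g x p = if (p.2.1 : ℝ) ≤ 1 / 2 then
      f x (p.1, firstHalf p.2.1, p.2.2) else g x (p.1, secondHalf p.2.1, p.2.2) := rfl

lemma Homotopic.add {f f' g g' : RelMap A W (bd E)} (hf : f ≈ f') (hg : g ≈ g') :
    f + g ≈ f' + g' := by
  obtain ⟨H, h0, h1⟩ := hf
  obtain ⟨H', h0', h1'⟩ := hg
  exact ⟨H.innerAdd H', fun x k => if_congr Iff.rfl (h0 x _) (h0' x _),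
    fun x k => if_congr Iff.rfl (h1 x _) (h1' x _)⟩

/-- The change of the loop parameter along a map `φ` of the interval. -/
def reparam (f : RelMap A W (bd E)) (φ : C(I, I)) (h0 : φ 0 = 0 ∨ φ 0 = 1)
    (h1 : φ 1 = 0 ∨ φ 1 = 1) : RelMap A W (bd E) :=
  f.comp (φ.prodMap (ContinuousMap.id L)) (by
    rintro ⟨t, l⟩ (ht | ht | hl)
    · obtain rfl : t = 0 := ht
      exact h0.imp id Or.inl
    · obtain rfl : t = 1 := ht
      exact h1.imp id Or.inl
    · exact mem_bd_of_snd hl)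

lemma Homotopic.reparam {f g : RelMap A W (bd E)} (h : f ≈ g) (φ : C(I, I))
    (h0 : φ 0 = 0 ∨ φ 0 = 1) (h1 : φ 1 = 0 ∨ φ 1 = 1) : f.reparam φ h0 h1 ≈ g.reparam φ h0 h1 := by
  unfold RelMap.reparam
  exact Homotopic.comp h _ _

/-- The point that divides the segment from `a` to `b` in the ratio `s`. -/
def convex (s a b : I) : I :=
  ⟨(1 - s) * a + s * b, by
    have hs := s.2
    have ha := a.2
    have hb := b.2
    constructor
    · exact add_nonneg (mul_nonneg (sub_nonneg.2 hs.2) ha.1) (mul_nonneg hs.1 hb.1)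
    · calc (1 - s : ℝ) * a + s * b ≤ (1 - s) * 1 + s * 1 :=
            add_le_add (mul_le_mul_of_nonneg_left ha.2 (sub_nonneg.2 hs.2))
              (mul_le_mul_of_nonneg_left hb.2 hs.1)
        _ = 1 := by ring⟩

lemma convex_zero (a b : I) : convex 0 a b = a := Subtype.ext (by simp [convex])

lemma convex_one (a b : I) : convex 1 a b = b := Subtype.ext (by simp [convex])

lemma convex_self (s a : I) : convex s a a = a := Subtype.ext (by simp only [convex]; ring)

/-- Two changes of parameter with the same end points are homotopic. -/
lemma reparam_homotopic (f : RelMap A W (bd E)) {φ ψ : C(I, I)} (h0 : φ 0 = 0 ∨ φ 0 = 1)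
    (h1 : φ 1 = 0 ∨ φ 1 = 1) (h0' : ψ 0 = 0 ∨ ψ 0 = 1) (h1' : ψ 1 = 0 ∨ ψ 1 = 1)
    (e0 : φ 0 = ψ 0) (e1 : φ 1 = ψ 1) : f.reparam φ h0 h1 ≈ f.reparam ψ h0' h1' := by
  let κ : C(I × I × L, I × L) := ⟨fun p => (convex p.1 (φ p.2.1) (ψ p.2.1), p.2.2), by
    refine Continuous.prodMk (Continuous.subtype_mk ?_ _) (by fun_prop)
    fun_prop⟩
  refine ⟨f.comp κ ?_, fun x p => ?_, fun x p => ?_⟩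
  · rintro ⟨s, t, l⟩ (ht | ht | hl)
    · obtain rfl : t = 0 := ht
      change convex s (φ 0) (ψ 0) = 0 ∨ convex s (φ 0) (ψ 0) = 1 ∨ _
      rw [← e0, convex_self]
      exact h0.imp id Or.inl
    · obtain rfl : t = 1 := ht
      change convex s (φ 1) (ψ 1) = 0 ∨ convex s (φ 1) (ψ 1) = 1 ∨ _
      rw [← e1, convex_self]
      exact h1.imp id Or.inl
    · exact mem_bd_of_snd hl
  · exact congrArg (fun t => f x (t, p.2)) (convex_zero _ _)
  · exact congrArg (fun t => f x (t, p.2)) (convex_one _ _)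

lemma reparam_id_homotopic (f : RelMap A W (bd E)) {φ : C(I, I)} (h0 : φ 0 = 0) (h1 : φ 1 = 1) :
    f.reparam φ (Or.inl h0) (Or.inr h1) ≈ f :=
  f.reparam_homotopic (ψ := ContinuousMap.id I) _ _ (Or.inl rfl) (Or.inr rfl) h0 h1

lemma reparam_zero_homotopic (f : RelMap A W (bd E)) {φ : C(I, I)} (h0 : φ 0 = 0) (h1 : φ 1 = 0) :
    f.reparam φ (Or.inl h0) (Or.inl h1) ≈ 0 := by
  have h2 : f.reparam (ContinuousMap.const I 0) (Or.inl rfl) (Or.inl rfl) = 0 :=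
    ext' fun x k => f.map_bd x (zero_mem_bd k.2)
  rw [← h2]
  exact f.reparam_homotopic _ _ _ _ h0 h1

lemma add_zero_homotopic (f : RelMap A W (bd E)) : f + 0 ≈ f := by
  let φ : C(I, I) := ⟨firstHalf, continuous_firstHalf⟩
  have h0 : φ 0 = 0 := firstHalf_zero
  have h1 : φ 1 = 1 := firstHalf_of_le (by norm_num)
  have h : f + 0 = f.reparam φ (Or.inl h0) (Or.inr h1) := by
    refine ext' fun x k => ?_
    rw [add_apply]
    split_ifs with h
    · rfl
    · rw [zero_apply]
      change _ = f x (firstHalf k.1, k.2)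
      rw [firstHalf_of_le (not_le.1 h).le, f.map_bd x (one_mem_bd _)]
  rw [h]
  exact f.reparam_id_homotopic h0 h1

lemma zero_add_homotopic (f : RelMap A W (bd E)) : 0 + f ≈ f := by
  let φ : C(I, I) := ⟨secondHalf, continuous_secondHalf⟩
  have h0 : φ 0 = 0 := secondHalf_of_le (by norm_num)
  have h1 : φ 1 = 1 := secondHalf_one
  have h : 0 + f = f.reparam φ (Or.inl h0) (Or.inr h1) := by
    refine ext' fun x k => ?_
    rw [add_apply]
    split_ifs with h
    · rw [zero_apply]
      change _ = f x (secondHalf k.1, k.2)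
      rw [secondHalf_of_le h, f.map_bd x (zero_mem_bd _)]
    · rfl
  rw [h]
  exact f.reparam_id_homotopic h0 h1

/-- The reversal of the first coordinate. -/
instance : Neg (RelMap A W (bd E)) where
  neg f := f.reparam ⟨unitInterval.symm, unitInterval.continuous_symm⟩
    (Or.inr unitInterval.symm_zero) (Or.inl unitInterval.symm_one)

lemma Homotopic.neg {f f' : RelMap A W (bd E)} (hf : f ≈ f') : -f ≈ -f' :=
  Homotopic.reparam hf ⟨unitInterval.symm, unitInterval.continuous_symm⟩
    (Or.inr unitInterval.symm_zero) (Or.inl unitInterval.symm_one)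

/-- The parametrization of a loop followed by its inverse. -/
def goAndReturn : C(I, I) :=
  ⟨fun t => if (t : ℝ) ≤ 1 / 2 then firstHalf t else unitInterval.symm (secondHalf t),
    Continuous.if_le (by fun_prop) (by fun_prop) (by fun_prop) continuous_const fun t ht => by
      rw [firstHalf_of_le ht.ge, secondHalf_of_le ht.le, unitInterval.symm_zero]⟩

lemma add_neg_homotopic (f : RelMap A W (bd E)) : f + -f ≈ 0 := by
  have h0 : goAndReturn 0 = 0 := (if_pos zero_le_half).trans firstHalf_zero
  have h1 : goAndReturn 1 = 0 := (if_neg one_not_le_half).trans (by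
    rw [secondHalf_one, unitInterval.symm_one])
  have h : f + -f = f.reparam goAndReturn (Or.inl h0) (Or.inl h1) := by
    refine ext' fun x k => ?_
    rw [add_apply]
    refine (apply_ite (fun t => f x (t, k.2)) ((k.1 : ℝ) ≤ 1 / 2) (firstHalf k.1)
      (unitInterval.symm (secondHalf k.1))).symm
  rw [h]
  exact f.reparam_zero_homotopic h0 h1

end RelMap
end RelMap

section RelClass

variable {G : Type u} [Group G] {X : Type v} [TopologicalSpace X] [MulAction G X]
  {A : SubMulAction G X} {W : Type w} [TopologicalSpace W] [MulAction G W] [PointedGSpace G W]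
  {L : Type} [TopologicalSpace L] {E : Set L}

/-- The homotopy classes of equivariant maps from `X × (I × L)` to `W` that are trivial on
`A × (I × L)` and on `X × ∂(I × L)`, i.e. of maps from `X × L` to the loop space of `W`. -/
def RelClass (A : SubMulAction G X) (W : Type w) [TopologicalSpace W] [MulAction G W]
    [PointedGSpace G W] (E : Set L) : Type (max v w) :=
  Quotient (RelMap.setoid (A := A) (W := W) (D := RelMap.bd E))

namespace RelClass

/-- The class of a map. -/
def mk (f : RelMap A W (RelMap.bd E)) : RelClass A W E := Quotient.mk _ f

instance : Zero (RelClass A W E) := ⟨mk 0⟩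

instance : Add (RelClass A W E) :=
  ⟨Quotient.map₂ (· + ·) fun _ _ h _ _ h' => RelMap.Homotopic.add h h'⟩

instance : Neg (RelClass A W E) := ⟨Quotient.map (- ·) fun _ _ h => RelMap.Homotopic.neg h⟩

lemma isUnital_add : EckmannHilton.IsUnital (fun a b : RelClass A W E => a + b) 0 where
  left_id := by
    rintro ⟨f⟩
    exact Quotient.sound f.zero_add_homotopic
  right_id := by
    rintro ⟨f⟩
    exact Quotient.sound f.add_zero_homotopic

end RelClass
end RelClass

section HAdd

variable {G : Type u} [Group G] {X : Type v} [TopologicalSpace X] [MulAction G X]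
  [UCompactlyGeneratedSpace.{u} X] {A : SubMulAction G X} {W : Type w} [TopologicalSpace W]
  [MulAction G W] [EquivariantHSpace G W] {K L : Type} [TopologicalSpace K]
  [LocallyCompactSpace K] [T2Space K] {D : Set K} [TopologicalSpace L] [LocallyCompactSpace L]
  [T2Space L] {E : Set L}

open EquivariantHSpace PointedGSpace

lemma EquivariantHSpace.add_pt_pt : add G (pt G : W) (pt G) = pt G := by
  rw [← rightUnit_one, rightUnit_pt]

namespace RelMap

/-- The pointwise sum, with respect to the addition of the H-space. -/
def pointwiseAdd (f g : RelMap A W D) : RelMap A W D where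
  toFun x k := EquivariantHSpace.add G (f x k) (g x k)
  continuous' := by
    have : UCompactlyGeneratedSpace.{u} (X × K) := uCompactlyGeneratedSpace_prod.{v, 0, u}
    exact KContinuous₂.continuous_comp.{u} (EquivariantHSpace.kContinuous₂_add (G := G) (W := W))
      f.continuous' g.continuous'
  map_smul' a x k := by rw [f.map_smul, g.map_smul, EquivariantHSpace.smul_add]
  map_sub' x hx k := by rw [f.map_sub hx, g.map_sub hx, add_pt_pt]
  map_bd' x k hk := by rw [f.map_bd x hk, g.map_bd x hk, add_pt_pt]

lemma Homotopic.pointwiseAdd {f f' g g' : RelMap A W D} (hf : f ≈ f') (hg : g ≈ g') :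
    f.pointwiseAdd g ≈ f'.pointwiseAdd g' := by
  obtain ⟨H, h0, h1⟩ := hf
  obtain ⟨H', h0', h1'⟩ := hg
  exact ⟨H.pointwiseAdd H', fun x k => congrArg₂ (EquivariantHSpace.add G) (h0 x k) (h0' x k),
    fun x k => congrArg₂ (EquivariantHSpace.add G) (h1 x k) (h1' x k)⟩

omit [UCompactlyGeneratedSpace.{u} X] [LocallyCompactSpace K] [T2Space K] in
/-- The homotopy that an equivariant pointed deformation of `W` induces. -/
lemma exists_deform (d : W → I → W) (hd : Continuous fun p : W × I => d p.1 p.2)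
    (hpt : ∀ s, d (pt G) s = pt G) (hG : ∀ (a : G) c s, a • d c s = d (a • c) s)
    (f : RelMap A W D) :
    ∃ H : RelMap A W (Prod.snd ⁻¹' D : Set (I × K)), ∀ x s k, H x (s, k) = d (f x k) s :=
  ⟨{toFun := fun x p => d (f x p.2) p.1
    continuous' := hd.comp ((f.continuous_apply continuous_fst (by fun_prop)).prodMk (by fun_prop))
    map_smul' := fun a x p => by rw [f.map_smul, hG]
    map_sub' := fun x hx p => by rw [f.map_sub hx, hpt]
    map_bd' := fun x p hp => by rw [f.map_bd x hp, hpt] }, fun _ _ _ => rfl⟩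

lemma pointwiseAdd_zero_homotopic (f : RelMap A W D) : f.pointwiseAdd 0 ≈ f := by
  obtain ⟨H, hH⟩ := exists_deform (rightUnit G) continuous_rightUnit rightUnit_pt
    smul_rightUnit f
  exact Setoid.symm ⟨H, fun x k => (hH x 0 k).trans (rightUnit_zero _),
    fun x k => (hH x 1 k).trans (rightUnit_one _)⟩

lemma zero_pointwiseAdd_homotopic (f : RelMap A W D) : (0 : RelMap A W D).pointwiseAdd f ≈ f := by
  obtain ⟨H, hH⟩ := exists_deform (leftUnit G) continuous_leftUnit leftUnit_pt
    smul_leftUnit f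
  exact Setoid.symm ⟨H, fun x k => (hH x 0 k).trans (leftUnit_zero _),
    fun x k => (hH x 1 k).trans (leftUnit_one _)⟩

lemma pointwiseAdd_add (a b c d : RelMap A W (bd E)) :
    (a + b).pointwiseAdd (c + d) = a.pointwiseAdd c + b.pointwiseAdd d := by
  refine ext' fun x k => ?_
  change EquivariantHSpace.add G ((a + b) x k) ((c + d) x k) = _
  rw [add_apply, add_apply, add_apply]
  split_ifs <;> rfl

end RelMap

namespace RelClass

/-- The sum of classes that is induced by the addition of the H-space `W`. -/
def pointwiseAdd : RelClass A W E → RelClass A W E → RelClass A W E :=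
  Quotient.map₂ RelMap.pointwiseAdd fun _ _ h _ _ h' => RelMap.Homotopic.pointwiseAdd h h'

lemma isUnital_pointwiseAdd :
    EckmannHilton.IsUnital (pointwiseAdd : RelClass A W E → RelClass A W E → RelClass A W E) 0 where
  left_id := by
    rintro ⟨f⟩
    exact Quotient.sound f.zero_pointwiseAdd_homotopic
  right_id := by
    rintro ⟨f⟩
    exact Quotient.sound f.pointwiseAdd_zero_homotopic

/-- Concatenation of loops is compatible with the pointwise sum, because both sides are computed by
the same case distinction on the loop parameter. -/
lemma interchange (a b c d : RelClass A W E) :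
    (a + b).pointwiseAdd (c + d) = a.pointwiseAdd c + b.pointwiseAdd d := by
  obtain ⟨a⟩ := a
  obtain ⟨b⟩ := b
  obtain ⟨c⟩ := c
  obtain ⟨d⟩ := d
  exact congrArg mk (RelMap.pointwiseAdd_add a b c d)

/-- Concatenation of loops is commutative by the Eckmann-Hilton argument, applied to the
concatenation and to the addition of the H-space. -/
instance : AddCommGroup (RelClass A W E) where
  add_assoc := (EckmannHilton.mul_assoc isUnital_pointwiseAdd isUnital_add interchange).assoc
  zero_add := isUnital_add.left_id
  add_zero := isUnital_add.right_id
  nsmul := nsmulRec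
  zsmul := zsmulRec
  add_comm := (EckmannHilton.mul_comm isUnital_pointwiseAdd isUnital_add interchange).comm
  neg_add_cancel a := by
    rw [(EckmannHilton.mul_comm isUnital_pointwiseAdd isUnital_add interchange).comm]
    obtain ⟨f⟩ := a
    exact Quotient.sound f.add_neg_homotopic

end RelClass
end HAdd

/-! ### Functoriality, homotopy invariance, excision and disjoint unions -/

section Pullback

variable {G : Type u} [Group G] [TopologicalSpace G] {P Q R : GCWPair.{u, v} G}
  {W : Type w} [TopologicalSpace W] [MulAction G W] [PointedGSpace G W]
  {K K' L : Type} [TopologicalSpace K] [TopologicalSpace K'] [TopologicalSpace L]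
  {D : Set K} {D' : Set K'} {E : Set L}

namespace RelMap

/-- The precomposition with a map of pairs. -/
def pullback (f : RelMap Q.A W D) (φ : PairMap P Q) : RelMap P.A W D where
  toFun x k := f (φ.toFun x) k
  continuous' := f.continuous_apply (φ.toFun.continuous.comp continuous_fst) continuous_snd
  map_smul' a x k := by rw [φ.map_smul, f.map_smul]
  map_sub' x hx k := f.map_sub (φ.map_sub x hx) k
  map_bd' x _ hk := f.map_bd (φ.toFun x) hk

lemma Homotopic.pullback {f g : RelMap Q.A W D} (h : f ≈ g) (φ : PairMap P Q) :
    f.pullback φ ≈ g.pullback φ := by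
  obtain ⟨H, h0, h1⟩ := h
  exact ⟨H.pullback φ, fun x k => h0 _ k, fun x k => h1 _ k⟩

lemma pullback_homotopic (f : RelMap Q.A W D) {φ₀ φ₁ : PairMap P Q} (h : φ₀.Homotopic φ₁) :
    f.pullback φ₀ ≈ f.pullback φ₁ := by
  obtain ⟨H⟩ := h
  refine ⟨{
    toFun := fun x p => f (H (p.1, x)) p.2
    continuous' := f.continuous_apply (H.continuous.comp (by fun_prop)) (by fun_prop)
    map_smul' := fun a x p => ?_
    map_sub' := fun x hx p => f.map_sub ((H.prop' p.1).2 x hx) _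
    map_bd' := fun x p hp => f.map_bd _ hp }, fun x k => ?_, fun x k => ?_⟩
  · rw [← f.map_smul]
    exact congrArg (fun y => f y p.2) ((H.prop' p.1).1 a x)
  · exact congrArg (fun y => f y k) (H.map_zero_left x)
  · exact congrArg (fun y => f y k) (H.map_one_left x)

/-- A push-out has the universal property of push-outs for the maps that are trivial on the
subspaces. -/
lemma exists_pullback_eq_of_isPushout [LocallyCompactSpace K] {φ : PairMap P Q} (hφ : φ.IsPushout)
    (g : RelMap P.A W D) : ∃ f : RelMap Q.A W D, f.pullback φ = g := by
  classical
  have hex : ∀ y, y ∉ Q.A → ∃ x, x ∉ P.A ∧ φ.toFun x = y := fun y hy => hφ.bijOn.surjOn hy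
  let f : Q.X → K → W := fun y k =>
    if hy : y ∈ Q.A then PointedGSpace.pt G else g (hex y hy).choose k
  have hfA : ∀ y ∈ Q.A, ∀ k, f y k = PointedGSpace.pt G := fun y hy k => dif_pos hy
  have hf : ∀ x k, f (φ.toFun x) k = g x k := by
    intro x k
    by_cases hx : x ∈ P.A
    · rw [hfA _ (φ.map_sub x hx), g.map_sub hx]
    · have hy : φ.toFun x ∉ Q.A := hφ.bijOn.mapsTo hx
      have h1 : f (φ.toFun x) k = g (hex _ hy).choose k := dif_neg hy
      rw [h1, hφ.bijOn.injOn (hex _ hy).choose_spec.1 hx (hex _ hy).choose_spec.2]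
  have hcases : ∀ y, y ∈ Q.A ∨ ∃ x, φ.toFun x = y := fun y => by
    by_cases hy : y ∈ Q.A
    · exact Or.inl hy
    · obtain ⟨x, -, hx⟩ := hex y hy
      exact Or.inr ⟨x, hx⟩
  have hfK : ∀ y, Continuous (f y) := by
    intro y
    rcases hcases y with hy | ⟨x, rfl⟩
    · rw [funext (hfA y hy)]
      exact continuous_const
    · rw [funext (hf x)]
      exact g.continuous_apply continuous_const continuous_id
  -- As `K` is locally compact, it suffices to glue the curried maps to `C(K, W)`. The map is constant
  -- on `Q.A`.
  have hfc : Continuous fun y => (⟨f y, hfK y⟩ : C(K, W)) := by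
    refine continuous_iff_isClosed.2 fun C hC => hφ.isClosed _ ?_ ?_
    · by_cases h1 : (ContinuousMap.const K (PointedGSpace.pt G : W)) ∈ C
      · convert isClosed_univ
        refine Set.eq_univ_of_forall fun y => ?_
        rw [← show (⟨f y, hfK y⟩ : C(K, W)) = ContinuousMap.const K (PointedGSpace.pt G) from
          ContinuousMap.ext (hfA y y.2)] at h1
        exact h1
      · convert isClosed_empty
        refine Set.eq_empty_of_forall_notMem fun y hy => h1 ?_
        rw [← show (⟨f y, hfK y⟩ : C(K, W)) = ContinuousMap.const K (PointedGSpace.pt G) from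
          ContinuousMap.ext (hfA y y.2)]
        exact hy
    · let g' : C(P.X, C(K, W)) := ContinuousMap.curry ⟨_, g.continuous'⟩
      have h1 : ∀ x, (⟨f (φ.toFun x), hfK _⟩ : C(K, W)) = g' x := fun x =>
        ContinuousMap.ext (hf x)
      have h2 : φ.toFun ⁻¹' ((fun y => (⟨f y, hfK y⟩ : C(K, W))) ⁻¹' C) = g' ⁻¹' C := by
        ext x
        change (⟨f (φ.toFun x), hfK _⟩ : C(K, W)) ∈ C ↔ _
        rw [h1]
        rfl
      rw [h2]
      exact hC.preimage g'.continuous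
  refine ⟨{
    toFun := f
    continuous' := ContinuousMap.continuous_uncurry_of_continuous ⟨_, hfc⟩
    map_smul' := fun a y k => ?_
    map_sub' := hfA
    map_bd' := fun y k hk => ?_ }, ext' hf⟩
  · rcases hcases y with hy | ⟨x, rfl⟩
    · rw [hfA y hy, hfA _ (Q.A.smul_mem a hy), PointedGSpace.smul_pt]
    · rw [← φ.map_smul, hf, hf, g.map_smul]
  · rcases hcases y with hy | ⟨x, rfl⟩
    · exact hfA y hy k
    · rw [hf, g.map_bd x hk]

lemma pullback_injective_of_isPushout {φ : PairMap P Q} (hφ : φ.IsPushout)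
    {f g : RelMap Q.A W D} (h : f.pullback φ = g.pullback φ) : f = g := by
  refine ext' fun y k => ?_
  by_cases hy : y ∈ Q.A
  · rw [f.map_sub hy, g.map_sub hy]
  · obtain ⟨x, -, rfl⟩ := hφ.bijOn.surjOn hy
    exact congrArg (fun f : RelMap P.A W D => f x k) h

/-- A disjoint union has the universal property of coproducts. -/
lemma exists_pullback_eq_of_isDisjointUnion {ι : Type v} {P : ι → GCWPair.{u, v} G}
    {φ : ∀ i, PairMap (P i) Q} (hφ : IsDisjointUnion φ) (g : ∀ i, RelMap (P i).A W D) :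
    ∃ f : RelMap Q.A W D, ∀ i, f.pullback (φ i) = g i := by
  let e := hφ.isHomeomorph.homeomorph
  let f : Q.X → K → W := fun y k => g (e.symm y).1 (e.symm y).2 k
  have hf : ∀ i x k, f ((φ i).toFun x) k = g i x k := by
    intro i x k
    have h1 : e.symm ((φ i).toFun x) = ⟨i, x⟩ := e.symm_apply_apply ⟨i, x⟩
    change g (e.symm ((φ i).toFun x)).1 (e.symm ((φ i).toFun x)).2 k = _
    rw [h1]
  have hcases : ∀ y, ∃ i x, (φ i).toFun x = y := fun y =>
    ⟨(e.symm y).1, (e.symm y).2, e.apply_symm_apply y⟩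
  refine ⟨{
    toFun := f
    continuous' := ?_
    map_smul' := fun a y k => ?_
    map_sub' := fun y hy k => ?_
    map_bd' := fun y k hk => (g _).map_bd _ hk }, fun i => ext' (hf i)⟩
  · have h1 : Continuous fun q : Σ i, (P i).X × K => g q.1 q.2.1 q.2.2 :=
      continuous_sigma fun i => (g i).continuous'
    have h2 : Continuous fun q : (Σ i, (P i).X) × K => g q.1.1 q.1.2 q.2 :=
      h1.comp (Homeomorph.sigmaProdDistrib (X := fun i => (P i).X) (Y := K)).continuous
    exact h2.comp ((e.symm.continuous.comp continuous_fst).prodMk continuous_snd)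
  · obtain ⟨i, x, rfl⟩ := hcases y
    rw [← (φ i).map_smul, hf, hf, (g i).map_smul]
  · obtain ⟨i, x, rfl⟩ := hcases y
    rw [hf, (g i).map_sub ((hφ.mem_iff i x).1 hy)]

lemma pullback_injective_of_isDisjointUnion {ι : Type v} {P : ι → GCWPair.{u, v} G}
    {φ : ∀ i, PairMap (P i) Q} (hφ : IsDisjointUnion φ) {f g : RelMap Q.A W D}
    (h : ∀ i, f.pullback (φ i) = g.pullback (φ i)) : f = g := by
  refine ext' fun y k => ?_
  obtain ⟨⟨i, x⟩, rfl⟩ := hφ.isHomeomorph.surjective y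
  exact congrArg (fun f : RelMap (P i).A W D => f x k) (h i)

end RelMap

namespace RelClass

/-- The map of homotopy classes that is induced by a map of pairs. -/
def res (φ : PairMap P Q) : RelClass Q.A W E → RelClass P.A W E :=
  Quotient.map (fun f => f.pullback φ) fun _ _ h => RelMap.Homotopic.pullback h φ

/-- If maps glue uniquely along a family of maps of pairs, then so do homotopy classes. -/
lemma bijective_res_family {ι : Type*} {P : ι → GCWPair.{u, v} G} (φ : ∀ i, PairMap (P i) Q)
    [LocallyCompactSpace L]
    (h₁ : ∀ {K : Type} [TopologicalSpace K] [LocallyCompactSpace K] {D : Set K}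
      (g : ∀ i, RelMap (P i).A W D), ∃ f : RelMap Q.A W D, ∀ i, f.pullback (φ i) = g i)
    (h₂ : ∀ {f g : RelMap Q.A W (RelMap.bd E)}, (∀ i, f.pullback (φ i) = g.pullback (φ i)) → f = g) :
    Function.Bijective fun (a : RelClass Q.A W E) i => res (φ i) a := by
  constructor
  · rintro ⟨f⟩ ⟨g⟩ hfg
    have h3 : ∀ i, f.pullback (φ i) ≈ g.pullback (φ i) := fun i =>
      Quotient.exact (congrFun hfg i)
    choose H h4 h5 using h3
    obtain ⟨H', hH'⟩ := h₁ H
    have h6 : ∀ i x p, H' ((φ i).toFun x) p = H i x p := fun i x p =>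
      congrArg (fun f : RelMap (P i).A W _ => f x p) (hH' i)
    -- The ends of the glued homotopy are determined by their restrictions.
    let κ : I → C(I × L, I × I × L) := fun s => ⟨fun k => (s, k), by fun_prop⟩
    have h7 : H'.comp (κ 0) (D' := RelMap.bd E) (fun _ h => h) = f :=
      h₂ fun i => RelMap.ext' fun x k => (h6 i x _).trans (h4 i x k)
    have h8 : H'.comp (κ 1) (D' := RelMap.bd E) (fun _ h => h) = g :=
      h₂ fun i => RelMap.ext' fun x k => (h6 i x _).trans (h5 i x k)
    refine Quotient.sound ⟨H', fun x k => ?_, fun x k => ?_⟩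
    · exact congrArg (fun f : RelMap Q.A W _ => f x k) h7
    · exact congrArg (fun f : RelMap Q.A W _ => f x k) h8
  · intro b
    have h3 : ∀ i, ∃ g, mk g = b i := fun i => Quotient.exists_rep (b i)
    choose g hg using h3
    obtain ⟨f, hf⟩ := h₁ g
    refine ⟨mk f, funext fun i => ?_⟩
    rw [← hg i, ← hf i]
    rfl

lemma bijective_res_of_isPushout [LocallyCompactSpace L] {φ : PairMap P Q} (hφ : φ.IsPushout) :
    Function.Bijective (res φ : RelClass Q.A W E → RelClass P.A W E) := by
  have h := bijective_res_family (W := W) (E := E) (fun _ : Unit => φ)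
    (fun g => by
      obtain ⟨f, hf⟩ := RelMap.exists_pullback_eq_of_isPushout hφ (g ())
      exact ⟨f, fun _ => hf⟩)
    fun h => RelMap.pullback_injective_of_isPushout hφ (h ())
  refine ⟨fun a b hab => h.1 (funext fun _ => hab), fun b => ?_⟩
  obtain ⟨a, ha⟩ := h.2 fun _ => b
  exact ⟨a, congrFun ha ()⟩

lemma bijective_res_of_isDisjointUnion [LocallyCompactSpace L] {ι : Type v}
    {P : ι → GCWPair.{u, v} G} {φ : ∀ i, PairMap (P i) Q} (hφ : IsDisjointUnion φ) :
    Function.Bijective fun (a : RelClass Q.A W E) i => res (φ i) a :=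
  bijective_res_family φ (fun g => RelMap.exists_pullback_eq_of_isDisjointUnion hφ g)
    fun h => RelMap.pullback_injective_of_isDisjointUnion hφ h

lemma res_homotopic {φ₀ φ₁ : PairMap P Q} (h : φ₀.Homotopic φ₁) :
    (res φ₀ : RelClass Q.A W E → RelClass P.A W E) = res φ₁ := by
  funext a
  obtain ⟨f⟩ := a
  exact Quotient.sound (f.pullback_homotopic h)

end RelClass
end Pullback

/-! ### The long exact sequence of a pair -/

section LongExactSequence

variable {G : Type u} [Group G] [TopologicalSpace G] {P Q : GCWPair.{u, v} G}
  {W : Type w} [TopologicalSpace W] [MulAction G W] [PointedGSpace G W]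
  {K L : Type} [TopologicalSpace K] [TopologicalSpace L] {D : Set K} {E : Set L}

/-- The map `(X, ∅) → (Y, ∅)` that underlies a map of pairs. -/
def PairMap.abs (φ : PairMap P Q) : PairMap P.abs Q.abs where
  toFun := φ.toFun
  map_smul := φ.map_smul
  map_sub _ h := h.elim

namespace RelMap

/-- The equivariant homotopy extension property, for maps that are trivial on `X × D`. -/
lemma exists_extension [ContinuousConstSMul G W] [LocallyCompactSpace K]
    (f : RelMap P.abs.A W D) (h : RelMap P.sub.A W (Prod.snd ⁻¹' D : Set (I × K)))
    (hfh : ∀ x k, h x (0, k) = f.pullback P.incl x k) :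
    ∃ H : RelMap P.abs.A W (Prod.snd ⁻¹' D : Set (I × K)), (∀ x k, H x (0, k) = f x k) ∧
      ∀ x p, H (P.incl.toFun x) p = h x p := by
  let f' : C(P.X, C(K, W)) := ContinuousMap.curry ⟨_, f.continuous'⟩
  have h1 : Continuous fun q : (P.A × I) × K => h q.1.1 (q.1.2, q.2) :=
    h.continuous_apply (x := fun q : (P.A × I) × K => q.1.1) (by fun_prop) (by fun_prop)
  let h' : C(P.A, C(I, C(K, W))) := ContinuousMap.curry (ContinuousMap.curry ⟨_, h1⟩)
  obtain ⟨H, H0, HA, HG, HS⟩ := IsRelGCW.exists_extension P.isRelGCW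
    (S := {c : C(K, W) | ∀ k ∈ D, c k = PointedGSpace.pt G}) f'
    (fun a x => ContinuousMap.ext fun k => f.map_smul a x k) (fun x k hk => f.map_bd x hk) h'
    (fun x => ContinuousMap.ext fun k => hfh x k)
    (fun a x t => ContinuousMap.ext fun k => h.map_smul a x (t, k))
    fun x t k hk => h.map_bd x hk
  have hc : Continuous fun q : P.X × I × K => H q.1 q.2.1 q.2.2 :=
    ((H.continuous.comp continuous_fst).eval continuous_snd.fst).eval continuous_snd.snd
  refine ⟨{
    toFun := fun x p => H x p.1 p.2
    continuous' := hc
    map_smul' := fun a x p => DFunLike.congr_fun (HG a x p.1) p.2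
    map_sub' := fun x hx => hx.elim
    map_bd' := fun x p hp => HS x p.1 p.2 hp }, fun x k => DFunLike.congr_fun (H0 x) k,
    fun x p => ?_⟩
  exact congrArg (fun c : C(I, C(K, W)) => c p.1 p.2) (HA x)

/-- `ψ` is the image of `φ` under the connecting map: `φ`, considered as a homotopy of maps on `A`,
extends to a homotopy of maps on `X` from the trivial map to `ψ`. -/
def IsDelta (φ : RelMap P.sub.A W (bd D)) (ψ : RelMap P.A W D) : Prop :=
  ∃ H : RelMap P.abs.A W (Prod.snd ⁻¹' D : Set (I × K)),
    (∀ x k, H x (0, k) = PointedGSpace.pt G) ∧ (∀ x k, H x (1, k) = ψ x k) ∧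
      ∀ x p, H (P.incl.toFun x) p = φ x p

/-- The restriction of a homotopy of maps on `X` to a given time, if it is trivial on `A`. -/
def atTime (H : RelMap P.abs.A W (Prod.snd ⁻¹' D : Set (I × K))) (s : I)
    (h : ∀ x k, H (P.incl.toFun x) (s, k) = PointedGSpace.pt G) : RelMap P.A W D where
  toFun x k := H x (s, k)
  continuous' := H.continuous_apply (x := fun q : P.X × K => q.1) continuous_fst (by fun_prop)
  map_smul' a x k := H.map_smul a x _
  map_sub' x hx k := h ⟨x, hx⟩ k
  map_bd' x k hk := H.map_bd x hk

variable [ContinuousConstSMul G W] [LocallyCompactSpace K]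

/-- Existence of the image under the connecting map: the trivial map on `X` is moved along the
homotopy `φ` of its restriction to `A`. -/
lemma exists_isDelta (φ : RelMap P.sub.A W (bd D)) : ∃ ψ : RelMap P.A W D, IsDelta φ ψ := by
  obtain ⟨H, H0, HA⟩ := exists_extension (0 : RelMap P.abs.A W D) φ.relax fun x k =>
    φ.map_bd x (zero_mem_bd k)
  exact ⟨H.atTime 1 fun x k => (HA x _).trans (φ.map_bd x (one_mem_bd k)), H, H0,
    fun _ _ => rfl, HA⟩

omit [ContinuousConstSMul G W] [LocallyCompactSpace K] in
lemma IsDelta.pullback {φ : RelMap Q.sub.A W (bd D)} {ψ : RelMap Q.A W D} (h : IsDelta φ ψ)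
    (f : PairMap P Q) : IsDelta (φ.pullback f.sub) (ψ.pullback f) := by
  obtain ⟨H, H0, H1, HA⟩ := h
  exact ⟨H.pullback f.abs, fun x k => H0 _ k, fun x k => H1 _ k, fun x p => HA (f.sub.toFun x) p⟩

/-- The three sides of a square, except one. -/
def threeSides (t : I) : I × I :=
  (Set.projIcc 0 1 zero_le_one (min (3 * (t : ℝ)) (3 - 3 * t)),
    Set.projIcc 0 1 zero_le_one (2 - 3 * (t : ℝ)))

lemma continuous_threeSides : Continuous threeSides :=
  (continuous_projIcc.comp (by fun_prop)).prodMk (continuous_projIcc.comp (by fun_prop))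

lemma threeSides_zero : threeSides 0 = (0, 1) :=
  Prod.ext (Set.projIcc_of_le_left zero_le_one (by simp)) (Set.projIcc_of_right_le zero_le_one (by simp))

lemma threeSides_one : threeSides 1 = (0, 0) :=
  Prod.ext (Set.projIcc_of_le_left zero_le_one (by norm_num)) (Set.projIcc_of_le_left zero_le_one (by norm_num))

lemma threeSides_cases (t : I) :
    (threeSides t).1 = 1 ∨ (threeSides t).2 = 0 ∨ (threeSides t).2 = 1 := by
  rcases le_total (3 * (t : ℝ)) 1 with h | h
  · exact Or.inr (Or.inr (Set.projIcc_of_right_le zero_le_one (by linarith)))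
  rcases le_total 2 (3 * (t : ℝ)) with h' | h'
  · exact Or.inr (Or.inl (Set.projIcc_of_le_left zero_le_one (by linarith)))
  · exact Or.inl (Set.projIcc_of_right_le zero_le_one (le_min h (by linarith)))

/-- The connecting map maps null-homotopic maps to null-homotopic maps: an extension of a
null-homotopy to `X` is a map on a square, whose values on three sides of the square form a homotopy
relative to `A`. -/
lemma IsDelta.homotopic_zero {φ : RelMap P.sub.A W (bd D)} {ψ : RelMap P.A W D} (h : IsDelta φ ψ)
    (hφ : φ ≈ 0) : ψ ≈ 0 := by
  obtain ⟨H, H0, H1, HA⟩ := h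
  obtain ⟨M, M0, M1⟩ := hφ
  obtain ⟨N, N0, NA⟩ := exists_extension H
    (M.comp (ContinuousMap.id _) (D' := Prod.snd ⁻¹' (Prod.snd ⁻¹' D : Set (I × K)))
      fun _ hp => mem_bd_of_snd hp) fun x k => (M0 x k).trans (HA x k).symm
  -- On `A`, the extension `N` is the null-homotopy `M`, which is trivial on these three sides.
  have hN : ∀ x t k, N (P.incl.toFun x) ((threeSides t).1, (threeSides t).2, k) =
      PointedGSpace.pt G := by
    intro x t k
    rw [NA, comp_apply]
    rcases threeSides_cases t with ht | ht | ht
    · have h1 := M1 x ((threeSides t).2, k)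
      rw [← ht] at h1
      exact h1
    · exact M.map_bd x (Or.inl ht)
    · exact M.map_bd x (Or.inr (Or.inl ht))
  refine ⟨{
    toFun := fun x p => N x ((threeSides p.1).1, (threeSides p.1).2, p.2)
    continuous' := ?_
    map_smul' := fun a x p => N.map_smul a x _
    map_sub' := fun x hx p => hN ⟨x, hx⟩ p.1 p.2
    map_bd' := fun x p hp => N.map_bd x hp }, fun x k => ?_, fun x k => ?_⟩
  · have h1 : Continuous fun q : P.X × I × K => threeSides q.2.1 :=
      continuous_threeSides.comp (by fun_prop)
    exact N.continuous_apply (x := fun q : P.X × I × K => q.1) continuous_fst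
      (h1.fst.prodMk (h1.snd.prodMk (by fun_prop)))
  · refine (congrArg (fun p : I × I => N x (p.1, p.2, k)) threeSides_zero).trans ?_
    exact (N0 x _).trans (H1 x k)
  · refine (congrArg (fun p : I × I => N x (p.1, p.2, k)) threeSides_one).trans ?_
    exact (N0 x _).trans (H0 x k)

/-- Exactness at the maps on `X`. -/
lemma exists_pullback_quot_homotopic {f : RelMap P.abs.A W D} (hf : f.pullback P.incl ≈ 0) :
    ∃ ψ : RelMap P.A W D, ψ.pullback P.quot ≈ f := by
  obtain ⟨M, M0, M1⟩ := hf
  obtain ⟨H, H0, HA⟩ := exists_extension f M M0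
  exact ⟨H.atTime 1 fun x k => (HA x _).trans (M1 x k), Setoid.symm ⟨H, H0, fun _ _ => rfl⟩⟩

omit [ContinuousConstSMul G W] [LocallyCompactSpace K] in
lemma pullback_quot_pullback_incl (ψ : RelMap P.A W D) :
    (ψ.pullback P.quot).pullback P.incl = 0 :=
  ext' fun x k => ψ.map_sub x.2 k

omit [ContinuousConstSMul G W] [LocallyCompactSpace K] in
/-- Exactness at the maps on `A`. -/
lemma IsDelta.exists_pullback_incl_homotopic {φ : RelMap P.sub.A W (bd D)} {ψ : RelMap P.A W D}
    (h : IsDelta φ ψ) (hψ : ψ ≈ 0) :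
    ∃ f : RelMap P.abs.A W (bd D), f.pullback P.incl ≈ φ := by
  obtain ⟨H, H0, H1, HA⟩ := h
  obtain ⟨M, M0, M1⟩ := hψ
  have h1 : ∀ x k, H x (1, k) = M.pullback P.quot x (0, k) := fun x k =>
    (H1 x k).trans (M0 x k).symm
  refine ⟨(H.concat (M.pullback P.quot) h1).restrain (fun x k => ?_) fun x k => ?_, ?_⟩
  · exact (concat_zero_left _ _ _ x k).trans (H0 x k)
  · exact (concat_one_left _ _ _ x k).trans (M1 x k)
  -- On `A`, the null-homotopy of `ψ` is trivial.
  · have h2 : (((H.concat (M.pullback P.quot) h1).restrain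
        (fun x k => (concat_zero_left _ _ _ x k).trans (H0 x k))
        fun x k => (concat_one_left _ _ _ x k).trans (M1 x k)).pullback P.incl) = φ + 0 :=
      ext' fun x p => if_congr Iff.rfl (HA x _) (M.map_sub x.2 _)
    rw [h2]
    exact φ.add_zero_homotopic

omit [ContinuousConstSMul G W] [LocallyCompactSpace K] in
lemma isDelta_pullback_incl (f : RelMap P.abs.A W (bd D)) :
    IsDelta (f.pullback P.incl) (0 : RelMap P.A W D) :=
  ⟨f.relax, fun x k => f.map_bd x (zero_mem_bd k), fun x k => f.map_bd x (one_mem_bd k),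
    fun _ _ => rfl⟩

omit [ContinuousConstSMul G W] [LocallyCompactSpace K] in
/-- Exactness at the maps on `(X, A)`. -/
lemma exists_isDelta_of_pullback_quot {ψ : RelMap P.A W D} (hψ : ψ.pullback P.quot ≈ 0) :
    ∃ φ, IsDelta φ ψ := by
  obtain ⟨H, H0, H1⟩ := Setoid.symm hψ
  exact ⟨(H.pullback P.incl).restrain (fun x k => H0 _ k)
    fun x k => (H1 _ k).trans (ψ.map_sub x.2 k), H, H0, H1, fun _ _ => rfl⟩

omit [ContinuousConstSMul G W] [LocallyCompactSpace K] in
lemma IsDelta.pullback_quot {φ : RelMap P.sub.A W (bd D)} {ψ : RelMap P.A W D} (h : IsDelta φ ψ) :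
    ψ.pullback P.quot ≈ 0 := by
  obtain ⟨H, H0, H1, -⟩ := h
  exact Setoid.symm ⟨H, H0, H1⟩

omit [ContinuousConstSMul G W] [LocallyCompactSpace K] in
/-- The connecting relation is additive for concatenation in the second coordinate, the one that is
not used as the time of the homotopy. -/
lemma IsDelta.add {φ φ' φ'' : RelMap P.sub.A W (bd (bd E))} {ψ ψ' : RelMap P.A W (bd E)}
    (h : IsDelta φ ψ) (h' : IsDelta φ' ψ')
    (hφ : ∀ x s t l, φ'' x (s, t, l) =
      if (t : ℝ) ≤ 1 / 2 then φ x (s, firstHalf t, l) else φ' x (s, secondHalf t, l)) :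
    IsDelta φ'' (ψ + ψ') := by
  obtain ⟨H, H0, H1, HA⟩ := h
  obtain ⟨H', H0', H1', HA'⟩ := h'
  refine ⟨H.innerAdd H', fun x k => ?_, fun x k => ?_, fun x p => ?_⟩
  · rw [innerAdd_apply, H0, H0', ite_self]
  · exact if_congr Iff.rfl (H1 x _) (H1' x _)
  · exact (if_congr Iff.rfl (HA x _) (HA' x _)).trans (hφ x p.1 p.2.1 p.2.2).symm

end RelMap
end LongExactSequence

section Connecting

variable {G : Type u} [Group G] [TopologicalSpace G] {P Q : GCWPair.{u, v} G}
  {W : Type w} [TopologicalSpace W] [MulAction G W]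
  {L L' : Type} [TopologicalSpace L] [TopologicalSpace L'] {E : Set L} {E' : Set L'}

namespace RelMap

variable [PointedGSpace G W]

/-- The exchange of the two coordinates of a map on `I × (I × L)`. -/
def exchange {X : Type v} [TopologicalSpace X] [MulAction G X] {A : SubMulAction G X}
    (f : RelMap A W (bd (bd E))) : RelMap A W (bd (bd E)) :=
  f.comp (swap L) (by
    rintro p (h | h | h | h | h)
    · exact Or.inr (Or.inr (Or.inl h))
    · exact Or.inr (Or.inr (Or.inr (Or.inl h)))
    · exact Or.inl h
    · exact Or.inr (Or.inl h)
    · exact mem_bd_of_snd (mem_bd_of_snd h))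

omit [TopologicalSpace G] in
lemma Homotopic.exchange {X : Type v} [TopologicalSpace X] [MulAction G X] {A : SubMulAction G X}
    {f g : RelMap A W (bd (bd E))} (h : f ≈ g) : f.exchange ≈ g.exchange := by
  unfold RelMap.exchange
  exact Homotopic.comp h _ _

lemma IsDelta.exchange_add {φ φ' : RelMap P.sub.A W (bd (bd E))} {ψ ψ' : RelMap P.A W (bd E)}
    (h : IsDelta φ.exchange ψ) (h' : IsDelta φ'.exchange ψ') :
    IsDelta (φ + φ').exchange (ψ + ψ') :=
  h.add h' fun _ _ _ _ => rfl

lemma IsDelta.exchange_neg {φ : RelMap P.sub.A W (bd (bd E))} {ψ : RelMap P.A W (bd E)}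
    (h : IsDelta φ.exchange ψ) : IsDelta (-φ).exchange (-ψ) := by
  obtain ⟨H, H0, H1, HA⟩ := h
  let κ : C(I × I × L, I × I × L) := ⟨fun p => (p.1, unitInterval.symm p.2.1, p.2.2), by fun_prop⟩
  refine ⟨H.comp κ ?_, fun x k => H0 x _, fun x k => H1 x _, fun x p => HA x _⟩
  rintro ⟨s, t, l⟩ (h | h | h)
  · obtain rfl : t = 0 := h
    exact Or.inr (Or.inl unitInterval.symm_zero)
  · obtain rfl : t = 1 := h
    exact Or.inl unitInterval.symm_one
  · exact mem_bd_of_snd h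

end RelMap

namespace RelClass

section ChangeParam

variable [PointedGSpace G W] {X : Type v} [TopologicalSpace X] [MulAction G X]
  {A : SubMulAction G X}

/-- The change of the parameter space. -/
def changeParam (κ : C(L', L)) (hκ : ∀ l ∈ E', κ l ∈ E) : RelClass A W E → RelClass A W E' :=
  Quotient.map (fun f => f.comp ((ContinuousMap.id I).prodMap κ) fun p hp =>
    hp.imp id (Or.imp id (hκ p.2))) fun _ _ h => RelMap.Homotopic.comp h _ _

omit [TopologicalSpace G] in
lemma changeParam_add (κ : C(L', L)) (hκ : ∀ l ∈ E', κ l ∈ E) (a b : RelClass A W E) :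
    changeParam κ hκ (a + b) = changeParam κ hκ a + changeParam κ hκ b := by
  obtain ⟨f⟩ := a
  obtain ⟨g⟩ := b
  rfl

omit [TopologicalSpace G] in
lemma changeParam_changeParam {κ : C(L', L)} {hκ : ∀ l ∈ E', κ l ∈ E} {κ' : C(L, L')}
    {hκ' : ∀ l ∈ E, κ' l ∈ E'} (h : ∀ l, κ (κ' l) = l) (a : RelClass A W E) :
    changeParam κ' hκ' (changeParam κ hκ a) = a := by
  obtain ⟨f⟩ := a
  refine congrArg mk (RelMap.ext' fun x p => ?_)
  exact congrArg (fun l => f x (p.1, l)) (h p.2)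

lemma changeParam_res (κ : C(L', L)) (hκ : ∀ l ∈ E', κ l ∈ E) (φ : PairMap P Q)
    (a : RelClass Q.A W E) : changeParam κ hκ (res φ a) = res φ (changeParam κ hκ a) := by
  obtain ⟨f⟩ := a
  rfl

end ChangeParam

lemma res_add [PointedGSpace G W] (φ : PairMap P Q) (a b : RelClass Q.A W E) :
    res φ (a + b) = res φ a + res φ b := by
  obtain ⟨f⟩ := a
  obtain ⟨g⟩ := b
  rfl

variable [ContinuousConstSMul G W] [IsTopologicalGroup G] [LocallyCompactSpace G]
  [T2Space G] [EquivariantHSpace G W] [LocallyCompactSpace L] [T2Space L]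

instance : UCompactlyGeneratedSpace.{u} P.X := P.isGCW.uCompactlyGeneratedSpace

omit [ContinuousConstSMul G W] [IsTopologicalGroup G] [LocallyCompactSpace G] [T2Space G]
  [LocallyCompactSpace L] [T2Space L] in
lemma mk_eq_zero {f : RelMap P.A W (RelMap.bd E)} : mk f = 0 ↔ f ≈ 0 := Quotient.eq

/-- The connecting map is well defined: as the relation is additive, this reduces to null-homotopic
maps. -/
lemma mk_eq_mk_of_isDelta {φ φ' : RelMap P.sub.A W (RelMap.bd (RelMap.bd E))}
    {ψ ψ' : RelMap P.A W (RelMap.bd E)} (h : RelMap.IsDelta φ.exchange ψ)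
    (h' : RelMap.IsDelta φ'.exchange ψ') (hφ : φ ≈ φ') : mk ψ = mk ψ' := by
  -- The difference is null-homotopic, and so is its image.
  have h1 : φ + -φ' ≈ 0 :=
    Setoid.trans (RelMap.Homotopic.add hφ (Setoid.refl _)) φ'.add_neg_homotopic
  have h2 := (h.exchange_add h'.exchange_neg).homotopic_zero (RelMap.Homotopic.exchange h1)
  rw [← sub_eq_zero, sub_eq_add_neg]
  exact Quotient.sound h2

variable (P W E) in
/-- The connecting map of the long exact sequence. -/
def delta : RelClass P.sub.A W (RelMap.bd E) → RelClass P.A W E :=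
  Quotient.lift (fun φ => mk (RelMap.exists_isDelta (RelMap.exchange φ)).choose) fun φ φ' h =>
    mk_eq_mk_of_isDelta (RelMap.exists_isDelta φ.exchange).choose_spec
      (RelMap.exists_isDelta φ'.exchange).choose_spec h

lemma delta_mk {φ : RelMap P.sub.A W (RelMap.bd (RelMap.bd E))} {ψ : RelMap P.A W (RelMap.bd E)}
    (h : RelMap.IsDelta φ.exchange ψ) : delta P W E (mk φ) = mk ψ :=
  mk_eq_mk_of_isDelta (RelMap.exists_isDelta φ.exchange).choose_spec h (Setoid.refl _)

lemma exists_delta_mk (φ : RelMap P.sub.A W (RelMap.bd (RelMap.bd E))) :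
    ∃ ψ, RelMap.IsDelta φ.exchange ψ ∧ delta P W E (mk φ) = mk ψ := by
  obtain ⟨ψ, h⟩ := RelMap.exists_isDelta φ.exchange
  exact ⟨ψ, h, delta_mk h⟩

lemma delta_add (a b : RelClass P.sub.A W (RelMap.bd E)) :
    delta P W E (a + b) = delta P W E a + delta P W E b := by
  obtain ⟨φ⟩ := a
  obtain ⟨φ'⟩ := b
  obtain ⟨ψ, h, e⟩ := exists_delta_mk φ
  obtain ⟨ψ', h', e'⟩ := exists_delta_mk φ'
  exact (delta_mk (h.exchange_add h')).trans (congrArg₂ (· + ·) e e').symm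

lemma delta_res (f : PairMap P Q) (b : RelClass Q.sub.A W (RelMap.bd E)) :
    delta P W E (res f.sub b) = res f (delta Q W E b) := by
  obtain ⟨φ⟩ := b
  obtain ⟨ψ, h, e⟩ := exists_delta_mk φ
  exact (delta_mk (φ := φ.pullback f.sub) (h.pullback f)).trans (congrArg (res f) e).symm

omit [IsTopologicalGroup G] [LocallyCompactSpace G] [T2Space G] [T2Space L] in
lemma exact_res_quot_res_incl : Function.Exact
    (res P.quot : RelClass P.A W E → _) (res P.incl : RelClass P.abs.A W E → _) := by
  rintro ⟨f⟩
  constructor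
  · intro hf
    obtain ⟨ψ, h⟩ := RelMap.exists_pullback_quot_homotopic (mk_eq_zero.1 hf)
    exact ⟨mk ψ, Quotient.sound h⟩
  · rintro ⟨⟨ψ⟩, h⟩
    refine (congrArg (res P.incl) h).symm.trans ?_
    exact congrArg mk ψ.pullback_quot_pullback_incl

lemma exact_res_incl_delta : Function.Exact
    (res P.incl : RelClass P.abs.A W (RelMap.bd E) → _) (delta P W E) := by
  rintro ⟨φ⟩
  constructor
  · intro hφ
    obtain ⟨ψ, h, e⟩ := exists_delta_mk φ
    obtain ⟨f, hf⟩ := h.exists_pullback_incl_homotopic (mk_eq_zero.1 (e.symm.trans hφ))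
    exact ⟨mk f.exchange, Quotient.sound (RelMap.Homotopic.exchange hf)⟩
  · rintro ⟨⟨f⟩, h⟩
    refine (congrArg (delta P W E) h).symm.trans ?_
    exact delta_mk (RelMap.isDelta_pullback_incl f.exchange)

lemma exact_delta_res_quot : Function.Exact (delta P W E) (res P.quot : RelClass P.A W E → _) := by
  rintro ⟨ψ⟩
  constructor
  · intro hψ
    obtain ⟨φ, h⟩ := RelMap.exists_isDelta_of_pullback_quot (mk_eq_zero.1 hψ)
    exact ⟨mk φ.exchange, delta_mk h⟩
  · rintro ⟨⟨φ⟩, hφ⟩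
    obtain ⟨ψ', h, e⟩ := exists_delta_mk φ
    refine (congrArg (res P.quot) (hφ.symm.trans e)).trans ?_
    exact mk_eq_zero.2 h.pullback_quot

end RelClass

/-- The boundary of the cube. -/
def cubeBoundary (n : ℕ) : Set (Fin n → I) := {c | ∃ k, c k = 0 ∨ c k = 1}

/-- The product of the interval with a cube, as a cube. -/
def consCube (n : ℕ) : C(I × (Fin n → I), Fin (n + 1) → I) :=
  ⟨fun p => Fin.cons p.1 p.2, continuous_pi fun k => by
    refine Fin.cases ?_ (fun k => ?_) k
    · exact continuous_fst
    · exact (continuous_apply k).comp continuous_snd⟩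

/-- The decomposition of a cube as a product of the interval with a cube. -/
def splitCube (n : ℕ) : C(Fin (n + 1) → I, I × (Fin n → I)) :=
  ⟨fun c => (c 0, fun k => c k.succ), by fun_prop⟩

lemma consCube_splitCube (n : ℕ) (c : Fin (n + 1) → I) : consCube n (splitCube n c) = c :=
  Fin.cons_self_tail c

lemma splitCube_consCube (n : ℕ) (p : I × (Fin n → I)) : splitCube n (consCube n p) = p := rfl

lemma consCube_mem (n : ℕ) : ∀ p ∈ RelMap.bd (cubeBoundary n), consCube n p ∈ cubeBoundary (n + 1) := by
  rintro p (h | h | ⟨k, h⟩)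
  · exact ⟨0, Or.inl h⟩
  · exact ⟨0, Or.inr h⟩
  · exact ⟨k.succ, h⟩

lemma splitCube_mem (n : ℕ) :
    ∀ c ∈ cubeBoundary (n + 1), splitCube n c ∈ RelMap.bd (cubeBoundary n) := by
  rintro c ⟨k, h⟩
  induction k using Fin.cases with
  | zero => exact h.imp id Or.inl
  | succ k => exact Or.inr (Or.inr ⟨k, h⟩)

/-- The homotopy classes of equivariant maps to an equivariant H-space form a good cohomology
theory. -/
theorem isGoodCohomologyTheory_relClass [IsTopologicalGroup G] [LocallyCompactSpace G] [T2Space G]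
    [EquivariantHSpace G W] [ContinuousConstSMul G W] :
    IsGoodCohomologyTheory (fun n (P : GCWPair.{u, v} G) => RelClass P.A W (cubeBoundary n))
      (fun _ _ _ f => RelClass.res f) where
  res_add _ _ _ f a b := RelClass.res_add f a b
  res_id _ _ a := by
    obtain ⟨f⟩ := a
    rfl
  res_comp _ _ _ _ g f a := by
    obtain ⟨φ⟩ := a
    rfl
  homotopy _ _ _ _ _ h := RelClass.res_homotopic h
  excision _ _ _ _ h := RelClass.bijective_res_of_isPushout h
  disjoint_union _ _ _ _ _ h := RelClass.bijective_res_of_isDisjointUnion h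
  exact_seq := by
    refine ⟨fun n P => AddMonoidHom.mk' (fun b => RelClass.delta P W (cubeBoundary n)
      (RelClass.changeParam (consCube n) (consCube_mem n) b)) fun a b => ?_, fun n P Q f b => ?_,
      fun n P => ⟨RelClass.exact_res_quot_res_incl, fun b => ?_, fun a => ?_⟩⟩
    · rw [RelClass.changeParam_add, RelClass.delta_add]
    · change RelClass.delta P W _ (RelClass.changeParam _ _ (RelClass.res f.sub b)) = _
      rw [RelClass.changeParam_res, RelClass.delta_res]
      rfl
    · refine (RelClass.exact_res_incl_delta _).trans ⟨?_, ?_⟩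
      · rintro ⟨a, ha⟩
        refine ⟨RelClass.changeParam (splitCube n) (splitCube_mem n) a, ?_⟩
        rw [← RelClass.changeParam_res, ha]
        exact RelClass.changeParam_changeParam (consCube_splitCube n) b
      · rintro ⟨a, rfl⟩
        exact ⟨RelClass.changeParam (consCube n) (consCube_mem n) a,
          (RelClass.changeParam_res _ _ _ _).symm⟩
    · refine (RelClass.exact_delta_res_quot a).trans ⟨?_, ?_⟩
      · rintro ⟨b, rfl⟩
        exact ⟨RelClass.changeParam (splitCube n) (splitCube_mem n) b,
          congrArg (RelClass.delta P W _) (RelClass.changeParam_changeParam (splitCube_consCube n) b)⟩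
      · rintro ⟨b, rfl⟩
        exact ⟨_, rfl⟩

end Connecting

/-! ### Maps to the loop space -/

section Adjunction

variable {F : Type w} [RCLike F] {G : Type u} [Group G] [TopologicalSpace G]
  [IsTopologicalGroup G]

instance : PointedGSpace G (BVec F G) := ⟨BVec.base F G, BVec.smul_base⟩

instance : ContinuousConstSMul G (BVec F G) := ⟨BVec.continuous_smul⟩

/-- The classifying space is an H-space by direct sums, whose units are the changes of labels to the
even and to the odd numbers. -/
instance [LocallyCompactSpace G] [T2Space G] : EquivariantHSpace G (BVec F G) where
  add := BVec.add
  kContinuous₂_add := BVec.kContinuous₂_add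
  smul_add := BVec.smul_add
  rightUnit := BVec.deform evenEmb
  continuous_rightUnit := BVec.continuous_deform evenEmb
  rightUnit_zero := BVec.deform_zero evenEmb
  rightUnit_one c := (BVec.add_base c).symm
  rightUnit_pt := BVec.deform_base evenEmb
  smul_rightUnit := BVec.smul_deform evenEmb
  leftUnit := BVec.deform oddEmb
  continuous_leftUnit := BVec.continuous_deform oddEmb
  leftUnit_zero := BVec.deform_zero oddEmb
  leftUnit_one c := (BVec.base_add c).symm
  leftUnit_pt := BVec.deform_base oddEmb
  smul_leftUnit := BVec.smul_deform oddEmb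

omit [Group G] [IsTopologicalGroup G] in
lemma KSpace.continuous_loop_apply {T : Type*} [TopologicalSpace T] {x : T → KSpace F G} {t : T → I}
    (hx : Continuous x) (ht : Continuous t) : Continuous fun q => (x q).loop (t q) := by
  have h0 := continuous_compactlyGenerated_id.{max u w}
    (tY := TopologicalSpace.induced (KSpace.loop (F := F) (G := G)) inferInstance)
  have h1 := @Continuous.comp T (KSpace F G) (KSpace F G) _ _
    (TopologicalSpace.induced KSpace.loop inferInstance) x id h0 hx
  have h2 : Continuous fun q => (x q).loop := continuous_induced_rng.1 h1
  exact h2.eval ht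

omit [Group G] [IsTopologicalGroup G] in
/-- A map from a compactly generated space to the loop space is continuous if the adjoint map is
continuous. -/
lemma KSpace.continuous_of_loop {T : Type*} [TopologicalSpace T] [UCompactlyGeneratedSpace.{u} T]
    {x : T → KSpace F G} (hx : Continuous fun q : T × I => (x q.1).loop q.2) : Continuous x := by
  refine continuous_to_compactlyGenerated.{_, u, w}
    (tY := TopologicalSpace.induced (KSpace.loop (F := F) (G := G)) inferInstance) ?_
  refine continuous_induced_rng.2 (continuous_induced_rng.2 ?_)
  exact (ContinuousMap.curry ⟨_, hx⟩).continuous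

lemma KSpace.smul_loop (a : G) (x : KSpace F G) (t : I) : (a • x).loop t = a • x.loop t := rfl

omit [Group G] [IsTopologicalGroup G] in
lemma KSpace.ext_loop {x y : KSpace F G} (h : ∀ t, x.loop t = y.loop t) : x = y := by
  obtain ⟨x⟩ := x
  obtain ⟨y⟩ := y
  exact congrArg KSpace.mk (Path.ext (funext h))

variable {P Q : GCWPair.{u, v} G} {n : ℕ}

omit [IsTopologicalGroup G] in
variable (P n) in
/-- The image in the suspension of a point of `X × [0,1]^n`. -/
def suspPoint (x : P.X) (c : Fin n → I) : P.Susp n :=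
  Quot.mk _ (Sum.inl ⟨Quot.mk _ (Sum.inl x), c⟩)

omit [IsTopologicalGroup G] in
lemma continuous_suspPoint : Continuous fun p : P.X × (Fin n → I) => suspPoint P n p.1 p.2 := by
  refine continuous_quot_mk.comp (continuous_inl.comp (continuous_induced_rng.2 ?_))
  exact (continuous_quot_mk.comp (continuous_inl.comp continuous_fst)).prodMk continuous_snd

omit [IsTopologicalGroup G] in
lemma suspPoint_of_mem {x : P.X} (hx : x ∈ P.A) (c : Fin n → I) :
    suspPoint P n x c = P.suspBase n :=
  Quot.sound (CollapseRel.glue _ (Or.inl (Quot.sound (CollapseRel.glue x hx))))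

omit [IsTopologicalGroup G] in
lemma suspPoint_of_mem_boundary (x : P.X) {c : Fin n → I} (hc : c ∈ cubeBoundary n) :
    suspPoint P n x c = P.suspBase n :=
  Quot.sound (CollapseRel.glue _ (Or.inr hc))

omit [IsTopologicalGroup G] in
lemma smul_suspPoint (a : G) (x : P.X) (c : Fin n → I) :
    a • suspPoint P n x c = suspPoint P n (a • x) c := rfl

omit [IsTopologicalGroup G] in
lemma eq_suspPoint_or (y : P.Susp n) : (∃ x c, y = suspPoint P n x c) ∨ y = P.suspBase n := by
  obtain ⟨⟨⟨x | _⟩, c⟩ | _⟩ := y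
  · exact Or.inl ⟨x, c, rfl⟩
  · exact Or.inr (Quot.sound (CollapseRel.glue _ (Or.inl rfl)))
  · exact Or.inr rfl

omit [IsTopologicalGroup G] in
/-- The continuity of a family of maps on the suspension may be checked on `X × [0,1]^n`. -/
lemma continuous_of_suspPoint {M : Type} [TopologicalSpace M] [LocallyCompactSpace M] {Z : Type*}
    [TopologicalSpace Z] {f : P.Susp n → M → Z}
    (h : Continuous fun p : P.X × ((Fin n → I) × M) => f (suspPoint P n p.1 p.2.1) p.2.2)
    (hb : Continuous (f (P.suspBase n))) : Continuous fun p : P.Susp n × M => f p.1 p.2 := by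
  have hM : ∀ y, Continuous (f y) := by
    intro y
    rcases eq_suspPoint_or y with ⟨x, c, rfl⟩ | rfl
    · exact h.comp (continuous_const.prodMk (continuous_const.prodMk continuous_id))
    · exact hb
  suffices h1 : Continuous fun y => (⟨f y, hM y⟩ : C(M, Z)) from
    ContinuousMap.continuous_uncurry_of_continuous ⟨_, h1⟩
  refine isQuotientMap_quot_mk.continuous_iff.2 (continuous_sum_dom.2 ⟨?_, continuous_of_const
    fun _ _ => rfl⟩)
  suffices h2 : Continuous fun p : P.Quotient × (Fin n → I) =>
      (⟨f (Quot.mk _ (Sum.inl ⟨p.1, p.2⟩)), hM _⟩ : C(M, Z)) by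
    have h3 : Continuous fun z : TimesCube n P.Quotient => (z.pt, z.time) := continuous_induced_dom
    exact h2.comp h3
  have h4 : Continuous fun p : P.X × (Fin n → I) =>
      (⟨f (suspPoint P n p.1 p.2), hM _⟩ : C(M, Z)) := by
    have h5 : Continuous fun p : (P.X × (Fin n → I)) × M => f (suspPoint P n p.1.1 p.1.2) p.2 :=
      h.comp (continuous_fst.fst.prodMk (continuous_fst.snd.prodMk continuous_snd))
    exact (ContinuousMap.curry ⟨_, h5⟩).continuous
  have hC : ∀ y : P.Quotient, Continuous fun c : Fin n → I =>
      (⟨f (Quot.mk _ (Sum.inl ⟨y, c⟩)), hM _⟩ : C(M, Z)) := by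
    rintro ⟨x | _⟩
    · exact h4.comp (continuous_const.prodMk continuous_id)
    · refine continuous_of_const fun c c' => ContinuousMap.ext fun m => ?_
      have hb : ∀ c : Fin n → I, (Quot.mk _ (Sum.inl ⟨Collapse.base P.A, c⟩) : P.Susp n) =
          P.suspBase n := fun c => Quot.sound (CollapseRel.glue _ (Or.inl rfl))
      exact congrArg (fun y => f y m) ((hb c).trans (hb c').symm)
  suffices h6 : Continuous fun y : P.Quotient => (⟨_, hC y⟩ : C(Fin n → I, C(M, Z))) from
    ContinuousMap.continuous_uncurry_of_continuous ⟨_, h6⟩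
  refine isQuotientMap_quot_mk.continuous_iff.2 (continuous_sum_dom.2 ⟨?_, continuous_of_const
    fun _ _ => rfl⟩)
  exact (ContinuousMap.curry ⟨_, h4⟩).continuous

/-- The adjoint on `X × (I × [0,1]^n)` of a pointed equivariant map to the loop space. -/
def adjoint (f : {f // IsPointedGMap F P n f}) :
    RelMap P.A (BVec F G) (RelMap.bd (cubeBoundary n)) where
  toFun x p := (f.1 (suspPoint P n x p.2)).loop p.1
  continuous' := KSpace.continuous_loop_apply
    (f.1.continuous.comp (continuous_suspPoint.comp (continuous_fst.prodMk continuous_snd.snd)))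
    continuous_snd.fst
  map_smul' a x p := by rw [← smul_suspPoint, f.2.1, KSpace.smul_loop]
  map_sub' x hx p := by
    rw [suspPoint_of_mem hx, f.2.2]
    rfl
  map_bd' := by
    rintro x ⟨t, c⟩ (h | h | h)
    · obtain rfl : t = 0 := h
      exact Path.source _
    · obtain rfl : t = 1 := h
      exact Path.target _
    · rw [suspPoint_of_mem_boundary x h, f.2.2]
      rfl

/-- The loop that is defined by the values of a map on `I × L`. -/
def RelMap.loopAt {L : Type} [TopologicalSpace L] {E : Set L}
    (g : RelMap P.A (BVec F G) (RelMap.bd E)) (x : P.X) (l : L) : KSpace F G :=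
  ⟨⟨⟨fun t => g x (t, l), g.continuous_apply continuous_const (by fun_prop)⟩,
    g.map_bd x (RelMap.zero_mem_bd l), g.map_bd x (RelMap.one_mem_bd l)⟩⟩

/-- The map from `X/A` to the loop space that is defined by a map on `X × (I × L)`. -/
def quotLift {L : Type} [TopologicalSpace L] {E : Set L}
    (g : RelMap P.A (BVec F G) (RelMap.bd E)) (l : L) : P.Quotient → KSpace F G :=
  Quot.lift (Sum.elim (fun x => g.loopAt x l) fun _ => KSpace.base F G) (by
    rintro _ _ ⟨x, hx⟩
    exact KSpace.ext_loop fun t => g.map_sub hx _)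

lemma quotLift_of_mem {L : Type} [TopologicalSpace L] {E : Set L}
    (g : RelMap P.A (BVec F G) (RelMap.bd E)) {l : L} (hl : l ∈ E) (y : P.Quotient) :
    quotLift g l y = KSpace.base F G := by
  obtain ⟨x | _⟩ := y
  · exact KSpace.ext_loop fun t => g.map_bd x (RelMap.mem_bd_of_snd hl)
  · rfl

/-- The map from the suspension to the loop space that is adjoint to a map on
`X × (I × [0,1]^n)`. -/
def suspLift (g : RelMap P.A (BVec F G) (RelMap.bd (cubeBoundary n))) : P.Susp n → KSpace F G :=
  Quot.lift (Sum.elim (fun z => quotLift g z.time z.pt) fun _ => KSpace.base F G) (by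
    rintro _ _ ⟨z, hz | hz⟩
    · exact congrArg (quotLift g z.time) hz
    · exact quotLift_of_mem g hz z.pt)

lemma suspLift_base (g : RelMap P.A (BVec F G) (RelMap.bd (cubeBoundary n))) :
    suspLift g (P.suspBase n) = KSpace.base F G := rfl

lemma suspLift_smul (g : RelMap P.A (BVec F G) (RelMap.bd (cubeBoundary n))) (a : G)
    (y : P.Susp n) : suspLift g (a • y) = a • suspLift g y := by
  rcases eq_suspPoint_or y with ⟨x, c, rfl⟩ | rfl
  · exact KSpace.ext_loop fun t => g.map_smul a x _
  · exact KSpace.ext_loop fun t => (BVec.smul_base a).symm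

/-- The member of a homotopy at time `s`. -/
def RelMap.slice {K : Type} [TopologicalSpace K] {D : Set K}
    (H : RelMap P.A (BVec F G) (Prod.snd ⁻¹' D : Set (I × K))) (s : I) :
    RelMap P.A (BVec F G) D :=
  H.comp ⟨fun k => (s, k), by fun_prop⟩ fun _ h => h

variable [LocallyCompactSpace G] [T2Space G]

lemma continuous_suspLift_slice
    (H : RelMap P.A (BVec F G) (Prod.snd ⁻¹' RelMap.bd (cubeBoundary n) :
      Set (I × I × (Fin n → I)))) :
    Continuous fun p : P.Susp n × I => suspLift (H.slice p.2) p.1 := by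
  refine continuous_of_suspPoint (f := fun y s => suspLift (H.slice s) y) ?_ continuous_const
  have : UCompactlyGeneratedSpace.{u} (P.X × ((Fin n → I) × I)) :=
    uCompactlyGeneratedSpace_prod.{v, 0, u}
  refine KSpace.continuous_of_loop ?_
  exact H.continuous_apply (x := fun q : (P.X × ((Fin n → I) × I)) × I => q.1.1)
    (k := fun q => (q.1.2.2, q.2, q.1.2.1)) continuous_fst.fst (by fun_prop)

/-- The pointed equivariant map to the loop space that is adjoint to a map on
`X × (I × [0,1]^n)`. -/
def ofAdjoint (g : RelMap P.A (BVec F G) (RelMap.bd (cubeBoundary n))) :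
    {f // IsPointedGMap F P n f} :=
  ⟨⟨suspLift g, (continuous_suspLift_slice g.const).comp
    (continuous_id.prodMk (continuous_const (y := (0 : I))))⟩, suspLift_smul g, suspLift_base g⟩

lemma adjoint_ofAdjoint (g : RelMap P.A (BVec F G) (RelMap.bd (cubeBoundary n))) :
    adjoint (ofAdjoint g) = g := rfl

lemma ofAdjoint_adjoint (f : {f // IsPointedGMap F P n f}) : ofAdjoint (adjoint f) = f := by
  refine Subtype.ext (ContinuousMap.ext fun y => ?_)
  rcases eq_suspPoint_or y with ⟨x, c, rfl⟩ | rfl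
  · rfl
  · exact f.2.2.symm

omit [LocallyCompactSpace G] [T2Space G] in
lemma adjoint_homotopic {f f' : {f // IsPointedGMap F P n f}} (h : f ≈ f') :
    adjoint f ≈ adjoint f' := by
  obtain ⟨H⟩ := h
  refine ⟨{
    toFun := fun x p => (H (p.1, suspPoint P n x p.2.2)).loop p.2.1
    continuous' := KSpace.continuous_loop_apply (H.continuous.comp (continuous_snd.fst.prodMk
      (continuous_suspPoint.comp (continuous_fst.prodMk continuous_snd.snd.snd))))
      continuous_snd.snd.fst
    map_smul' := fun a x p => (adjoint ⟨_, H.prop' p.1⟩).map_smul a x p.2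
    map_sub' := fun x hx p => (adjoint ⟨_, H.prop' p.1⟩).map_sub hx p.2
    map_bd' := fun x p hp => (adjoint ⟨_, H.prop' p.1⟩).map_bd x hp }, fun x k => ?_, fun x k => ?_⟩
  · exact congrArg (fun y : KSpace F G => y.loop k.1) (H.map_zero_left _)
  · exact congrArg (fun y : KSpace F G => y.loop k.1) (H.map_one_left _)

lemma ofAdjoint_homotopic {g g' : RelMap P.A (BVec F G) (RelMap.bd (cubeBoundary n))}
    (h : g ≈ g') : ofAdjoint g ≈ ofAdjoint g' := by
  obtain ⟨H, H0, H1⟩ := h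
  have h0 : H.slice 0 = g := RelMap.ext' H0
  have h1 : H.slice 1 = g' := RelMap.ext' H1
  refine ⟨⟨⟨⟨fun p => suspLift (H.slice p.1) p.2,
    (continuous_suspLift_slice H).comp continuous_swap⟩, fun y => ?_, fun y => ?_⟩, fun s => ?_⟩⟩
  · exact congrArg (fun g => suspLift g y) h0
  · exact congrArg (fun g => suspLift g y) h1
  · exact (ofAdjoint (H.slice s)).2

variable (F P n) in
/-- Adjunction identifies `KF_G^{-n}(X, A)` with the homotopy classes of equivariant maps from
`X × (I × [0,1]^n)` to the classifying space. -/
def KF.equivRelClass : KF F n P ≃ RelClass P.A (BVec F G) (cubeBoundary n) where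
  toFun := Quotient.map adjoint fun _ _ h => adjoint_homotopic h
  invFun := Quotient.map ofAdjoint fun _ _ h => ofAdjoint_homotopic h
  left_inv := by
    rintro ⟨f⟩
    exact congrArg KF.mk (ofAdjoint_adjoint f)
  right_inv := by
    rintro ⟨g⟩
    exact congrArg RelClass.mk (adjoint_ofAdjoint g)

lemma KF.equivRelClass_res (φ : PairMap P Q) (a : KF F n Q) :
    KF.equivRelClass F P n (KF.res n φ a) = RelClass.res φ (KF.equivRelClass F Q n a) := by
  obtain ⟨f⟩ := a
  rfl

/-- The sum of adjoint maps corresponds to the pointwise concatenation of loops. -/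
lemma isConcat_ofAdjoint_add (a b : {f // IsPointedGMap F P n f}) :
    IsConcat a b (ofAdjoint (adjoint a + adjoint b)) := by
  intro y
  rcases eq_suspPoint_or y with ⟨x, c, rfl⟩ | rfl
  · refine Path.ext (funext fun t => ?_)
    rw [Path.trans_apply]
    change (if (t : ℝ) ≤ 1 / 2 then (a.1 (suspPoint P n x c)).loop (RelMap.firstHalf t)
      else (b.1 (suspPoint P n x c)).loop (RelMap.secondHalf t)) = _
    split_ifs with h
    · exact congrArg _ (Set.projIcc_of_mem _ _)
    · exact congrArg _ (Set.projIcc_of_mem _ _)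
  · rw [a.2.2, b.2.2]
    exact (Path.refl_trans_refl).symm

end Adjunction

/-- Good cohomology theories may be transported along natural isomorphisms. -/
lemma IsGoodCohomologyTheory.of_equiv {G : Type u} [Group G] [TopologicalSpace G]
    {h : ℕ → GCWPair.{u, v} G → Type*} [∀ n P, AddCommGroup (h n P)]
    {h' : ℕ → GCWPair.{u, v} G → Type*} [∀ n P, AddCommGroup (h' n P)]
    {res : ∀ (n : ℕ) {P Q : GCWPair.{u, v} G}, PairMap P Q → h n Q → h n P}
    {res' : ∀ (n : ℕ) {P Q : GCWPair.{u, v} G}, PairMap P Q → h' n Q → h' n P}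
    (H : IsGoodCohomologyTheory h res) (e : ∀ n P, h' n P ≃+ h n P)
    (he : ∀ n {P Q : GCWPair.{u, v} G} (f : PairMap P Q) a,
      e n P (res' n f a) = res n f (e n Q a)) : IsGoodCohomologyTheory h' res' := by
  have he' : ∀ n {P Q : GCWPair.{u, v} G} (f : PairMap P Q) a,
      res' n f a = (e n P).symm (res n f (e n Q a)) := fun n P Q f a => by
    rw [← he, AddEquiv.symm_apply_apply]
  refine ⟨fun n P Q f a b => ?_, fun n P a => ?_, fun n P Q R g f a => ?_,
    fun n P Q f₀ f₁ hf => ?_, fun n P Q f hf => ?_, fun n ι P Q f hf => ?_, ?_⟩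
  · rw [he', he', he', map_add, H.res_add, map_add]
  · rw [he', H.res_id, AddEquiv.symm_apply_apply]
  · rw [he', he', he', AddEquiv.apply_symm_apply, H.res_comp]
  · funext a
    rw [he', he', H.homotopy n f₀ f₁ hf]
  · have h1 : res' n f = (e n P).symm ∘ res n f ∘ e n Q := funext fun a => he' n f a
    rw [h1]
    exact (e n P).symm.bijective.comp ((H.excision n f hf).comp (e n Q).bijective)
  · have h1 : (fun (a : h' n Q) i => res' n (f i) a) =
        (Equiv.piCongrRight fun i => (e n (P i)).symm.toEquiv) ∘
          (fun (a : h n Q) i => res n (f i) a) ∘ e n Q :=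
      funext fun a => funext fun i => he' n (f i) a
    rw [h1]
    exact (Equiv.bijective _).comp ((H.disjoint_union n f hf).comp (e n Q).bijective)
  · obtain ⟨δ, hδ, hex⟩ := H.exact_seq
    refine ⟨fun n P => ((e n P).symm.toAddMonoidHom.comp (δ n P)).comp
      (e (n + 1) P.sub).toAddMonoidHom, fun n P Q f b => ?_, fun n P => ⟨fun a => ?_, fun b => ?_,
      fun a => ?_⟩⟩
    · change (e n P).symm (δ n P (e (n + 1) P.sub (res' (n + 1) f.sub b))) =
        res' n f ((e n Q).symm (δ n Q (e (n + 1) Q.sub b)))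
      rw [he, hδ, he', AddEquiv.apply_symm_apply]
    · rw [he', AddEquiv.map_eq_zero_iff, (hex n P).1]
      constructor
      · rintro ⟨c, hc⟩
        exact ⟨(e n P).symm c, by
          rw [he', AddEquiv.apply_symm_apply, hc, AddEquiv.symm_apply_apply]⟩
      · rintro ⟨c, rfl⟩
        exact ⟨e n P c, (he n _ c).symm⟩
    · change (e n P).symm (δ n P (e (n + 1) P.sub b)) = 0 ↔ _
      rw [AddEquiv.map_eq_zero_iff, (hex n P).2.1]
      constructor
      · rintro ⟨c, hc⟩
        exact ⟨(e (n + 1) P.abs).symm c, by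
          rw [he', AddEquiv.apply_symm_apply, hc, AddEquiv.symm_apply_apply]⟩
      · rintro ⟨c, rfl⟩
        exact ⟨e (n + 1) P.abs c, (he (n + 1) _ c).symm⟩
    · rw [he', AddEquiv.map_eq_zero_iff, (hex n P).2.2]
      constructor
      · rintro ⟨c, hc⟩
        refine ⟨(e (n + 1) P.sub).symm c, ?_⟩
        change (e n P).symm (δ n P (e (n + 1) P.sub ((e (n + 1) P.sub).symm c))) = a
        rw [AddEquiv.apply_symm_apply, hc, AddEquiv.symm_apply_apply]
      · rintro ⟨c, rfl⟩
        exact ⟨e (n + 1) P.sub c, ((e n P).apply_symm_apply _).symm⟩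

end EquivKTheory

end

theorem mainTheorem7 {F : Type w} [RCLike F]
    {E : Type*} [NormedAddCommGroup E] [NormedSpace ℝ E] [FiniteDimensional ℝ E]
    {G : Type u} [Group G] [TopologicalSpace G] [IsTopologicalGroup G] [T2Space G]
    [ChartedSpace E G] [LieGroup 𝓘(ℝ, E) ∞ G] :
    ∃ _ : ∀ (n : ℕ) (P : EquivKTheory.GCWPair.{u, v} G), AddCommGroup (EquivKTheory.KF F n P),
      (∀ (n : ℕ) (P : EquivKTheory.GCWPair.{u, v} G)
        (a b : {f // EquivKTheory.IsPointedGMap F P n f}),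
        ∃ c, EquivKTheory.IsConcat a b c ∧
          EquivKTheory.KF.mk a + EquivKTheory.KF.mk b = EquivKTheory.KF.mk c) ∧
      EquivKTheory.IsGoodCohomologyTheory
        (fun n (P : EquivKTheory.GCWPair.{u, v} G) => EquivKTheory.KF F n P)
        (fun n _ _ f => EquivKTheory.KF.res n f) := by
  have : ProperSpace E := FiniteDimensional.proper_real E
  have : LocallyCompactSpace G := ChartedSpace.locallyCompactSpace E G
  refine ⟨fun n P => (EquivKTheory.KF.equivRelClass F P n).addCommGroup, fun n P a b =>
    ⟨EquivKTheory.ofAdjoint (EquivKTheory.adjoint a + EquivKTheory.adjoint b),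
      EquivKTheory.isConcat_ofAdjoint_add a b, rfl⟩, ?_⟩
  let _ : ∀ n (P : EquivKTheory.GCWPair.{u, v} G), AddCommGroup (EquivKTheory.KF F n P) :=
    fun n P => (EquivKTheory.KF.equivRelClass F P n).addCommGroup
  exact EquivKTheory.isGoodCohomologyTheory_relClass.of_equiv
    (fun n P => (EquivKTheory.KF.equivRelClass F P n).addEquiv)
    fun n P Q f a => EquivKTheory.KF.equivRelClass_res f a
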